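/- **Theorem 3.1.** Let $a_1,a_2,c_1,c_2,c_3>0$ and $p_O>0$. A particle of unit mass moves freely in $[-a_1,a_2]$ between instantaneous collisions. The walls $q=-a_1$ and $q=a_2$ always reflect it; the interior wall $q=0$ reflects it (on both faces) when its speed is at most $p_O$, and is passed freely when its speed exceeds $p_O$. The particle starts at $q_0\in[-a_1,a_2]$ with velocity $p_0>p_O$. At the $k$-th collision with the wall $a_2$, $-a_1$, $0$, respectively, its velocity $p$ is replaced by $-p(1-\varepsilon c_2-\varepsilon\delta\xi_k)$, $-p(1-\varepsilon c_1-\varepsilon\delta\eta_k)$, $-p(1-\varepsilon c_3-\varepsilon\delta\zeta_k)$. Here $\xi_k,\eta_k,\zeta_k$ ($k\ge1$) are independent real random variables, each of the three sequences is identically distributed with a continuous density, and almost surely all of them lie in $(\alpha,\beta)$, where $\alpha<\beta$ are real numbers. Let $X^{\varepsilon,\delta}_t=(q(t),p(t))$ be the right-continuous trajectory and $\widetilde X^{\varepsilon,\delta}_t=X^{\varepsilon,\delta}_{t/\varepsilon}$. Put $H(q,p)=p^2/2$, $H(O)=p_O^2/2$, $H_0=p_0^2/2$. Let $\Gamma$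 be the graph with coordinates $(H,K)$, made of the edges $I_1$ (well $q<0$) and $I_2$ (well $q>0$), on which $0\le H\le H(O)$, and $I_3$, on which $H\ge H(O)$, glued at the vertex $O$ where $H=H(O)$, with the shortest-path metric. Let $\widehat H^{\varepsilon,\delta}$ be the continuous piecewise-linear function obtained by joining by line segments the starting point and the successive points of the graph of $t\mapsto H(\widetilde X^{\varepsilon,\delta}_t)$ at the collision times. Let $\widehat Y^{\varepsilon,\delta}_t\in\Gamma$ be the point with energy $\widehat H^{\varepsilon,\delta}(t)$ that lies on $I_3$ if this energy is at least $H(O)$, and otherwise on the edge of the well in which the particle is at the right end of the segment. Let $Y$ be the process on $\Gamma$ that starts on $I_3$, satisfies $$H(t)=\Big(\tfrac{t}{\sqrt2}\tfrac{c_1+c_2}{a_1+a_2}+H_0^{-1/2}\Big)^{-2}\quad\text{on } I_3,\ \text{for } 0\le t\le t_0=\tfrac{\sqrt2\,(a_1+a_2)}{c_1+c_2}\big(H(O)^{-1/2}-H_0^{-1/2}\big),$$ goes at time $t_0$ from $O$ immediately into $I_1$ or $I_2$ with probabilities $\frac{c_1}{c_1+c_2}$ and $\frac{c_2}{c_1+c_2}$,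 and satisfies, for $t\ge t_0$, $$H(t)=\Big(\tfrac{t-t_0}{\sqrt2}\tfrac{c_i+c_3}{a_i}+H(O)^{-1/2}\Big)^{-2}\quad\text{on } I_i,\ i=1,2.$$ Then for every $T>0$ the process $\widehat Y^{\varepsilon,\delta}$ converges weakly to $Y$ in $C([0,T],\Gamma)$ with the uniform topology, as first $\varepsilon\downarrow0$ and then $\delta\downarrow0$. That is, for every $\delta>0$ with $c_i+\delta\alpha>0$ for $i=1,2,3$ (every $\delta>0$ if $\alpha\ge0$), the paths of $\widehat Y^{\varepsilon,\delta}$ are almost surely continuous for all small $\varepsilon>0$, and $\widehat Y^{\varepsilon,\delta}$ converges weakly as $\varepsilon\downarrow0$ to some law $\nu_\delta$ on $C([0,T],\Gamma)$; and $\nu_\delta$ converges weakly to the law of $Y$ as $\delta\downarrow0$. -/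

import Mathlib

open MeasureTheory ProbabilityTheory Filter Topology Set

open scoped BoundedContinuousFunction NNReal ENNReal

noncomputable section

namespace NearlyElastic

/-! ### The graph of the slow component -/

/-- The two trapping wells: `left` is `q < 0`, `right` is `q > 0`. -/
inductive Well
  | left
  | right
  deriving DecidableEq

/-- The three edges of the graph: `trap left` is `I₁`, `trap right` is `I₂`, and `top` is `I₃`. -/
inductive Edge
  | trap (w : Well)
  | top
  deriving DecidableEq

/-- The graph `Γ` in its global coordinates `(H, K)` (energy and number of the edge): the edges
`I₁`, `I₂` carry the energies in `[0, hO]`, the edge `I₃` the energies in `[hO, ∞)`, and the three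
ends at energy `hO` are glued to the interior vertex `O`, which is represented as `(hO, I₃)`. -/
@[ext] structure Graph (hO : ℝ) where
  H : ℝ
  K : Edge
  le_of_top : K = Edge.top → hO ≤ H
  nonneg_of_trap : K ≠ Edge.top → 0 ≤ H
  lt_of_trap : K ≠ Edge.top → H < hO

/-- The length of the shortest path on the graph: inside an edge it is the difference of the
energies, and between different edges the path passes through the vertex `O`. -/
instance (hO : ℝ) : Dist (Graph hO) where
  dist x y := if x.K = y.K then |x.H - y.H| else |x.H - hO| + |y.H - hO|

theorem Graph.dist_def {hO : ℝ} (x y : Graph hO) :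
    dist x y = if x.K = y.K then |x.H - y.H| else |x.H - hO| + |y.H - hO| := rfl

instance (hO : ℝ) : MetricSpace (Graph hO) where
  dist_self x := by simp [Graph.dist_def]
  dist_comm x y := by
    rw [Graph.dist_def, Graph.dist_def, abs_sub_comm x.H y.H, add_comm |x.H - hO|]
    simp only [eq_comm]
  dist_triangle x y z := by
    simp only [Graph.dist_def]
    have h1 := abs_sub_le x.H y.H z.H
    have h2 := abs_sub_le x.H y.H hO
    have h3 := abs_sub_le z.H y.H hO
    have h4 := abs_sub_le x.H hO z.H
    have h5 := abs_sub_comm z.H y.H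
    have h6 := abs_sub_comm hO z.H
    have h7 := abs_nonneg (y.H - hO)
    split_ifs <;> first | linarith | simp_all
  eq_of_dist_eq_zero := by
    intro x y h
    rw [Graph.dist_def] at h
    split_ifs at h with hK
    · exact Graph.ext (by linarith [abs_eq_zero.1 h]) hK
    · exfalso
      have hx : x.H = hO := by
        have := abs_nonneg (y.H - hO)
        have := abs_nonneg (x.H - hO)
        linarith [abs_eq_zero.1 (show |x.H - hO| = 0 by linarith)]
      have hy : y.H = hO := by
        have := abs_nonneg (y.H - hO)
        have := abs_nonneg (x.H - hO)
        linarith [abs_eq_zero.1 (show |y.H - hO| = 0 by linarith)]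
      by_cases hxt : x.K = Edge.top
      · have := y.lt_of_trap (fun hyt => hK (hxt.trans hyt.symm))
        linarith
      · have := x.lt_of_trap hxt
        linarith

/-- The point of the graph with energy `h` that lies on `I₃` if `hO ≤ h`, and on the lower edge of
the well `w` if `h < hO`. (Energies are nonnegative; a negative `h` is read as `0`.) -/
def Graph.point {hO : ℝ} (hpos : 0 < hO) (w : Well) (h : ℝ) : Graph hO where
  H := max h 0
  K := if hO ≤ h then Edge.top else Edge.trap w
  le_of_top hK := by
    by_cases hh : hO ≤ h
    · exact hh.trans (le_max_left _ _)
    · simp [hh] at hK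
  nonneg_of_trap _ := le_max_right _ _
  lt_of_trap hK := by
    by_cases hh : hO ≤ h
    · simp [hh] at hK
    · exact max_lt (not_le.1 hh) hpos

theorem Graph.continuous_point {hO : ℝ} (hpos : 0 < hO) (w : Well) :
    Continuous (Graph.point hpos w) := by
  have : LipschitzWith 1 (Graph.point hpos w) := by
    refine LipschitzWith.of_dist_le_mul fun x y => ?_
    have key : |max x 0 - max y 0| ≤ |x - y| := abs_max_sub_max_le_abs x y 0
    have hd : dist (Graph.point hpos w x) (Graph.point hpos w y) = |max x 0 - max y 0| := by
      rw [Graph.dist_def]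
      by_cases hx : hO ≤ x <;> by_cases hy : hO ≤ y
      · simp [Graph.point, hx, hy]
      · have h1 : hO ≤ max x 0 := hx.trans (le_max_left _ _)
        have h2 : max y 0 ≤ hO := max_le (not_le.1 hy).le hpos.le
        simp only [Graph.point, hx, hy, if_true, if_false, reduceCtorEq]
        rw [abs_of_nonneg (by linarith), abs_of_nonpos (by linarith), abs_of_nonneg (by linarith)]
        ring
      · have h1 : hO ≤ max y 0 := hy.trans (le_max_left _ _)
        have h2 : max x 0 ≤ hO := max_le (not_le.1 hx).le hpos.le
        simp only [Graph.point, hx, hy, if_true, if_false, reduceCtorEq]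
        rw [abs_of_nonpos (by linarith), abs_of_nonneg (by linarith), abs_of_nonpos (by linarith)]
        ring
      · simp [Graph.point, hx, hy]
    rw [hd, Real.dist_eq]
    simpa using key
  exact this.continuous

/-- Continuous paths `[0, T] → Γ`; the topology of `C(_, _)` is that of uniform convergence. -/
abbrev PathSpace (T hO : ℝ) : Type := C(Icc (0 : ℝ) T, Graph hO)

instance (T hO : ℝ) : MeasurableSpace (PathSpace T hO) := borel _

instance (T hO : ℝ) : BorelSpace (PathSpace T hO) := ⟨rfl⟩

/-! ### The nearly-elastic motion -/

/-- The walls `q = -a₁`, `q = 0` (interior wall, with two faces) and `q = a₂`. -/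
inductive Wall
  | left
  | middle
  | right
  deriving DecidableEq

/-- The parameters of the model with two wells: the walls `-a₁ < 0 < a₂`, the constants `c₁`, `c₂`,
`c₃` of the walls `-a₁`, `a₂`, `0`, the speed `pO` at the top of the interior wall, and the starting
point `(q₀, p₀)`, whose speed suffices to pass over the interior wall. -/
structure Model where
  a₁ : ℝ
  a₂ : ℝ
  c₁ : ℝ
  c₂ : ℝ
  c₃ : ℝ
  pO : ℝ
  q₀ : ℝ
  p₀ : ℝ
  a₁_pos : 0 < a₁
  a₂_pos : 0 < a₂
  c₁_pos : 0 < c₁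
  c₂_pos : 0 < c₂
  c₃_pos : 0 < c₃
  pO_pos : 0 < pO
  q₀_mem : q₀ ∈ Icc (-a₁) a₂
  pO_lt : pO < p₀

namespace Model

variable (M : Model)

/-- The position of a wall. -/
def wallPos : Wall → ℝ
  | .left => -M.a₁
  | .middle => 0
  | .right => M.a₂

/-- The constant in the restitution coefficient of a wall. -/
def c : Wall → ℝ
  | .left => M.c₁
  | .middle => M.c₃
  | .right => M.c₂

/-- The energy `H(O)` of the interior vertex. -/
def hO : ℝ := M.pO ^ 2 / 2

theorem hO_pos : 0 < M.hO := by
  have := M.pO_pos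
  unfold hO
  positivity

/-- The energy `H₀` of the starting point. -/
def h₀ : ℝ := M.p₀ ^ 2 / 2

theorem h₀_pos : 0 < M.h₀ := by
  have := M.pO_pos.trans M.pO_lt
  unfold h₀
  positivity

/-- The situation right after a collision (or at the start): the time, the point of the phase space,
and how often each wall has been hit so far. -/
structure State where
  time : ℝ
  q : ℝ
  p : ℝ
  hits : Wall → ℕ

/-- The wall that a particle at `q` with velocity `p ≠ 0` hits next. A particle with `|p| ≤ pO`
does not pass `q = 0`. -/
def nextWall (q p : ℝ) : Wall :=
  if 0 < p then
    if q < 0 ∧ |p| ≤ M.pO then Wall.middle else Wall.right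
  else
    if 0 < q ∧ |p| ≤ M.pO then Wall.middle else Wall.left

/-- Free flight to the next wall `w`, and reflection there with the restitution coefficient
`1 - ε c_w - ε δ (z w k)`, where `z w k` is the noise for the hit number `k + 1` of that wall. -/
def collide (ε δ : ℝ) (z : Wall → ℕ → ℝ) (s : State) : State :=
  let w := M.nextWall s.q s.p
  { time := s.time + |M.wallPos w - s.q| / |s.p|
    q := M.wallPos w
    p := -s.p * (1 - ε * M.c w - ε * δ * z w (s.hits w))
    hits := Function.update s.hits w (s.hits w + 1) }

/-- The state after `n` collisions. -/
def state (ε δ : ℝ) (z : Wall → ℕ → ℝ) : ℕ → State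
  | 0 => { time := 0, q := M.q₀, p := M.p₀, hits := fun _ => 0 }
  | n + 1 => M.collide ε δ z (state ε δ z n)

/-- The time of the `n`-th collision (`0` for `n = 0`). -/
def hitTime (ε δ : ℝ) (z : Wall → ℕ → ℝ) (n : ℕ) : ℝ := (M.state ε δ z n).time

/-- The number of collisions up to and including time `t ≥ 0`. -/
def numHits (ε δ : ℝ) (z : Wall → ℕ → ℝ) (t : ℝ) : ℕ := sSup {n : ℕ | M.hitTime ε δ z n ≤ t}

/-- The trajectory `X_t = (q(t), p(t))` of the particle, in the original time. -/
def trajectory (ε δ : ℝ) (z : Wall → ℕ → ℝ) (t : ℝ) : ℝ × ℝ :=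
  let s := M.state ε δ z (M.numHits ε δ z t)
  (s.q + s.p * (t - s.time), s.p)

/-- The energy of a point of the phase space. -/
def energy (x : ℝ × ℝ) : ℝ := x.2 ^ 2 / 2

/-- The side of the interior wall on which a point `(q, p)` of the phase space lies; a particle
that is leaving the face of the interior wall belongs to the side into which it moves. -/
def side (x : ℝ × ℝ) : Well :=
  if x.1 < 0 ∨ (x.1 = 0 ∧ x.2 < 0) then Well.left else Well.right

/-- The path `t ↦ Ŷ_t` on the graph, in the rescaled time (`t` stands for the original time `t / ε`).
The step function `t ↦ H(X_{t/ε})` is replaced by the piecewise linear function that connects its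
neighboring discontinuity points (and the starting point) by segments, and the corresponding points
of the graph are connected along the graph: a segment that leads below `H(O)` does so in the edge of
the well where the particle is at the right end of the segment. -/
def slowPath (ε δ : ℝ) (z : Wall → ℕ → ℝ) (t : ℝ) : Graph M.hO :=
  let n := M.numHits ε δ z (t / ε)
  let s₁ := M.hitTime ε δ z n
  let s₂ := M.hitTime ε δ z (n + 1)
  let h₁ := energy (M.trajectory ε δ z s₁)
  let h₂ := energy (M.trajectory ε δ z s₂)
  Graph.point M.hO_pos (side (M.trajectory ε δ z s₂))
    (h₁ + (t / ε - s₁) / (s₂ - s₁) * (h₂ - h₁))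

open Classical in
/-- `slowPath` on `[0, T]` as an element of the path space (a constant path where it fails to be
continuous). -/
def slowPathC (T ε δ : ℝ) (z : Wall → ℕ → ℝ) : PathSpace T M.hO :=
  if h : Continuous fun t : Icc (0 : ℝ) T => M.slowPath ε δ z t then ⟨_, h⟩
  else ContinuousMap.const _ (Graph.point M.hO_pos Well.left M.hO)

/-! ### The limiting process -/

/-- The time at which the limiting process reaches the vertex `O`. -/
def t₀ : ℝ :=
  √2 * (M.a₁ + M.a₂) * (M.hO ^ (-1 / 2 : ℝ) - M.h₀ ^ (-1 / 2 : ℝ)) / (M.c₁ + M.c₂)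

/-- The width of a well: `a₁` or `a₂`. -/
def wellWidth : Well → ℝ
  | .left => M.a₁
  | .right => M.a₂

/-- The constant of the outer wall of a well: `c₁` or `c₂`. -/
def wellC : Well → ℝ
  | .left => M.c₁
  | .right => M.c₂

/-- The energy before `t₀`, on `I₃`. -/
def limitEnergyTop (t : ℝ) : ℝ :=
  (t / √2 * ((M.c₁ + M.c₂) / (M.a₁ + M.a₂)) + M.h₀ ^ (-1 / 2 : ℝ)) ^ (-2 : ℝ)

/-- The energy after `t₀`, on the edge of the well `w`. -/
def limitEnergyTrap (w : Well) (t : ℝ) : ℝ :=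
  ((t - M.t₀) / √2 * ((M.wellC w + M.c₃) / M.wellWidth w) + M.hO ^ (-1 / 2 : ℝ)) ^ (-2 : ℝ)

/-- The energy `H(t)` of the limiting process that enters the well `w`. -/
def limitEnergy (w : Well) (t : ℝ) : ℝ :=
  if t ≤ M.t₀ then M.limitEnergyTop t else M.limitEnergyTrap w t

theorem limitEnergyTop_t₀ : M.limitEnergyTop M.t₀ = M.hO := by
  have h1 := M.a₁_pos
  have h2 := M.a₂_pos
  have h3 := M.c₁_pos
  have h4 := M.c₂_pos
  have h : M.t₀ / √2 * ((M.c₁ + M.c₂) / (M.a₁ + M.a₂)) + M.h₀ ^ (-1 / 2 : ℝ)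
      = M.hO ^ (-1 / 2 : ℝ) := by
    have : √2 ≠ 0 := by positivity
    have : M.a₁ + M.a₂ ≠ 0 := by positivity
    have : M.c₁ + M.c₂ ≠ 0 := by positivity
    unfold t₀
    field_simp
    ring
  rw [limitEnergyTop, h, ← Real.rpow_mul M.hO_pos.le]
  norm_num

theorem limitEnergyTrap_t₀ (w : Well) : M.limitEnergyTrap w M.t₀ = M.hO := by
  rw [limitEnergyTrap, sub_self, zero_div, zero_mul, zero_add, ← Real.rpow_mul M.hO_pos.le]
  norm_num

theorem continuousOn_limitEnergy (w : Well) : ContinuousOn (M.limitEnergy w) (Ici 0) := by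
  have h1 := M.a₁_pos
  have h2 := M.a₂_pos
  have h3 := M.c₁_pos
  have h4 := M.c₂_pos
  have hO := Real.rpow_pos_of_pos M.hO_pos (-1 / 2)
  have h₀ := Real.rpow_pos_of_pos M.h₀_pos (-1 / 2)
  have hw : 0 ≤ (M.wellC w + M.c₃) / M.wellWidth w := by
    have := M.c₃_pos
    cases w <;> simp only [wellC, wellWidth] <;> positivity
  unfold limitEnergy
  refine ContinuousOn.if ?_ ?_ ?_
  · rintro t ⟨-, ht⟩
    have : t = M.t₀ := by simpa using frontier_le_subset_eq continuous_id continuous_const ht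
    rw [this, limitEnergyTop_t₀, limitEnergyTrap_t₀]
  · refine ContinuousOn.rpow_const (by fun_prop) ?_
    rintro t ⟨ht, -⟩
    left
    have : (0 : ℝ) ≤ t := ht
    positivity
  · refine ContinuousOn.rpow_const (by fun_prop) ?_
    rintro t ⟨-, ht⟩
    left
    have : M.t₀ ≤ t := closure_lt_subset_le continuous_const continuous_id (by simpa using ht)
    have : 0 ≤ t - M.t₀ := by linarith
    positivity

/-- The path of the limiting process that enters the edge of the well `w` at the vertex `O`. -/
def limitPath (T : ℝ) (w : Well) : PathSpace T M.hO where
  toFun t := Graph.point M.hO_pos w (M.limitEnergy w t)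
  continuous_toFun := (Graph.continuous_point M.hO_pos w).comp
    ((M.continuousOn_limitEnergy w).comp_continuous continuous_subtype_val fun t => t.2.1)

/-- The probability to branch into the well `w`: `c₁ / (c₁ + c₂)` or `c₂ / (c₁ + c₂)`. -/
def branchProb (w : Well) : ℝ := M.wellC w / (M.c₁ + M.c₂)

/-- The law of the limiting process `Y` on `C([0, T], Γ)`. -/
def limitLaw (T : ℝ) : ProbabilityMeasure (PathSpace T M.hO) :=
  ⟨ENNReal.ofReal (M.branchProb Well.left) • Measure.dirac (M.limitPath T Well.left)
    + ENNReal.ofReal (M.branchProb Well.right) • Measure.dirac (M.limitPath T Well.right), by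
    have h1 := M.c₁_pos
    have h2 := M.c₂_pos
    constructor
    simp only [Measure.coe_add, Measure.coe_smul, Pi.add_apply, Pi.smul_apply, measure_univ,
      smul_eq_mul, mul_one, branchProb, wellC]
    rw [← ENNReal.ofReal_add (by positivity) (by positivity), ← add_div,
      div_self (by positivity), ENNReal.ofReal_one]⟩

end Model

/-- The random elements `X i` (measurable for all `i` far enough along the filter `l`) converge
weakly to the law `ν`. -/
def ConvergesWeakly {Ω ι E : Type*} [MeasurableSpace Ω] [TopologicalSpace E] [MeasurableSpace E]
    (P : Measure Ω) (X : ι → Ω → E) (l : Filter ι) (ν : Measure E) : Prop :=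
  (∀ᶠ i in l, AEMeasurable (X i) P) ∧
    ∀ F : E →ᵇ ℝ, Tendsto (fun i => ∫ ω, F (X i ω) ∂P) l (𝓝 (∫ x, F x ∂ν))

/-- The real random variable `X` has a continuous density. -/
def HasContinuousDensity {Ω : Type*} [MeasurableSpace Ω] (P : Measure Ω) (X : Ω → ℝ) : Prop :=
  ∃ f : ℝ → ℝ≥0, Continuous f ∧ P.map X = volume.withDensity fun x => (f x : ℝ≥0∞)

end NearlyElastic

end

/-! The proof separates two effects: averaging, which makes the energy deterministic once the final
well is known, and branching, which decides the well.

Averaging. Let `u` be the inverse speed. A collision increases `u` by about `ε * loss * u`, and a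
flight of length `d` lasts `ε * d * u` in the rescaled time. The quotient does not contain `u`, so
`u` is nearly linear in time, with slope the mean loss divided by the width of the region: one slope
above the interior wall, another in the well. The losses are replaced by their means by the strong
law of large numbers and a summation by parts against the monotone sequence `u` (`abs_sum_mul_le`).
This gives an error bound uniform on `[0, T]` (`exists_error_bound`,
`eventually_abs_segment_sub_le`), and the energy is `1 / (2 * u ^ 2)`.

Branching. Above the interior wall the collisions alternate between the right and the left wall,
beginning with the right one. The logarithmic decrement of the speed, divided by `ε`, is thus an
alternating sum of independent positive steps `logStep`, and the particle is trapped on the right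
exactly when the level `log (p₀ / pO) / ε` is passed by a right step (`Regular.inFirst_iff`). As the
level grows, the probability of this tends to the mean right step over the mean of a pair of steps.
Since the law of the steps changes with `ε` together with the level, the renewal theorem must have a
rate that depends only on bounds for the steps and on a lower bound for their law
(`RenewalData.renewal_limit`). Its proof: beyond the range of one step the passage probability is
harmonic for the random walk; a Harnack inequality makes its oscillation decay geometrically; the
integrated renewal equation identifies the limit. The continuous density enters only through a
multiple of Lebesgue measure on some interval below the law of the noise.

For fixed `δ` the limit as `ε ↓ 0` is therefore a mixture of two deterministic paths
(`convergesWeakly_slowPathC`). Its weights and paths are continuous functions of the mean losses `c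
w + δ * E[noise w]`, so the limit `δ ↓ 0` is a matter of continuity (`tendsto_meanLaw`). -/

noncomputable section

namespace NearlyElastic

/-! ### A renewal theorem that is uniform in the law of the steps -/

/-- Lower bound for the convolution of the indicator functions of two intervals. -/
theorem lintegral_add_Icc_ge {h : ℝ → ℝ≥0∞} (hh : Measurable h) {a b a' b' r : ℝ}
    (h1 : r ≤ b - a) (h2 : r ≤ b' - a') :
    ENNReal.ofReal r * ∫⁻ s in Icc (a + a' + r) (b + b' - r), h s
      ≤ ∫⁻ z in Icc a b, ∫⁻ t in Icc a' b', h (z + t) := by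
  have e1 : ∀ z : ℝ, ∫⁻ t in Icc a' b', h (z + t)
      = ∫⁻ s, (Icc (z + a') (z + b')).indicator h s := by
    intro z
    rw [← lintegral_indicator measurableSet_Icc,
      ← lintegral_add_left_eq_self (fun s => (Icc (z + a') (z + b')).indicator h s) z]
    refine lintegral_congr fun t => ?_
    by_cases ht : t ∈ Icc a' b'
    · have : z + t ∈ Icc (z + a') (z + b') := ⟨by linarith [ht.1], by linarith [ht.2]⟩
      simp [ht, this]
    · have : z + t ∉ Icc (z + a') (z + b') :=
        fun h => ht ⟨by linarith [h.1], by linarith [h.2]⟩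
      simp [ht, this]
  simp_rw [e1]
  have hmeas : Measurable (Function.uncurry fun (z s : ℝ) =>
      (Icc (z + a') (z + b')).indicator h s) := by
    have : (Function.uncurry fun (z s : ℝ) => (Icc (z + a') (z + b')).indicator h s)
        = {p : ℝ × ℝ | p.1 + a' ≤ p.2 ∧ p.2 ≤ p.1 + b'}.indicator (fun p => h p.2) := by
      ext p
      simp only [Function.uncurry, Set.indicator, mem_Icc, mem_ofPred_eq]
    rw [this]
    refine (hh.comp measurable_snd).indicator ?_
    exact (measurableSet_le (measurable_fst.add_const a') measurable_snd).inter
      (measurableSet_le measurable_snd (measurable_fst.add_const b'))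
  rw [lintegral_lintegral_swap hmeas.aemeasurable, ← lintegral_const_mul _ hh,
    ← lintegral_indicator measurableSet_Icc]
  refine lintegral_mono fun s => ?_
  by_cases hs : s ∈ Icc (a + a' + r) (b + b' - r)
  · rw [indicator_of_mem hs]
    have : ∀ z, (Icc (z + a') (z + b')).indicator h s
        = (Icc (s - b') (s - a')).indicator (fun _ => h s) z := by
      intro z
      by_cases hz : z ∈ Icc (s - b') (s - a')
      · have : s ∈ Icc (z + a') (z + b') := ⟨by linarith [hz.2], by linarith [hz.1]⟩
        simp [hz, this]
      · have : s ∉ Icc (z + a') (z + b') :=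
          fun h => hz ⟨by linarith [h.2], by linarith [h.1]⟩
        simp [hz, this]
    simp_rw [this]
    rw [lintegral_indicator_const measurableSet_Icc, mul_comm]
    gcongr
    rw [Measure.restrict_apply measurableSet_Icc, Icc_inter_Icc, Real.volume_Icc]
    apply ENNReal.ofReal_le_ofReal
    rcases hs with ⟨hs1, hs2⟩
    have : (s - b') ⊔ a ≤ (s - a') ⊓ b - r :=
      sup_le (by rw [le_sub_iff_add_le]; exact le_inf (by linarith) (by linarith))
        (by rw [le_sub_iff_add_le]; exact le_inf (by linarith) (by linarith))
    linarith
  · rw [indicator_of_notMem hs]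
    exact zero_le

/-- The hypotheses of the renewal theorem: `g ℓ` is the probability that the level `ℓ` lies in the
first part, of length `A`, of a renewal interval of length `Z`. -/
structure RenewalData {Ω : Type*} [MeasurableSpace Ω] (P : Measure Ω) (R a b : ℝ) (η : ℝ≥0)
    (c₀ : ℝ) (A Z : Ω → ℝ) (g : ℝ → ℝ) : Prop where
  measA : Measurable A
  measZ : Measurable Z
  measg : Measurable g
  A_nonneg : ∀ ω, 0 ≤ A ω
  A_le : ∀ ω, A ω ≤ R
  le_Z : ∀ ω, c₀ ≤ Z ω
  Z_le : ∀ ω, Z ω ≤ R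
  g_nonneg : ∀ x, 0 ≤ g x
  g_le : ∀ x, g x ≤ 1
  g_zero : ∀ x ≤ 0, g x = 0
  renewal : ∀ x, g x = P.real {ω | 0 < x ∧ x ≤ A ω} + ∫ ω, g (x - Z ω) ∂P
  minor : η • volume.restrict (Icc a b) ≤ P.map Z

namespace RenewalData

variable {Ω : Type*} [MeasurableSpace Ω] {P : Measure Ω} [IsProbabilityMeasure P] {R a b c₀ : ℝ}
  {η : ℝ≥0} {A Z : Ω → ℝ} {g : ℝ → ℝ}

theorem integrable_g (D : RenewalData P R a b η c₀ A Z g) (x : ℝ) :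
    Integrable (fun ω => g (x - Z ω)) P :=
  Integrable.of_bound (D.measg.comp (measurable_const.sub D.measZ)).aestronglyMeasurable 1
    (ae_of_all _ fun ω => by
      rw [Real.norm_eq_abs, abs_of_nonneg (D.g_nonneg _)]; exact D.g_le _)

-- Beyond `R` the source term of the renewal equation vanishes, because `A ≤ R`. There `g` is a mean
-- of its own earlier values, which is what the maximum principle and the Harnack inequality
-- exploit.
omit [IsProbabilityMeasure P] in
theorem harmonic (D : RenewalData P R a b η c₀ A Z g) {x : ℝ} (hx : R < x) :
    g x = ∫ ω, g (x - Z ω) ∂P := by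
  rw [D.renewal x]
  have : {ω | 0 < x ∧ x ≤ A ω} = ∅ := by
    ext ω
    simp only [mem_ofPred_eq, mem_empty_iff_false, iff_false, not_and, not_le]
    exact fun _ => (D.A_le ω).trans_lt hx
  simp [this]

omit [IsProbabilityMeasure P] in
theorem intervalIntegrable_g (D : RenewalData P R a b η c₀ A Z g) (u v : ℝ) :
    IntervalIntegrable g volume u v :=
  (intervalIntegrable_const (c := (1 : ℝ))).mono_fun D.measg.aestronglyMeasurable
    (ae_of_all _ fun t => by
      simpa [abs_of_nonneg (D.g_nonneg t)] using D.g_le t)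

theorem integrable_Z (D : RenewalData P R a b η c₀ A Z g) (hc : 0 < c₀) : Integrable Z P :=
  Integrable.of_bound D.measZ.aestronglyMeasurable R
    (ae_of_all _ fun ω => by
      rw [Real.norm_eq_abs, abs_of_nonneg (hc.le.trans (D.le_Z ω))]; exact D.Z_le ω)

theorem integrable_primitive (D : RenewalData P R a b η c₀ A Z g) (hc : 0 < c₀) (s : ℝ) :
    Integrable (fun ω => ∫ t in (0 : ℝ)..(s - Z ω), g t) P := by
  have hcont : Continuous fun u : ℝ => ∫ t in (0 : ℝ)..u, g t :=
    intervalIntegral.continuous_primitive D.intervalIntegrable_g 0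
  refine Integrable.of_bound
    (hcont.measurable.comp (measurable_const.sub D.measZ)).aestronglyMeasurable (|s| + R)
    (ae_of_all _ fun ω => ?_)
  have := intervalIntegral.norm_integral_le_of_norm_le_const (a := 0) (b := s - Z ω)
    (f := g) (C := 1) (fun t _ => by
      rw [Real.norm_eq_abs, abs_of_nonneg (D.g_nonneg _)]; exact D.g_le t)
  refine this.trans ?_
  rw [one_mul, sub_zero]
  refine (abs_sub _ _).trans ?_
  rw [abs_of_nonneg (hc.le.trans (D.le_Z ω))]
  linarith [D.Z_le ω]

/-- Maximum principle. -/
theorem le_of_window (D : RenewalData P R a b η c₀ A Z g) (hc : 0 < c₀) {L M : ℝ} (hL : 0 ≤ L)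
    (h : ∀ x ∈ Icc L (L + R), g x ≤ M) (x : ℝ) (hx : L ≤ x) : g x ≤ M := by
  have key : ∀ n : ℕ, ∀ x, L ≤ x → x ≤ L + R + n * c₀ → g x ≤ M := by
    intro n
    induction n with
    | zero => intro x h1 h2; exact h x ⟨h1, by simpa using h2⟩
    | succ n ih =>
      intro x h1 h2
      by_cases hxR : x ≤ L + R
      · exact h x ⟨h1, hxR⟩
      · push Not at hxR
        rw [D.harmonic (by linarith)]
        calc ∫ ω, g (x - Z ω) ∂P ≤ ∫ _, M ∂P := by
              refine integral_mono (D.integrable_g x) (integrable_const _) fun ω => ?_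
              have := D.le_Z ω
              have := D.Z_le ω
              push_cast at h2
              exact ih _ (by linarith) (by linarith)
          _ = M := by simp
  obtain ⟨n, hn⟩ := exists_nat_ge ((x - (L + R)) / c₀)
  exact key n x hx (by rw [div_le_iff₀ hc] at hn; linarith)

theorem ge_of_window (D : RenewalData P R a b η c₀ A Z g) (hc : 0 < c₀) {L M : ℝ} (hL : 0 ≤ L)
    (h : ∀ x ∈ Icc L (L + R), M ≤ g x) (x : ℝ) (hx : L ≤ x) : M ≤ g x := by
  have key : ∀ n : ℕ, ∀ x, L ≤ x → x ≤ L + R + n * c₀ → M ≤ g x := by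
    intro n
    induction n with
    | zero => intro x h1 h2; exact h x ⟨h1, by simpa using h2⟩
    | succ n ih =>
      intro x h1 h2
      by_cases hxR : x ≤ L + R
      · exact h x ⟨h1, hxR⟩
      · push Not at hxR
        rw [D.harmonic (by linarith)]
        calc M = ∫ _, M ∂P := by simp
          _ ≤ ∫ ω, g (x - Z ω) ∂P := by
              refine integral_mono (integrable_const _) (D.integrable_g x) fun ω => ?_
              have := D.le_Z ω
              have := D.Z_le ω
              push_cast at h2
              exact ih _ (by linarith) (by linarith)
  obtain ⟨n, hn⟩ := exists_nat_ge ((x - (L + R)) / c₀)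
  exact key n x hx (by rw [div_le_iff₀ hc] at hn; linarith)

end RenewalData

/-- Harnack inequality: the constant, and the ends of the interval of integration, after `n + 1`
steps with a law that has density at least `η` on `[a, b]`. -/
theorem harnack {Ω : Type*} [MeasurableSpace Ω] {P : Measure Ω} {Z : Ω → ℝ} (hZ : Measurable Z)
    {R a b L : ℝ} {η : ℝ≥0} (hR : 0 ≤ R) (hab : a < b) (hbR : b ≤ R)
    (hminor : η • volume.restrict (Icc a b) ≤ P.map Z) {W : ℝ → ℝ≥0∞} (hW : Measurable W)
    (hsup : ∀ x, L + R < x → ∫⁻ ω, W (x - Z ω) ∂P ≤ W x) (n : ℕ) (x : ℝ)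
    (hx : L + (n + 1) * R < x) :
    (η * (η * ENNReal.ofReal ((b - a) / 4)) ^ n) *
      ∫⁻ t in Icc (a + n * (a + (b - a) / 4)) (b + n * (b - (b - a) / 4)), W (x - t) ≤ W x := by
  have step : ∀ x, L + R < x → (η : ℝ≥0∞) * ∫⁻ t in Icc a b, W (x - t) ≤ W x := by
    intro x hx
    refine le_trans ?_ (hsup x hx)
    have hm : Measurable fun t => W (x - t) := hW.comp (measurable_const.sub measurable_id)
    rw [← lintegral_map (μ := P) hm hZ]
    refine le_trans (le_of_eq ?_) (lintegral_mono' hminor le_rfl)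
    rw [lintegral_smul_measure]
    rfl
  induction n generalizing x with
  | zero => simpa using step x (by simpa using hx)
  | succ n ih =>
    have hn : (0 : ℝ) ≤ n := n.cast_nonneg
    push_cast at hx ⊢
    have hx1 : L + R < x := by nlinarith
    have hr : (b - a) / 4 ≤ b - a := by linarith
    have hr' : (b - a) / 4 ≤ (b + n * (b - (b - a) / 4)) - (a + n * (a + (b - a) / 4)) := by
      nlinarith [mul_nonneg hn (sub_pos.2 hab).le]
    have hm : Measurable fun s => W (x - s) := hW.comp (measurable_const.sub measurable_id)
    -- One more convolution trims `(b - a) / 4` at both ends of the sum of the two intervals, so the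
    -- interval still gains the length `(b - a) / 2`. The price is a factor `η * (b - a) / 4`.
    set K : ℝ≥0∞ := η * (η * ENNReal.ofReal ((b - a) / 4)) ^ n with hK
    calc (η * (η * ENNReal.ofReal ((b - a) / 4)) ^ (n + 1)) *
        ∫⁻ t in Icc (a + (n + 1) * (a + (b - a) / 4)) (b + (n + 1) * (b - (b - a) / 4)), W (x - t)
        = η * (K * (ENNReal.ofReal ((b - a) / 4) *
          ∫⁻ t in Icc (a + (a + n * (a + (b - a) / 4)) + (b - a) / 4)
            (b + (b + n * (b - (b - a) / 4)) - (b - a) / 4), W (x - t))) := by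
          rw [hK, pow_succ]
          have e1 : a + (n + 1) * (a + (b - a) / 4)
              = a + (a + n * (a + (b - a) / 4)) + (b - a) / 4 := by ring
          have e2 : b + (n + 1) * (b - (b - a) / 4)
              = b + (b + n * (b - (b - a) / 4)) - (b - a) / 4 := by ring
          rw [e1, e2]
          ring
      _ ≤ η * (K * ∫⁻ z in Icc a b,
          ∫⁻ t in Icc (a + n * (a + (b - a) / 4)) (b + n * (b - (b - a) / 4)),
            W (x - (z + t))) := by
          gcongr
          exact lintegral_add_Icc_ge hm hr hr'
      _ ≤ η * ∫⁻ z in Icc a b, W (x - z) := by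
          gcongr
          refine (lintegral_const_mul_le _ _).trans ?_
          refine setLIntegral_mono hm fun z hz => ?_
          have := ih (x - z) (by nlinarith [hz.2])
          simpa only [sub_sub] using this
      _ ≤ W x := step x hx1

namespace RenewalData

variable {Ω : Type*} [MeasurableSpace Ω] {P : Measure Ω} [IsProbabilityMeasure P] {R a b c₀ : ℝ}
  {η : ℝ≥0} {A Z : Ω → ℝ} {g : ℝ → ℝ}

omit [IsProbabilityMeasure P] in
/-- The lower bound of `harnack` for a nonnegative function bounded by `1`. -/
theorem harnack_real (D : RenewalData P R a b η c₀ A Z g) (hR : 0 < R) (hab : a < b) (hbR : b ≤ R)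
    {L : ℝ} {f : ℝ → ℝ} (hf : Measurable f) (hf1 : ∀ x, f x ≤ 1)
    (hf0 : ∀ x, L ≤ x → 0 ≤ f x) (hfh : ∀ x, L + R < x → f x = ∫ ω, f (x - Z ω) ∂P)
    (hfi : ∀ x, Integrable (fun ω => f (x - Z ω)) P) (n : ℕ) (x : ℝ) (hx : L + (n + 1) * R < x) :
    (η * (η * ((b - a) / 4)) ^ n) *
      ∫ t in (x - (b + n * (b - (b - a) / 4)))..(x - (a + n * (a + (b - a) / 4))), f t ≤ f x := by
  have hn : (0 : ℝ) ≤ n := n.cast_nonneg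
  have hsup : ∀ x, L + R < x →
      ∫⁻ ω, ENNReal.ofReal (f (x - Z ω)) ∂P ≤ ENNReal.ofReal (f x) := by
    intro x hx
    rw [hfh x hx, ofReal_integral_eq_lintegral_ofReal (hfi x)]
    exact ae_of_all _ fun ω => hf0 _ (by linarith [D.Z_le ω])
  have := harnack D.measZ hR.le hab hbR D.minor hf.ennreal_ofReal hsup n x hx
  set a' := a + n * (a + (b - a) / 4) with ha'
  set b' := b + n * (b - (b - a) / 4) with hb'
  have hab' : a' ≤ b' := by
    rw [ha', hb']; nlinarith [mul_nonneg hn (sub_pos.2 hab).le]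
  have hb'R : b' ≤ (n + 1) * R := by
    rw [hb']; nlinarith [mul_nonneg hn (sub_pos.2 hab).le]
  have hfx : 0 ≤ f x := hf0 x (by nlinarith)
  have h0 : ∀ t ∈ Icc a' b', 0 ≤ f (x - t) := fun t ht => hf0 _ (by linarith [ht.2])
  have hint : IntegrableOn (fun t => f (x - t)) (Icc a' b') := by
    refine Measure.integrableOn_of_bounded (M := 1) (by simp)
      (hf.comp (measurable_const.sub measurable_id)).aestronglyMeasurable ?_
    refine (ae_restrict_mem measurableSet_Icc).mono fun t ht => ?_
    rw [Real.norm_eq_abs, abs_of_nonneg (h0 t ht)]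
    exact hf1 _
  have hlin : ∫⁻ t in Icc a' b', ENNReal.ofReal (f (x - t))
      = ENNReal.ofReal (∫ t in (x - b')..(x - a'), f t) := by
    rw [← intervalIntegral.integral_comp_sub_left (fun t => f t) x,
      intervalIntegral.integral_of_le hab', ← integral_Icc_eq_integral_Ioc,
      ofReal_integral_eq_lintegral_ofReal hint]
    exact (ae_restrict_mem measurableSet_Icc).mono h0
  rw [hlin] at this
  have hba : 0 ≤ (b - a) / 4 := by linarith
  have e : (η * (η * ENNReal.ofReal ((b - a) / 4)) ^ n : ℝ≥0∞)
      = ENNReal.ofReal (η * (η * ((b - a) / 4)) ^ n) := by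
    rw [ENNReal.ofReal_mul (by positivity), ENNReal.ofReal_pow (by positivity),
      ENNReal.ofReal_mul (by positivity), ENNReal.ofReal_coe_nnreal]
  rw [e, ← ENNReal.ofReal_mul (by positivity)] at this
  exact (ENNReal.ofReal_le_ofReal_iff hfx).1 this

/-- The oscillation of `g` on a half-line contracts when the half-line is moved. -/
theorem osc_contract (D : RenewalData P R a b η c₀ A Z g) (hc : 0 < c₀) (hR : 0 < R) (hab : a < b)
    (hbR : b ≤ R) {n : ℕ} (hn : 2 * R ≤ (b - a) * (1 + n / 2)) {L d θ : ℝ} (hL : 0 ≤ L)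
    (hθ : θ = R * (η * (η * ((b - a) / 4)) ^ n))
    (hd : ∀ x y, L ≤ x → L ≤ y → g x - g y ≤ d) (x y : ℝ) (hx : L + (n + 2) * R ≤ x)
    (hy : L + (n + 2) * R ≤ y) : g x - g y ≤ (1 - min θ (1 / 2)) * d := by
  have hn0 : (0 : ℝ) ≤ n := n.cast_nonneg
  set K : ℝ := η * (η * ((b - a) / 4)) ^ n with hK
  have hba : 0 < b - a := by linarith
  have hK0 : 0 ≤ K := by positivity
  set s := g '' Ici L with hs
  have hbb : BddBelow s := ⟨0, by rintro _ ⟨x, -, rfl⟩; exact D.g_nonneg x⟩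
  have hba' : BddAbove s := ⟨1, by rintro _ ⟨x, -, rfl⟩; exact D.g_le x⟩
  have hne : s.Nonempty := ⟨g L, L, self_mem_Ici, rfl⟩
  set m := sInf s
  set M := sSup s
  have hm : ∀ x, L ≤ x → m ≤ g x := fun x hx => csInf_le hbb ⟨x, hx, rfl⟩
  have hM : ∀ x, L ≤ x → g x ≤ M := fun x hx => le_csSup hba' ⟨x, hx, rfl⟩
  have hm0 : 0 ≤ m := le_csInf hne (by rintro _ ⟨x, -, rfl⟩; exact D.g_nonneg x)
  have hM1 : M ≤ 1 := csSup_le hne (by rintro _ ⟨x, -, rfl⟩; exact D.g_le x)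
  have hMm : M - m ≤ d := by
    have h1 : ∀ y, L ≤ y → M ≤ d + g y := fun y hy =>
      csSup_le hne (by rintro _ ⟨x, hx, rfl⟩; linarith [hd x y hx hy])
    have h2 : M - d ≤ m := le_csInf hne (by rintro _ ⟨x, hx, rfl⟩; linarith [h1 x hx])
    linarith
  have hmM : m ≤ M := (hm L le_rfl).trans (hM L le_rfl)
  set L' := L + (n + 2) * R with hL'
  set a' := a + n * (a + (b - a) / 4) with ha'
  set b' := b + n * (b - (b - a) / 4) with hb'
  have hb'R : b' ≤ (n + 1) * R := by
    rw [hb']; nlinarith [mul_nonneg hn0 hba.le]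
  -- The interval of integration has length `(b - a) * (1 + n / 2)`. Length `2 * R` makes the
  -- intervals that belong to two points at distance at most `R` overlap in length at least `R`.
  have hlen : 2 * R ≤ b' - a' := by
    refine hn.trans (le_of_eq ?_)
    rw [hb', ha']; ring
  have hii := D.intervalIntegrable_g
  -- the common part of the intervals of integration
  have window : ∀ x ∈ Icc L' (L' + R), ∀ y ∈ Icc L' (L' + R),
      g x - g y ≤ (1 - min θ (1 / 2)) * d := by
    intro x hx y hy
    -- Harnack is applied to `g - m` at `y` and to `M - g` at `x`. Both functions are nonnegative
    -- and harmonic and their sum is the constant `M - m`, so on the common interval the two lower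
    -- bounds add up to at least `θ * (M - m)`. The oscillation loses this amount.
    have H1 := D.harnack_real hR hab hbR (L := L) (f := fun t => g t - m)
      (D.measg.sub_const m) (fun t => by linarith [D.g_le t])
      (fun t ht => by linarith [hm t ht])
      (fun t ht => by
        rw [integral_sub (D.integrable_g t) (integrable_const _), ← D.harmonic (by linarith)]
        simp)
      (fun t => (D.integrable_g t).sub (integrable_const _)) n y (by nlinarith [hy.1])
    have H2 := D.harnack_real hR hab hbR (L := L) (f := fun t => M - g t)
      (D.measg.const_sub M) (fun t => by linarith [D.g_nonneg t])
      (fun t ht => by linarith [hM t ht])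
      (fun t ht => by
        rw [integral_sub (integrable_const _) (D.integrable_g t), ← D.harmonic (by linarith)]
        simp)
      (fun t => (integrable_const _).sub (D.integrable_g t)) n x (by nlinarith [hx.1])
    rw [← hK, ← ha', ← hb'] at H1 H2
    have common : ∀ f : ℝ → ℝ, (∀ t, L ≤ t → 0 ≤ f t) → (∀ u v, IntervalIntegrable f volume u v) →
        ∀ z ∈ Icc L' (L' + R), ∫ t in (L' + R - b')..(L' - a'), f t
          ≤ ∫ t in (z - b')..(z - a'), f t := by
      intro f hf hfi z hz
      refine intervalIntegral.integral_mono_interval (by linarith [hz.2]) (by linarith)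
        (by linarith [hz.1]) ?_ (hfi _ _)
      refine (ae_restrict_mem measurableSet_Ioc).mono fun t ht => hf t ?_
      nlinarith [ht.1, hz.1]
    have C1 := common (fun t => g t - m) (fun t ht => by linarith [hm t ht])
      (fun u v => (hii u v).sub intervalIntegrable_const) y hy
    have C2 := common (fun t => M - g t) (fun t ht => by linarith [hM t ht])
      (fun u v => intervalIntegrable_const.sub (hii u v)) x hx
    have hsum : (∫ t in (L' + R - b')..(L' - a'), (g t - m))
        + ∫ t in (L' + R - b')..(L' - a'), (M - g t) = (b' - a' - R) * (M - m) := by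
      rw [← intervalIntegral.integral_add ((hii _ _).sub intervalIntegrable_const)
        (intervalIntegrable_const.sub (hii _ _))]
      have : ∀ t, (g t - m) + (M - g t) = M - m := fun t => by ring
      simp only [this, intervalIntegral.integral_const, smul_eq_mul]
      ring
    have h1 := mul_le_mul_of_nonneg_left C1 hK0
    have h2 := mul_le_mul_of_nonneg_left C2 hK0
    have h3 : K * (R * (M - m)) ≤ K * ((b' - a' - R) * (M - m)) := by
      gcongr
      linarith
    rw [← hsum, mul_add] at h3
    have h4 : min θ (1 / 2) * (M - m) ≤ θ * (M - m) :=
      mul_le_mul_of_nonneg_right (min_le_left _ _) (by linarith)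
    have h5 : (1 - min θ (1 / 2)) * (M - m) ≤ (1 - min θ (1 / 2)) * d :=
      mul_le_mul_of_nonneg_left hMm (by linarith [min_le_right θ (1 / 2)])
    have h6 : K * (R * (M - m)) = θ * (M - m) := by rw [hθ]; ring
    linarith
  have hL'0 : 0 ≤ L' := by positivity
  -- The maximum principle frees first `x` and then `y` from the window of length `R`.
  have step1 : ∀ y ∈ Icc L' (L' + R), ∀ x, L' ≤ x → g x - g y ≤ (1 - min θ (1 / 2)) * d := by
    intro y hy x hx
    have := D.le_of_window hc hL'0 (M := (1 - min θ (1 / 2)) * d + g y)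
      (fun x hx => by linarith [window x hx y hy]) x hx
    linarith
  have := D.ge_of_window hc hL'0 (M := g x - (1 - min θ (1 / 2)) * d)
      (fun y hy => by linarith [step1 y hy x hx]) y hy
  linarith

/-- The integrated renewal equation. -/
theorem integral_renewal (D : RenewalData P R a b η c₀ A Z g) (hc : 0 < c₀) {s : ℝ} (hs : R ≤ s)
    (hR : 0 < R) : ∫ ω, (∫ t in (s - Z ω)..s, g t) ∂P = ∫ ω, A ω ∂P := by
  have hii := D.intervalIntegrable_g
  have hs0 : 0 ≤ s := hR.le.trans hs
  have hAi : Integrable A P := Integrable.of_bound D.measA.aestronglyMeasurable R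
    (ae_of_all _ fun ω => by
      rw [Real.norm_eq_abs, abs_of_nonneg (D.A_nonneg ω)]; exact D.A_le ω)
  -- The layer-cake formula for `E[A]`; the integral may stop at `s` because `A ≤ R ≤ s`.
  have hA : ∫ t in (0 : ℝ)..s, P.real {ω | 0 < t ∧ t ≤ A ω} = ∫ ω, A ω ∂P := by
    rw [hAi.integral_eq_integral_meas_le (ae_of_all _ D.A_nonneg),
      intervalIntegral.integral_of_le hs0]
    symm
    rw [setIntegral_eq_of_subset_of_forall_sdiff_eq_zero measurableSet_Ioi
      (Ioc_subset_Ioi_self (a := s) (b := (0 : ℝ)))]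
    · refine setIntegral_congr_fun measurableSet_Ioc fun t ht => ?_
      have : 0 < t := ht.1
      simp [this]
    · intro t ht
      have ht0 : (0 : ℝ) < t := ht.1
      have hts : s < t := by
        by_contra! h
        exact ht.2 ⟨ht0, h⟩
      have : {ω | t ≤ A ω} = ∅ := by
        ext ω
        simp only [mem_ofPred_eq, mem_empty_iff_false, iff_false, not_le]
        linarith [D.A_le ω]
      simp [this]
  have hswap : ∫ t in (0 : ℝ)..s, ∫ ω, g (t - Z ω) ∂P
      = ∫ ω, (∫ t in (0 : ℝ)..(s - Z ω), g t) ∂P := by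
    rw [intervalIntegral.integral_of_le hs0, integral_integral_swap]
    · refine integral_congr_ae (ae_of_all _ fun ω => ?_)
      simp only
      rw [← intervalIntegral.integral_of_le hs0,
        intervalIntegral.integral_comp_sub_right (fun t => g t) (Z ω), zero_sub,
        ← intervalIntegral.integral_add_adjacent_intervals (hii (-Z ω) 0) (hii 0 (s - Z ω))]
      -- No mass of `g` lies to the left of `0`, so the shift by `Z` only shortens the interval of
      -- integration. Subtracting the two integrals leaves the last stretch, of length `Z`.
      have hz : ∫ t in (-Z ω)..0, g t = 0 := by
        rw [intervalIntegral.integral_of_le (by linarith [D.le_Z ω])]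
        refine setIntegral_eq_zero_of_forall_eq_zero fun t ht => D.g_zero t ht.2
      rw [hz, zero_add]
    · refine Integrable.of_bound (C := 1) ?_ (ae_of_all _ fun p => ?_)
      · exact (D.measg.comp (measurable_fst.sub
          (D.measZ.comp measurable_snd))).aestronglyMeasurable
      · simp only [Function.uncurry]
        rw [Real.norm_eq_abs, abs_of_nonneg (D.g_nonneg _)]; exact D.g_le _
  have htot : ∫ t in (0 : ℝ)..s, g t
      = ∫ ω, A ω ∂P + ∫ ω, (∫ t in (0 : ℝ)..(s - Z ω), g t) ∂P := by
    have hg2 : IntervalIntegrable (fun t => ∫ ω, g (t - Z ω) ∂P) volume 0 s := by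
      refine (intervalIntegrable_const (c := (1 : ℝ))).mono_fun ?_ (ae_of_all _ fun t => ?_)
      · have : StronglyMeasurable (Function.uncurry fun (t : ℝ) ω => g (t - Z ω)) :=
          (D.measg.comp (measurable_fst.sub (D.measZ.comp measurable_snd))).stronglyMeasurable
        exact this.integral_prod_right.aestronglyMeasurable
      · have := norm_integral_le_of_norm_le_const (μ := P) (C := 1)
          (f := fun ω => g (t - Z ω)) (ae_of_all _ fun ω => by
            rw [Real.norm_eq_abs, abs_of_nonneg (D.g_nonneg _)]; exact D.g_le _)
        simpa using this
    have hg1 : IntervalIntegrable (fun t => P.real {ω | 0 < t ∧ t ≤ A ω}) volume 0 s := by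
      refine ((hii 0 s).sub hg2).congr fun t _ => ?_
      linarith [D.renewal t]
    rw [← hA, ← hswap, ← intervalIntegral.integral_add hg1 hg2]
    exact intervalIntegral.integral_congr fun t _ => D.renewal t
  have hsplit : ∀ ω, ∫ t in (s - Z ω)..s, g t
      = (∫ t in (0 : ℝ)..s, g t) - ∫ t in (0 : ℝ)..(s - Z ω), g t := fun ω =>
    (intervalIntegral.integral_interval_sub_left (hii _ _) (hii _ _)).symm
  simp_rw [hsplit]
  rw [integral_sub (integrable_const _) (D.integrable_primitive hc s)]
  simp only [integral_const, probReal_univ, smul_eq_mul, one_mul]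
  linarith

/-- The renewal theorem, with a rate that depends only on the parameters. -/
theorem renewal_limit (P : Measure Ω) [IsProbabilityMeasure P] (hc : 0 < c₀) (hR : 0 < R)
    (hab : a < b) (hbR : b ≤ R) (hη : 0 < η) {κ : ℝ} (hκ : 0 < κ) :
    ∃ ℓ₀ : ℝ, ∀ (A Z : Ω → ℝ) (g : ℝ → ℝ), RenewalData P R a b η c₀ A Z g →
      ∀ ℓ ≥ ℓ₀, |g ℓ * ∫ ω, Z ω ∂P - ∫ ω, A ω ∂P| ≤ κ := by
  obtain ⟨n, hn⟩ : ∃ n : ℕ, 2 * R ≤ (b - a) * (1 + n / 2) := by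
    obtain ⟨n, hn⟩ := exists_nat_ge (4 * R / (b - a))
    refine ⟨n, ?_⟩
    rw [div_le_iff₀ (by linarith)] at hn
    nlinarith
  set θ := R * (η * (η * ((b - a) / 4)) ^ n) with hθ
  have hθ0 : 0 < θ := by
    have : 0 < b - a := by linarith
    have : (0 : ℝ) < η := by exact_mod_cast hη
    positivity
  set ρ := 1 - min θ (1 / 2) with hρ
  have hρ0 : 0 ≤ ρ := by linarith [min_le_right θ (1 / 2)]
  have hρ1 : ρ < 1 := by
    have : 0 < min θ (1 / 2) := lt_min hθ0 (by norm_num)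
    linarith
  obtain ⟨k, hk⟩ := exists_pow_lt_of_lt_one (div_pos hκ hR) hρ1
  -- Each contraction by `ρ` moves the half-line by `(n + 2) * R`; the extra `R` keeps all of `[ℓ -
  -- Z, ℓ]` inside the last half-line.
  refine ⟨k * ((n + 2) * R) + R, fun A Z g D ℓ hℓ => ?_⟩
  have osc : ∀ k : ℕ, ∀ x y, k * ((n + 2) * R) ≤ x → k * ((n + 2) * R) ≤ y → g x - g y ≤ ρ ^ k := by
    intro k
    induction k with
    | zero => intro x y _ _; linarith [D.g_nonneg y, D.g_le x, pow_zero ρ]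
    | succ k ih =>
      intro x y hx hy
      push_cast at hx hy
      have := D.osc_contract hc hR hab hbR hn (L := k * ((n + 2) * R)) (by positivity) hθ ih x y
        (by linarith) (by linarith)
      rw [pow_succ]
      linarith
  have hkL : (0 : ℝ) ≤ k * ((n + 2) * R) := by positivity
  have hii := D.intervalIntegrable_g
  -- With `E[A]` written as the mean of the integral of `g` over `[ℓ - Z, ℓ]`, the claim compares `g
  -- ℓ` with nearby values of `g`, and the oscillation bound suffices.
  rw [← D.integral_renewal hc (s := ℓ) (by linarith) hR]
  have hZi := D.integrable_Z hc
  have hpt : ∀ ω, |g ℓ * Z ω - ∫ t in (ℓ - Z ω)..ℓ, g t| ≤ κ := by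
    intro ω
    have h1 : g ℓ * Z ω = ∫ t in (ℓ - Z ω)..ℓ, g ℓ := by
      simp only [intervalIntegral.integral_const, smul_eq_mul]; ring
    have hZ0 := hc.le.trans (D.le_Z ω)
    rw [h1, ← intervalIntegral.integral_sub intervalIntegrable_const (hii _ _)]
    have := intervalIntegral.norm_integral_le_of_norm_le_const (a := ℓ - Z ω) (b := ℓ)
      (f := fun t => g ℓ - g t) (C := ρ ^ k) (fun t ht => by
        rw [uIoc_of_le (by linarith)] at ht
        have h2 := D.Z_le ω
        rw [Real.norm_eq_abs, abs_le]
        constructor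
        · linarith [osc k t ℓ (by linarith [ht.1]) (by linarith)]
        · linarith [osc k ℓ t (by linarith) (by linarith [ht.1])])
    rw [Real.norm_eq_abs, sub_sub_cancel, abs_of_nonneg hZ0] at this
    have h3 : ρ ^ k * Z ω ≤ κ / R * R := by
      gcongr
      · exact D.Z_le ω
    rw [div_mul_cancel₀ _ hR.ne'] at h3
    linarith
  have hI : Integrable (fun ω => ∫ t in (ℓ - Z ω)..ℓ, g t) P := by
    have := (integrable_const (μ := P) (∫ t in (0 : ℝ)..ℓ, g t)).sub (D.integrable_primitive hc ℓ)
    refine this.congr (ae_of_all _ fun ω => ?_)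
    exact intervalIntegral.integral_interval_sub_left (hii _ _) (hii _ _)
  rw [← integral_const_mul, ← integral_sub (hZi.const_mul _) hI]
  have := norm_integral_le_of_norm_le_const (μ := P) (C := κ)
    (f := fun ω => g ℓ * Z ω - ∫ t in (ℓ - Z ω)..ℓ, g t) (ae_of_all _ hpt)
  simpa using this

end RenewalData
end NearlyElastic

namespace NearlyElastic

/-! ### Laws with an absolutely continuous component -/

/-- The law of `X` is bounded below by a multiple of the Lebesgue measure on an interval. -/
def HasMinorant {Ω : Type*} [MeasurableSpace Ω] (P : Measure Ω) (X : Ω → ℝ) : Prop :=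
  ∃ (η : ℝ≥0) (a b : ℝ), 0 < η ∧ a < b ∧ η • volume.restrict (Icc a b) ≤ P.map X

/-- A density of total mass one is positive at some point, and by continuity it exceeds half that
value on a neighbourhood. Nothing else about the density is needed. -/
theorem HasContinuousDensity.hasMinorant {Ω : Type*} [MeasurableSpace Ω] {P : Measure Ω}
    [IsProbabilityMeasure P] {X : Ω → ℝ} (hX : Measurable X) (h : HasContinuousDensity P X) :
    HasMinorant P X := by
  obtain ⟨f, hf, hfX⟩ := h
  have : ∃ x, 0 < f x := by
    by_contra! hcon
    have h0 : ∀ x, f x = 0 := fun x => le_antisymm (hcon x) zero_le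
    have := (Measure.isProbabilityMeasure_map (μ := P) hX.aemeasurable).measure_univ
    rw [hfX] at this
    simp [h0] at this
  obtain ⟨x, hx⟩ := this
  have hev : ∀ᶠ y in 𝓝 x, f x / 2 < f y :=
    hf.continuousAt.eventually (lt_mem_nhds (NNReal.half_lt_self hx.ne'))
  obtain ⟨r, hr, hball⟩ := Metric.nhds_basis_closedBall.eventually_iff.1 hev
  refine ⟨f x / 2, x - r, x + r, by positivity, by linarith, ?_⟩
  rw [hfX]
  refine Measure.le_iff.2 fun s hs => ?_
  rw [withDensity_apply _ hs, Measure.smul_apply, Measure.restrict_apply hs]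
  calc (f x / 2) • volume (s ∩ Icc (x - r) (x + r))
      = ∫⁻ _ in s ∩ Icc (x - r) (x + r), ((f x / 2 : ℝ≥0) : ℝ≥0∞) := by
        rw [setLIntegral_const]; rfl
    _ ≤ ∫⁻ y in s ∩ Icc (x - r) (x + r), (f y : ℝ≥0∞) := by
        refine setLIntegral_mono' (hs.inter measurableSet_Icc) fun y hy => ?_
        have : y ∈ Metric.closedBall x r := by rw [Real.closedBall_eq_Icc]; exact hy.2
        exact_mod_cast (hball this).le
    _ ≤ ∫⁻ y in s, (f y : ℝ≥0∞) := lintegral_mono_set inter_subset_left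

/-- The image of the law under a map that is Lipschitz on the interval. -/
theorem minorant_comp {Ω : Type*} [MeasurableSpace Ω] {P : Measure Ω} {X : Ω → ℝ}
    (hX : Measurable X) {η K : ℝ≥0} {a b a' b' : ℝ} (hK : 0 < K)
    (h : η • volume.restrict (Icc a b) ≤ P.map X) {F : ℝ → ℝ} (hF : Measurable F)
    (hFK : LipschitzOnWith K F (Icc a b)) (himg : Icc a' b' ⊆ F '' Icc a b) :
    (η / K) • volume.restrict (Icc a' b') ≤ P.map (F ∘ X) := by
  refine Measure.le_iff.2 fun s hs => ?_
  rw [← Measure.map_map hF hX, Measure.map_apply hF hs, Measure.smul_apply,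
    Measure.restrict_apply hs]
  have h1 : volume (s ∩ Icc a' b') ≤ K * volume (F ⁻¹' s ∩ Icc a b) := by
    have hsub : s ∩ Icc a' b' ⊆ F '' (F ⁻¹' s ∩ Icc a b) := by
      rintro y ⟨hy, hy'⟩
      obtain ⟨x, hx, rfl⟩ := himg hy'
      exact ⟨x, ⟨hy, hx⟩, rfl⟩
    refine (measure_mono hsub).trans ?_
    -- Lebesgue measure on the line is the one-dimensional Hausdorff measure, which a `K`-Lipschitz
    -- map increases at most by the factor `K`.
    have := (hFK.mono (inter_subset_right (s := F ⁻¹' s))).hausdorffMeasure_image_le zero_le_one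
    rwa [hausdorffMeasure_real, ENNReal.rpow_one] at this
  have h2 := (Measure.le_iff.1 h) (F ⁻¹' s) (hF hs)
  rw [Measure.smul_apply, Measure.restrict_apply (hF hs)] at h2
  refine le_trans ?_ h2
  calc (η / K) • volume (s ∩ Icc a' b') ≤ (η / K) • (K * volume (F ⁻¹' s ∩ Icc a b)) := by
        gcongr
    _ = η • volume (F ⁻¹' s ∩ Icc a b) := by
        rw [ENNReal.smul_def, ENNReal.smul_def, smul_eq_mul, smul_eq_mul, ← mul_assoc,
          ← ENNReal.coe_mul, div_mul_cancel₀ _ hK.ne']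

/-- The law of a sum of independent random variables. -/
theorem minorant_add {Ω : Type*} [MeasurableSpace Ω] {P : Measure Ω} [IsProbabilityMeasure P]
    {X Y : Ω → ℝ} (hX : Measurable X) (hY : Measurable Y) (hXY : IndepFun X Y P) {η η' : ℝ≥0}
    {a b a' b' : ℝ} {r : ℝ≥0} (h1 : r ≤ b - a) (h2 : r ≤ b' - a')
    (hmX : η • volume.restrict (Icc a b) ≤ P.map X)
    (hmY : η' • volume.restrict (Icc a' b') ≤ P.map Y) :
    (η * η' * r) • volume.restrict (Icc (a + a' + r) (b + b' - r)) ≤ P.map (fun ω => X ω + Y ω) := by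
  refine Measure.le_iff.2 fun s hs => ?_
  have hind : Measurable (s.indicator (1 : ℝ → ℝ≥0∞)) := measurable_one.indicator hs
  have hprod := (indepFun_iff_map_prod_eq_prod_map_map hX.aemeasurable hY.aemeasurable).1 hXY
  have hlaw : P.map (fun ω => X ω + Y ω) s
      = ∫⁻ z, ∫⁻ t, s.indicator (1 : ℝ → ℝ≥0∞) (z + t) ∂(P.map Y) ∂(P.map X) := by
    have hm : Measurable fun p : ℝ × ℝ => p.1 + p.2 := measurable_fst.add measurable_snd
    have : (fun ω => X ω + Y ω) = (fun p : ℝ × ℝ => p.1 + p.2) ∘ fun ω => (X ω, Y ω) := rfl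
    rw [this, ← Measure.map_map hm (hX.prodMk hY), hprod,
      ← lintegral_indicator_one hs, lintegral_map hind hm,
      lintegral_prod (fun p : ℝ × ℝ => s.indicator (1 : ℝ → ℝ≥0∞) (p.1 + p.2))
        (hind.comp hm).aemeasurable]
  rw [hlaw, Measure.smul_apply, ENNReal.smul_def, smul_eq_mul]
  calc ((η * η' * r : ℝ≥0) : ℝ≥0∞) * volume.restrict (Icc (a + a' + r) (b + b' - r)) s
      = η * (η' * (ENNReal.ofReal r *
        ∫⁻ u in Icc (a + a' + r) (b + b' - r), s.indicator (1 : ℝ → ℝ≥0∞) u)) := by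
        rw [lintegral_indicator_one hs, ENNReal.ofReal_coe_nnreal]
        push_cast
        ring
    _ ≤ η * (η' * ∫⁻ z in Icc a b, ∫⁻ t in Icc a' b', s.indicator (1 : ℝ → ℝ≥0∞) (z + t)) := by
        gcongr
        exact lintegral_add_Icc_ge hind h1 h2
    _ ≤ η * ∫⁻ z in Icc a b, ∫⁻ t, s.indicator (1 : ℝ → ℝ≥0∞) (z + t) ∂(P.map Y) := by
        gcongr
        refine (lintegral_const_mul_le _ _).trans (lintegral_mono fun z => ?_)
        refine le_trans (le_of_eq ?_) (lintegral_mono' hmY le_rfl)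
        rw [lintegral_smul_measure]
        rfl
    _ ≤ _ := by
        refine le_trans (le_of_eq ?_) (lintegral_mono' hmX le_rfl)
        rw [lintegral_smul_measure]
        rfl

/-! ### The logarithmic decrement of the speed -/

/-- The decrement of the logarithm of the speed, divided by `ε`, when the speed is multiplied by
`1 - ε y`. -/
def logStep (ε y : ℝ) : ℝ := -Real.log (1 - ε * y) / ε

theorem measurable_logStep (ε : ℝ) : Measurable (logStep ε) := by
  unfold logStep
  fun_prop

/-- Together with the quadratic upper bound that follows, this shows that the steps tend to the
losses uniformly on bounded sets as `ε ↓ 0`; hence the mean steps tend to the mean losses. -/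
theorem le_logStep {ε y : ℝ} (hε : 0 < ε) (hy : ε * y ≤ 1 / 2) : y ≤ logStep ε y := by
  rw [logStep, le_div_iff₀ hε]
  have := Real.log_le_sub_one_of_pos (x := 1 - ε * y) (by linarith)
  linarith

theorem logStep_le {ε y : ℝ} (hε : 0 < ε) (hy : ε * y ≤ 1 / 2) : logStep ε y ≤ y + 2 * ε * y ^ 2 := by
  rw [logStep, div_le_iff₀ hε]
  have h := Real.one_sub_inv_le_log_of_pos (x := 1 - ε * y) (by linarith)
  have h2 : (1 - ε * y)⁻¹ ≤ 1 + ε * y + 2 * (ε * y) ^ 2 := by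
    rw [inv_le_iff_one_le_mul₀ (by linarith)]
    nlinarith [sq_nonneg (ε * y), mul_nonneg (sq_nonneg (ε * y)) (by linarith : 0 ≤ 1 - 2 * (ε * y))]
  nlinarith

theorem logStep_lipschitz {ε D : ℝ} (hε : 0 < ε) (hD : ε * D ≤ 1 / 2) :
    LipschitzOnWith 2 (logStep ε) (Iic D) := by
  refine LipschitzOnWith.of_dist_le_mul fun x hx y hy => ?_
  have key : ∀ x y : ℝ, x ≤ D → y ≤ D → logStep ε x - logStep ε y ≤ 2 * |x - y| := by
    intro x y hx hy
    have hx' : ε * x ≤ ε * D := by gcongr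
    have hy' : ε * y ≤ ε * D := by gcongr
    rw [logStep, logStep, ← sub_div, div_le_iff₀ hε]
    have hpx : 0 < 1 - ε * x := by linarith
    have hpy : 0 < 1 - ε * y := by linarith
    have h := Real.log_le_sub_one_of_pos (x := (1 - ε * y) / (1 - ε * x)) (by positivity)
    rw [Real.log_div hpy.ne' hpx.ne', div_sub_one hpx.ne'] at h
    have h2 : (1 - ε * y - (1 - ε * x)) / (1 - ε * x) ≤ 2 * |x - y| * ε := by
      rw [div_le_iff₀ hpx]
      have h3 : 1 - ε * y - (1 - ε * x) ≤ ε * |x - y| := by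
        nlinarith [le_abs_self (x - y)]
      have h4 : 0 ≤ ε * |x - y| := by positivity
      nlinarith
    linarith
  rw [Real.dist_eq, Real.dist_eq, abs_sub_le_iff]
  have h2 := key y x hy hx
  rw [abs_sub_comm] at h2
  exact ⟨key x y hx hy, h2⟩

/-- The logarithmic steps have a minorant that does not depend on `ε`. -/
theorem HasMinorant.logStep {Ω : Type*} [MeasurableSpace Ω] {P : Measure Ω} {Y : Ω → ℝ}
    (hY : Measurable Y) (h : HasMinorant P Y) :
    ∃ (η : ℝ≥0) (a b : ℝ), 0 < η ∧ a < b ∧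
      ∀ᶠ ε in 𝓝[>] (0 : ℝ), η • volume.restrict (Icc a b) ≤ P.map fun ω => logStep ε (Y ω) := by
  obtain ⟨η, a, b, hη, hab, hmin⟩ := h
  -- The Lipschitz constant `2` halves the density. `logStep ε` does not decrease `b` and moves `a`
  -- up by at most `2 * ε * a ^ 2`, so for small `ε` the image of `[a, b]` covers all but the first
  -- quarter.
  refine ⟨η / 2, a + (b - a) / 4, b, by positivity, by linarith, ?_⟩
  set D := max |a| |b| with hD
  have hDa : |a| ≤ D := le_max_left _ _
  have hDb : |b| ≤ D := le_max_right _ _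
  have h1 : ∀ᶠ ε in 𝓝[>] (0 : ℝ), ε * D < 1 / 2 := by
    have : Tendsto (fun ε : ℝ => ε * D) (𝓝[>] 0) (𝓝 (0 * D)) :=
      (tendsto_nhdsWithin_of_tendsto_nhds tendsto_id).mul_const D
    exact this.eventually (gt_mem_nhds (by norm_num))
  have h2 : ∀ᶠ ε in 𝓝[>] (0 : ℝ), ε * (2 * a ^ 2) < (b - a) / 4 := by
    have : Tendsto (fun ε : ℝ => ε * (2 * a ^ 2)) (𝓝[>] 0) (𝓝 (0 * (2 * a ^ 2))) :=
      (tendsto_nhdsWithin_of_tendsto_nhds tendsto_id).mul_const _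
    exact this.eventually (gt_mem_nhds (by linarith))
  filter_upwards [h1, h2, self_mem_nhdsWithin] with ε h1 h2 (hε : 0 < ε)
  have hlip : LipschitzOnWith 2 (NearlyElastic.logStep ε) (Icc a b) :=
    (logStep_lipschitz hε h1.le).mono fun x hx => hx.2.trans ((le_abs_self b).trans hDb)
  refine minorant_comp hY two_pos hmin (measurable_logStep ε) hlip ?_
  refine subset_trans ?_ (intermediate_value_Icc hab.le hlip.continuousOn)
  refine Icc_subset_Icc ?_ ?_
  · have : ε * a ≤ ε * D := by gcongr; exact (le_abs_self a).trans hDa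
    linarith [logStep_le hε (y := a) (by linarith)]
  · have : ε * b ≤ ε * D := by gcongr; exact (le_abs_self b).trans hDb
    exact le_logStep hε (by linarith)

/-! ### Alternating renewal -/

/-- The length of the first `i` pairs of steps. -/
def pairSum (x y : ℕ → ℝ) (i : ℕ) : ℝ := ∑ j ∈ Finset.range i, (x j + y j)

/-- The level `ℓ` is passed by a step of the first kind, where the steps `x 0, y 0, x 1, y 1, …` of
the two kinds alternate. -/
def InFirst (x y : ℕ → ℝ) (ℓ : ℝ) : Prop := ∃ i, pairSum x y i < ℓ ∧ ℓ ≤ pairSum x y i + x i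

theorem pairSum_succ' (x y : ℕ → ℝ) (i : ℕ) :
    pairSum x y (i + 1) = x 0 + y 0 + pairSum (fun j => x (j + 1)) (fun j => y (j + 1)) i := by
  rw [pairSum, Finset.sum_range_succ', add_comm]
  rfl

/-- Splitting off the first pair of steps. This pathwise identity is the source of the renewal
equation. -/
theorem inFirst_iff (x y : ℕ → ℝ) (ℓ : ℝ) : InFirst x y ℓ ↔ (0 < ℓ ∧ ℓ ≤ x 0) ∨
    InFirst (fun j => x (j + 1)) (fun j => y (j + 1)) (ℓ - (x 0 + y 0)) := by
  constructor
  · rintro ⟨i, h1, h2⟩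
    cases i with
    | zero =>
      rw [pairSum, Finset.sum_range_zero] at h1 h2
      exact Or.inl ⟨h1, by linarith⟩
    | succ i =>
      right
      rw [pairSum_succ'] at h1 h2
      exact ⟨i, by linarith, by linarith⟩
  · rintro (⟨h1, h2⟩ | ⟨i, h1, h2⟩)
    · exact ⟨0, by simpa [pairSum] using h1, by simpa [pairSum] using h2⟩
    · refine ⟨i + 1, ?_, ?_⟩ <;> rw [pairSum_succ'] <;> linarith

/-- It makes the two cases of `inFirst_iff` exclude each other and gives the vanishing of the
passage probability at levels `ℓ ≤ 0`. -/
theorem InFirst.pos {x y : ℕ → ℝ} {ℓ : ℝ} (hx : ∀ i, 0 ≤ x i) (hy : ∀ i, 0 ≤ y i)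
    (h : InFirst x y ℓ) : 0 < ℓ := by
  obtain ⟨i, h1, -⟩ := h
  exact (Finset.sum_nonneg fun j _ => add_nonneg (hx j) (hy j)).trans_lt h1

/-- The level is allowed to be random because the level that remains after the first pair is random,
and because the passage probability must be measurable in the level. -/
theorem measurableSet_inFirst {Ω : Type*} [MeasurableSpace Ω] {x y : ℕ → Ω → ℝ} {ℓ : Ω → ℝ}
    (hx : ∀ i, Measurable (x i)) (hy : ∀ i, Measurable (y i)) (hℓ : Measurable ℓ) :
    MeasurableSet {ω | InFirst (fun i => x i ω) (fun i => y i ω) (ℓ ω)} := by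
  have hs : ∀ i, Measurable fun ω => pairSum (fun i => x i ω) (fun i => y i ω) i := fun i =>
    Finset.measurable_sum _ fun j _ => (hx j).add (hy j)
  have : {ω | InFirst (fun i => x i ω) (fun i => y i ω) (ℓ ω)}
      = ⋃ i, {ω | pairSum (fun i => x i ω) (fun i => y i ω) i < ℓ ω}
        ∩ {ω | ℓ ω ≤ pairSum (fun i => x i ω) (fun i => y i ω) i + x i ω} := by
    ext ω
    simp [InFirst]
  rw [this]
  exact MeasurableSet.iUnion fun i =>
    (measurableSet_lt (hs i) hℓ).inter (measurableSet_le hℓ ((hs i).add (hx i)))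

instance : MeasurableSpace Wall := ⊤

instance : DiscreteMeasurableSpace Wall := ⟨fun _ => trivial⟩

instance : Countable Wall := by
  refine Function.Injective.countable (f := fun w : Wall => match w with
    | .left => (0 : ℕ) | .middle => 1 | .right => 2) ?_
  intro a b
  cases a <;> cases b <;> simp

section Renewal

variable {Ω : Type*} [MeasurableSpace Ω] {P : Measure Ω} [IsProbabilityMeasure P]
  {X : Wall → ℕ → Ω → ℝ}

omit [IsProbabilityMeasure P] in
/-- The first pair of steps is independent of the later steps. -/
theorem indepFun_shift (hmeas : ∀ w k, Measurable (X w k))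
    (hindep : iIndepFun (fun wk : Wall × ℕ => X wk.1 wk.2) P) :
    IndepFun (fun ω => (X .right 0 ω, X .left 0 ω))
      (fun ω (wk : Wall × ℕ) => X wk.1 (wk.2 + 1) ω) P := by
  have hle : ∀ i : Wall × ℕ,
      (inferInstance : MeasurableSpace ℝ).comap (X i.1 i.2) ≤ ‹MeasurableSpace Ω› :=
    fun i => (hmeas i.1 i.2).comap_le
  have hdisj : Disjoint {i : Wall × ℕ | i.2 = 0} {i : Wall × ℕ | i.2 ≠ 0} := by
    rw [Set.disjoint_left]; intro i h1 h2; exact h2 h1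
  have h := indep_iSup_of_disjoint hle hindep.iIndep hdisj
  rw [IndepFun_iff_Indep]
  refine indep_of_indep_of_le_left (indep_of_indep_of_le_right h ?_) ?_
  · rw [MeasurableSpace.pi, MeasurableSpace.comap_iSup]
    refine iSup_le fun wk => ?_
    rw [MeasurableSpace.comap_comp]
    exact le_biSup (fun i : Wall × ℕ => MeasurableSpace.comap (X i.1 i.2) inferInstance)
      (show (wk.1, wk.2 + 1) ∈ {i : Wall × ℕ | i.2 ≠ 0} from Nat.succ_ne_zero _)
  · rw [Prod.instMeasurableSpace, MeasurableSpace.prod, MeasurableSpace.comap_sup,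
      MeasurableSpace.comap_comp, MeasurableSpace.comap_comp]
    exact sup_le
      (le_biSup (fun i : Wall × ℕ => MeasurableSpace.comap (X i.1 i.2) inferInstance)
        (show (Wall.right, 0) ∈ {i : Wall × ℕ | i.2 = 0} from rfl))
      (le_biSup (fun i : Wall × ℕ => MeasurableSpace.comap (X i.1 i.2) inferInstance)
        (show (Wall.left, 0) ∈ {i : Wall × ℕ | i.2 = 0} from rfl))

/-- The probability that the level `ℓ` is passed by a step at the right wall. -/
def passProb (P : Measure Ω) (X : Wall → ℕ → Ω → ℝ) (ℓ : ℝ) : ℝ :=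
  P.real {ω | InFirst (fun i => X .right i ω) (fun i => X .left i ω) ℓ}

theorem measurable_passProb (hmeas : ∀ w k, Measurable (X w k)) : Measurable (passProb P X) := by
  have h : MeasurableSet {p : ℝ × Ω |
      InFirst (fun i => X .right i p.2) (fun i => X .left i p.2) p.1} :=
    measurableSet_inFirst (fun i => (hmeas _ i).comp measurable_snd)
      (fun i => (hmeas _ i).comp measurable_snd) measurable_fst
  exact (measurable_measure_prodMk_left h).ennreal_toReal

/-- The renewal equation. -/
theorem passProb_renewal (hmeas : ∀ w k, Measurable (X w k))
    (hindep : iIndepFun (fun wk : Wall × ℕ => X wk.1 wk.2) P)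
    (hident : ∀ w k, IdentDistrib (X w k) (X w 0) P P) (h0 : ∀ w k ω, 0 ≤ X w k ω) (ℓ : ℝ) :
    passProb P X ℓ = P.real {ω | 0 < ℓ ∧ ℓ ≤ X .right 0 ω}
      + ∫ ω, passProb P X (ℓ - (X .right 0 ω + X .left 0 ω)) ∂P := by
  -- the later steps have the law of the whole sequence
  have hshift : IdentDistrib (fun ω (wk : Wall × ℕ) => X wk.1 (wk.2 + 1) ω)
      (fun ω (wk : Wall × ℕ) => X wk.1 wk.2 ω) P P := by
    refine IdentDistrib.pi (X := fun (wk : Wall × ℕ) => X wk.1 (wk.2 + 1))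
      (Y := fun (wk : Wall × ℕ) => X wk.1 wk.2)
      (fun wk => (hident _ _).trans (hident _ _).symm) ?_ hindep
    exact hindep.precomp (g := fun wk : Wall × ℕ => (wk.1, wk.2 + 1))
      fun a b hab => by
        simp only [Prod.mk.injEq, add_left_inj] at hab
        exact Prod.ext hab.1 hab.2
  have hset : {ω | InFirst (fun i => X .right i ω) (fun i => X .left i ω) ℓ}
      = {ω | 0 < ℓ ∧ ℓ ≤ X .right 0 ω} ∪ {ω | InFirst (fun i => X .right (i + 1) ω)
        (fun i => X .left (i + 1) ω) (ℓ - (X .right 0 ω + X .left 0 ω))} := by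
    ext ω
    exact inFirst_iff _ _ _
  have hm2 : MeasurableSet {ω | InFirst (fun i => X .right (i + 1) ω)
        (fun i => X .left (i + 1) ω) (ℓ - (X .right 0 ω + X .left 0 ω))} :=
    measurableSet_inFirst (fun i => hmeas _ _) (fun i => hmeas _ _)
      (measurable_const.sub ((hmeas _ _).add (hmeas _ _)))
  have hdisj : Disjoint {ω | 0 < ℓ ∧ ℓ ≤ X .right 0 ω} {ω | InFirst (fun i => X .right (i + 1) ω)
        (fun i => X .left (i + 1) ω) (ℓ - (X .right 0 ω + X .left 0 ω))} := by
    rw [Set.disjoint_left]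
    rintro ω ⟨-, h1⟩ h2
    have := InFirst.pos (fun i => h0 _ _ _) (fun i => h0 _ _ _) h2
    linarith [h0 .left 0 ω]
  rw [passProb, hset, measureReal_union hdisj hm2]
  congr 1
  -- integrate with respect to the law of the first pair
  set V : Ω → ℝ × ℝ := fun ω => (X .right 0 ω, X .left 0 ω) with hV
  set S : Ω → (Wall × ℕ → ℝ) := fun ω wk => X wk.1 (wk.2 + 1) ω with hS
  have hVm : Measurable V := (hmeas _ _).prodMk (hmeas _ _)
  have hSm : Measurable S := measurable_pi_lambda _ fun wk => hmeas _ _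
  have hprod := (indepFun_iff_map_prod_eq_prod_map_map hVm.aemeasurable hSm.aemeasurable).1
    (indepFun_shift hmeas hindep)
  set B : Set ((ℝ × ℝ) × (Wall × ℕ → ℝ)) :=
    {p | InFirst (fun i => p.2 (.right, i)) (fun i => p.2 (.left, i)) (ℓ - (p.1.1 + p.1.2))}
    with hB
  have hBm : MeasurableSet B :=
    measurableSet_inFirst (Ω := (ℝ × ℝ) × (Wall × ℕ → ℝ))
      (x := fun i p => p.2 (.right, i)) (y := fun i p => p.2 (.left, i))
      (fun i => (measurable_pi_apply _).comp measurable_snd)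
      (fun i => (measurable_pi_apply _).comp measurable_snd)
      (measurable_const.sub ((measurable_fst.comp measurable_fst).add
        (measurable_snd.comp measurable_fst)))
  have e1 : P {ω | InFirst (fun i => X .right (i + 1) ω)
        (fun i => X .left (i + 1) ω) (ℓ - (X .right 0 ω + X .left 0 ω))}
      = ∫⁻ ω, P {ω' | InFirst (fun i => X .right i ω') (fun i => X .left i ω')
        (ℓ - (X .right 0 ω + X .left 0 ω))} ∂P := by
    calc _ = P.map (fun ω => (V ω, S ω)) B := by
          rw [Measure.map_apply (hVm.prodMk hSm) hBm]; rfl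
      _ = ∫⁻ v, P.map S (Prod.mk v ⁻¹' B) ∂(P.map V) := by
          rw [hprod, Measure.prod_apply hBm]
      _ = ∫⁻ ω, P.map S (Prod.mk (V ω) ⁻¹' B) ∂P :=
          lintegral_map (measurable_measure_prodMk_left hBm) hVm
      _ = _ := by
          refine lintegral_congr fun ω => ?_
          rw [hshift.map_eq, Measure.map_apply
            (measurable_pi_lambda _ fun wk => hmeas _ _) (measurable_prodMk_left hBm)]
          rfl
  have hpm : Measurable fun ω => passProb P X (ℓ - (X .right 0 ω + X .left 0 ω)) :=
    (measurable_passProb hmeas).comp (measurable_const.sub ((hmeas _ _).add (hmeas _ _)))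
  rw [measureReal_def, e1, integral_eq_lintegral_of_nonneg_ae
    (f := fun ω => passProb P X (ℓ - (X .right 0 ω + X .left 0 ω)))
    (ae_of_all _ fun ω => measureReal_nonneg) hpm.aestronglyMeasurable]
  congr 1
  refine lintegral_congr fun ω => ?_
  rw [passProb, ofReal_measureReal]

/-- The limit of the probability that a high level is passed by a step at the right wall, for the
logarithmic steps of a nearly elastic particle. -/
theorem tendsto_passProb_logStep {Y : Wall → ℕ → Ω → ℝ} {c₀ C : ℝ} (hc₀ : 0 < c₀)
    (hmeas : ∀ w k, Measurable (Y w k)) (hindep : iIndepFun (fun wk : Wall × ℕ => Y wk.1 wk.2) P)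
    (hident : ∀ w k, IdentDistrib (Y w k) (Y w 0) P P) (hle : ∀ w k ω, c₀ ≤ Y w k ω)
    (hge : ∀ w k ω, Y w k ω ≤ C) (hmin : ∀ w, HasMinorant P (Y w 0)) {L : ℝ} (hL : 0 < L) :
    Tendsto (fun ε => passProb P (fun w k ω => logStep ε (Y w k ω)) (L / ε)) (𝓝[>] 0)
      (𝓝 ((∫ ω, Y .right 0 ω ∂P) / (∫ ω, Y .right 0 ω ∂P + ∫ ω, Y .left 0 ω ∂P))) := by
  obtain ⟨ω₀⟩ : Nonempty Ω := nonempty_of_isProbabilityMeasure P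
  have hC : c₀ ≤ C := (hle .right 0 ω₀).trans (hge .right 0 ω₀)
  obtain ⟨η₁, a₁, b₁, hη₁, hab₁, hm₁⟩ := (hmin .right).logStep (hmeas .right 0)
  obtain ⟨η₂, a₂, b₂, hη₂, hab₂, hm₂⟩ := (hmin .left).logStep (hmeas .left 0)
  obtain ⟨r, hr, hr₁, hr₂⟩ :
      ∃ r : ℝ≥0, 0 < r ∧ (r : ℝ) ≤ (b₁ - a₁) / 2 ∧ (r : ℝ) ≤ (b₂ - a₂) / 2 := by
    -- Half of the shorter interval: small enough that the trimmed sum of the two intervals keeps a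
    -- positive length.
    refine ⟨⟨min ((b₁ - a₁) / 2) ((b₂ - a₂) / 2), ?_⟩, ?_, min_le_left _ _, min_le_right _ _⟩
    · exact le_min (by linarith) (by linarith)
    · exact lt_min (by linarith : (0 : ℝ) < _) (by linarith)
  have hr0 : (0 : ℝ) < r := hr
  set η := η₁ * η₂ * r with hη
  set a := a₁ + a₂ + r with ha
  set b := b₁ + b₂ - r with hb
  have hη0 : 0 < η := by positivity
  have hab : a < b := by linarith
  -- A logarithmic step is at most `2 * C` for small `ε`, so a pair is at most `4 * C`; the maximum
  -- with `b` meets the condition `b ≤ R` of the renewal theorem.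
  set R := max (4 * C) b with hR
  have hR0 : 0 < R := lt_max_of_lt_left (by linarith)
  have hεC : ∀ᶠ ε in 𝓝[>] (0 : ℝ), ε * C < 1 / 2 := by
    have : Tendsto (fun ε : ℝ => ε * C) (𝓝[>] 0) (𝓝 (0 * C)) :=
      (tendsto_nhdsWithin_of_tendsto_nhds tendsto_id).mul_const C
    exact this.eventually (gt_mem_nhds (by norm_num))
  have hbounds : ∀ ε, 0 < ε → ε * C < 1 / 2 → ∀ w k ω, Y w k ω ≤ logStep ε (Y w k ω) ∧
      logStep ε (Y w k ω) ≤ Y w k ω + 2 * ε * C ^ 2 ∧ logStep ε (Y w k ω) ≤ 2 * C := by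
    intro ε hε h w k ω
    have h0 := hc₀.le.trans (hle w k ω)
    have h1 := hge w k ω
    have h2 : ε * Y w k ω ≤ ε * C := by gcongr
    have h3 : ε * Y w k ω ^ 2 ≤ ε * C ^ 2 := by gcongr
    have h4 := logStep_le hε (y := Y w k ω) (by linarith)
    refine ⟨le_logStep hε (by linarith), by linarith, ?_⟩
    nlinarith [mul_nonneg h0 (by linarith : 0 ≤ 1 / 2 - ε * Y w k ω)]
  have hlm : ∀ ε w k, Measurable fun ω => logStep ε (Y w k ω) := fun ε w k =>
    (measurable_logStep ε).comp (hmeas w k)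
  have hYi : ∀ w, Integrable (Y w 0) P := fun w =>
    Integrable.of_bound (hmeas w 0).aestronglyMeasurable C (ae_of_all _ fun ω => by
      rw [Real.norm_eq_abs, abs_of_nonneg (hc₀.le.trans (hle w 0 ω))]; exact hge w 0 ω)
  have hli : ∀ ε, 0 < ε → ε * C < 1 / 2 → ∀ w, Integrable (fun ω => logStep ε (Y w 0 ω)) P := by
    intro ε hε h w
    refine Integrable.of_bound (hlm ε w 0).aestronglyMeasurable (2 * C) (ae_of_all _ fun ω => ?_)
    obtain ⟨h1, -, h2⟩ := hbounds ε hε h w 0 ω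
    rw [Real.norm_eq_abs, abs_of_nonneg ((hc₀.le.trans (hle w 0 ω)).trans h1)]
    exact h2
  have hmean : ∀ w, Tendsto (fun ε => ∫ ω, logStep ε (Y w 0 ω) ∂P) (𝓝[>] 0)
      (𝓝 (∫ ω, Y w 0 ω ∂P)) := by
    intro w
    have hup : Tendsto (fun ε : ℝ => ∫ ω, Y w 0 ω ∂P + 2 * ε * C ^ 2) (𝓝[>] 0)
        (𝓝 (∫ ω, Y w 0 ω ∂P)) := by
      have : Tendsto (fun ε : ℝ => ∫ ω, Y w 0 ω ∂P + 2 * ε * C ^ 2) (𝓝 0)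
        (𝓝 (∫ ω, Y w 0 ω ∂P + 2 * 0 * C ^ 2)) := Continuous.tendsto (by fun_prop) 0
      rw [mul_zero, zero_mul, add_zero] at this
      exact tendsto_nhdsWithin_of_tendsto_nhds this
    refine tendsto_of_tendsto_of_tendsto_of_le_of_le' tendsto_const_nhds hup ?_ ?_
    · filter_upwards [hεC, self_mem_nhdsWithin] with ε h (hε : 0 < ε)
      exact integral_mono (hYi w) (hli ε hε h w) fun ω => (hbounds ε hε h w 0 ω).1
    · filter_upwards [hεC, self_mem_nhdsWithin] with ε h (hε : 0 < ε)
      have := integral_mono (hli ε hε h w) ((hYi w).add (integrable_const (2 * ε * C ^ 2)))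
        fun ω => (hbounds ε hε h w 0 ω).2.1
      simpa [integral_add (hYi w) (integrable_const _)] using this
  have hYpos : ∀ w, c₀ ≤ ∫ ω, Y w 0 ω ∂P := fun w => by
    have := integral_mono (μ := P) (integrable_const c₀) (hYi w) fun ω => hle w 0 ω
    simpa using this
  -- the data of the renewal theorem
  have hdata : ∀ᶠ ε in 𝓝[>] (0 : ℝ), RenewalData P R a b η c₀ (fun ω => logStep ε (Y .right 0 ω))
      (fun ω => logStep ε (Y .right 0 ω) + logStep ε (Y .left 0 ω))
      (passProb P fun w k ω => logStep ε (Y w k ω)) := by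
    filter_upwards [hεC, self_mem_nhdsWithin, hm₁, hm₂] with ε h (hε : 0 < ε) hm₁ hm₂
    have hb := hbounds ε hε h
    have h0 : ∀ w k ω, 0 ≤ logStep ε (Y w k ω) := fun w k ω =>
      (hc₀.le.trans (hle w k ω)).trans (hb w k ω).1
    have hX : iIndepFun (fun wk : Wall × ℕ => fun ω => logStep ε (Y wk.1 wk.2 ω)) P :=
      hindep.comp (fun _ => logStep ε) fun _ => measurable_logStep ε
    refine ⟨hlm _ _ _, (hlm _ _ _).add (hlm _ _ _), measurable_passProb (hlm ε), h0 _ _,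
      fun ω => ?_, fun ω => ?_, fun ω => ?_, fun x => measureReal_nonneg,
      fun x => measureReal_le_one, fun x hx => ?_, fun x => ?_, ?_⟩
    · exact le_max_of_le_left (by linarith [(hb .right 0 ω).2.2])
    · linarith [hle .right 0 ω, (hb .right 0 ω).1, h0 .left 0 ω]
    · exact le_max_of_le_left (by linarith [(hb .right 0 ω).2.2, (hb .left 0 ω).2.2])
    · have : {ω | InFirst (fun i => logStep ε (Y .right i ω)) (fun i => logStep ε (Y .left i ω)) x}
          = ∅ := by
        ext ω
        simp only [mem_ofPred_eq, mem_empty_iff_false, iff_false]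
        intro hin
        linarith [hin.pos (fun i => h0 _ i ω) (fun i => h0 _ i ω)]
      rw [passProb, this, measureReal_empty]
    · exact passProb_renewal (hlm ε) hX (fun w k => (hident w k).comp (measurable_logStep ε)) h0 x
    · refine minorant_add (hlm ε .right 0) (hlm ε .left 0) ?_ (by linarith) (by linarith) hm₁ hm₂
      exact hX.indepFun (i := (Wall.right, 0)) (j := (Wall.left, 0)) (by simp)
  set mr := ∫ ω, Y .right 0 ω ∂P
  set ml := ∫ ω, Y .left 0 ω ∂P
  set EA : ℝ → ℝ := fun ε => ∫ ω, logStep ε (Y .right 0 ω) ∂P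
  set EZ : ℝ → ℝ := fun ε => ∫ ω, (logStep ε (Y .right 0 ω) + logStep ε (Y .left 0 ω)) ∂P
  have hEZ : Tendsto EZ (𝓝[>] 0) (𝓝 (mr + ml)) := by
    refine ((hmean .right).add (hmean .left)).congr' ?_
    filter_upwards [hεC, self_mem_nhdsWithin] with ε h (hε : 0 < ε)
    exact (integral_add (hli ε hε h _) (hli ε hε h _)).symm
  have hpos : 0 < mr + ml := by linarith [hYpos .right, hYpos .left]
  have hlimq : Tendsto (fun ε => EA ε / EZ ε) (𝓝[>] 0) (𝓝 (mr / (mr + ml))) :=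
    (hmean .right).div hEZ hpos.ne'
  -- Here the uniformity of the renewal theorem is used: `ℓ₀` is fixed before `ε`, and `L / ε`
  -- exceeds it once `ε` is small, although the law of the steps still varies.
  have hdiff : Tendsto (fun ε => passProb P (fun w k ω => logStep ε (Y w k ω)) (L / ε)
      - EA ε / EZ ε) (𝓝[>] 0) (𝓝 0) := by
    rw [Metric.tendsto_nhds]
    intro κ hκ
    have hκ' : 0 < κ * ((mr + ml) / 2) / 2 := by positivity
    obtain ⟨ℓ₀, hℓ₀⟩ := RenewalData.renewal_limit P hc₀ hR0 hab (le_max_right _ _) hη0 hκ'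
    have hbig : ∀ᶠ ε in 𝓝[>] (0 : ℝ), ℓ₀ ≤ L / ε :=
      (tendsto_inv_nhdsGT_zero.const_mul_atTop hL).eventually_ge_atTop ℓ₀
    filter_upwards [hdata, hbig, hEZ.eventually (lt_mem_nhds (half_lt_self hpos))]
      with ε hD hb hZ
    have := hℓ₀ _ _ _ hD _ hb
    have hZ0 : 0 < EZ ε := by linarith
    rw [dist_zero_right, Real.norm_eq_abs]
    have e : passProb P (fun w k ω => logStep ε (Y w k ω)) (L / ε) - EA ε / EZ ε
        = (passProb P (fun w k ω => logStep ε (Y w k ω)) (L / ε) * EZ ε - EA ε) / EZ ε := by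
      field_simp
    rw [e, abs_div, abs_of_pos hZ0, div_lt_iff₀ hZ0]
    have : κ * ((mr + ml) / 2) ≤ κ * EZ ε := by gcongr
    have : 0 < κ * ((mr + ml) / 2) := by positivity
    linarith
  simpa using hdiff.add hlimq

end Renewal

end NearlyElastic

namespace NearlyElastic

instance : Fintype Wall := ⟨{.left, .middle, .right}, fun w => by cases w <;> simp⟩

theorem Wall.sum_eq {A : Type*} [AddCommMonoid A] (f : Wall → A) :
    ∑ w, f w = f .left + (f .middle + f .right) := by
  change ∑ w ∈ {Wall.left, Wall.middle, Wall.right}, f w = _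
  rw [Finset.sum_insert (by simp), Finset.sum_insert (by simp), Finset.sum_singleton]

/-- The outer wall of a well. -/
def Well.outer : Well → Wall
  | .left => .left
  | .right => .right

namespace Model

/-! ### The structure of the sequence of collisions -/

/-- The loss `c_w + δ z_{w,k}` at the hit number `k + 1` of the wall `w`, for `ε = 1`. -/
def loss (M : Model) (δ : ℝ) (z : Wall → ℕ → ℝ) (w : Wall) (k : ℕ) : ℝ := M.c w + δ * z w k

/-- The losses lie in `[b, B]` with `0 < b`, and `ε` is small. -/
structure Regular (M : Model) (ε δ : ℝ) (z : Wall → ℕ → ℝ) (b B : ℝ) : Prop where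
  ε_pos : 0 < ε
  b_pos : 0 < b
  le_loss : ∀ w k, b ≤ M.loss δ z w k
  loss_le : ∀ w k, M.loss δ z w k ≤ B
  small : ε * B ≤ 1 / 2

section

variable (M : Model) (ε δ : ℝ) (z : Wall → ℕ → ℝ)

/-- The speed after `n` collisions. -/
def speed (n : ℕ) : ℝ := |(M.state ε δ z n).p|

/-- The wall of the collision number `n + 1`. -/
def wallAt (n : ℕ) : Wall := M.nextWall (M.state ε δ z n).q (M.state ε δ z n).p

/-- The loss at the collision number `n + 1`. -/
def lossAt (n : ℕ) : ℝ :=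
  M.loss δ z (M.wallAt ε δ z n) ((M.state ε δ z n).hits (M.wallAt ε δ z n))

/-- The length of the flight between the collisions number `n` and `n + 1`. -/
def flight (n : ℕ) : ℝ := |M.wallPos (M.wallAt ε δ z n) - (M.state ε δ z n).q|

/-- The collision number `m` is the first one after which the speed is at most `pO`. -/
def IsCrossing (m : ℕ) : Prop :=
  M.speed ε δ z m ≤ M.pO ∧ ∀ j < m, M.pO < M.speed ε δ z j

end

/-- The well in which a particle is trapped at its collision number `m`. -/
def crossingWell (m : ℕ) : Well := if Even m then .left else .right

variable {M : Model} {ε δ : ℝ} {z : Wall → ℕ → ℝ} {b B : ℝ}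

theorem p_succ (n : ℕ) : (M.state ε δ z (n + 1)).p
    = -(M.state ε δ z n).p * (1 - ε * M.lossAt ε δ z n) := by
  change -(M.state ε δ z n).p * (1 - ε * M.c _ - ε * δ * z _ _) = _
  rw [lossAt, loss]
  unfold wallAt
  ring

theorem q_succ (n : ℕ) : (M.state ε δ z (n + 1)).q = M.wallPos (M.wallAt ε δ z n) := rfl

theorem hits_succ (n : ℕ) : (M.state ε δ z (n + 1)).hits = Function.update (M.state ε δ z n).hits
    (M.wallAt ε δ z n) ((M.state ε δ z n).hits (M.wallAt ε δ z n) + 1) := rfl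

theorem hitTime_succ (n : ℕ) : M.hitTime ε δ z (n + 1)
    = M.hitTime ε δ z n + M.flight ε δ z n / M.speed ε δ z n := rfl

theorem hitTime_zero : M.hitTime ε δ z 0 = 0 := rfl

theorem p₀_pos (M : Model) : 0 < M.p₀ := M.pO_pos.trans M.pO_lt

theorem speed_zero : M.speed ε δ z 0 = M.p₀ := abs_of_pos M.p₀_pos

/-- Regrouping by walls. The hit counters use up the noise of each wall in order and without gaps,
so a sum along the trajectory becomes three ordinary partial sums, to which the law of large numbers
applies. -/
theorem sum_hits (F : Wall → ℕ → ℝ) (n : ℕ) :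
    ∑ j ∈ Finset.range n, F (M.wallAt ε δ z j) ((M.state ε δ z j).hits (M.wallAt ε δ z j))
      = ∑ w, ∑ k ∈ Finset.range ((M.state ε δ z n).hits w), F w k := by
  induction n with
  | zero => simp [state]
  | succ n ih =>
    rw [Finset.sum_range_succ, ih, hits_succ, Wall.sum_eq, Wall.sum_eq]
    rcases M.wallAt ε δ z n with _ | _ | _ <;> simp [Finset.sum_range_succ] <;> ring

theorem hits_le (n : ℕ) (w : Wall) : (M.state ε δ z n).hits w ≤ n := by
  induction n with
  | zero => simp [state]
  | succ n ih =>
    rw [hits_succ]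
    by_cases h : w = M.wallAt ε δ z n
    · subst h
      rw [Function.update_self]
      omega
    · rw [Function.update_of_ne h]
      omega

namespace Regular

variable (h : M.Regular ε δ z b B)
include h

theorem loss_small (w : Wall) (k : ℕ) : ε * M.loss δ z w k ≤ 1 / 2 :=
  (mul_le_mul_of_nonneg_left (h.loss_le w k) h.ε_pos.le).trans h.small

theorem B_pos : 0 < B := h.b_pos.trans_le ((h.le_loss .left 0).trans (h.loss_le .left 0))

theorem factor_ge (n : ℕ) : 1 / 2 ≤ 1 - ε * M.lossAt ε δ z n := by
  have := h.loss_small (M.wallAt ε δ z n) ((M.state ε δ z n).hits (M.wallAt ε δ z n))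
  rw [lossAt]
  linarith

theorem lossAt_ge (n : ℕ) : b ≤ M.lossAt ε δ z n := h.le_loss _ _

theorem lossAt_le (n : ℕ) : M.lossAt ε δ z n ≤ B := h.loss_le _ _

theorem speed_succ (n : ℕ) :
    M.speed ε δ z (n + 1) = M.speed ε δ z n * (1 - ε * M.lossAt ε δ z n) := by
  rw [speed, p_succ, abs_mul, abs_neg, abs_of_pos (a := 1 - ε * M.lossAt ε δ z n)
    (by linarith [h.factor_ge n])]
  rfl

theorem speed_pos (n : ℕ) : 0 < M.speed ε δ z n := by
  induction n with
  | zero => rw [speed_zero]; exact M.p₀_pos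
  | succ n ih =>
    rw [h.speed_succ]
    exact mul_pos ih (by linarith [h.factor_ge n])

theorem speed_succ_le (n : ℕ) :
    M.speed ε δ z (n + 1) ≤ M.speed ε δ z n * (1 - ε * b) := by
  rw [h.speed_succ]
  have := h.speed_pos n
  have := h.ε_pos
  have := h.lossAt_ge n
  gcongr

theorem speed_antitone : Antitone (M.speed ε δ z) :=
  antitone_nat_of_succ_le fun n => by
    have h1 := h.speed_succ_le n
    have h2 := h.speed_pos n
    have h3 := mul_pos h.ε_pos h.b_pos
    nlinarith

theorem exists_crossing : ∃ m, M.IsCrossing ε δ z m := by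
  have hεb := mul_pos h.ε_pos h.b_pos
  have hεb1 : ε * b ≤ 1 / 2 :=
    (mul_le_mul_of_nonneg_left (h.le_loss .left 0) h.ε_pos.le).trans (h.loss_small _ _)
  -- Every loss is at least `b`, so the speed decays geometrically and must reach `pO`.
  have hpow : ∀ n, M.speed ε δ z n ≤ M.p₀ * (1 - ε * b) ^ n := by
    intro n
    induction n with
    | zero => simp [speed_zero]
    | succ n ih =>
      rw [pow_succ, ← mul_assoc]
      exact (h.speed_succ_le n).trans (mul_le_mul_of_nonneg_right ih (by linarith))
  obtain ⟨n, hn⟩ := exists_pow_lt_of_lt_one (div_pos M.pO_pos M.p₀_pos)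
    (by linarith : 1 - ε * b < 1)
  have hex : ∃ n, M.speed ε δ z n ≤ M.pO := by
    refine ⟨n, (hpow n).trans ?_⟩
    rw [lt_div_iff₀ M.p₀_pos] at hn
    linarith
  classical
  exact ⟨Nat.find hex, Nat.find_spec hex, fun j hj => not_le.1 (Nat.find_min hex hj)⟩

end Regular

theorem IsCrossing.pos {m : ℕ} (h : M.IsCrossing ε δ z m) : 0 < m := by
  rcases Nat.eq_zero_or_pos m with rfl | h0
  · have := h.1
    rw [speed_zero] at this
    linarith [M.pO_lt]
  · exact h0

theorem nextWall_of_pos {q p : ℝ} (hp : 0 < p) (h : M.pO < |p|) : M.nextWall q p = .right := by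
  simp [nextWall, hp, not_le.2 h]

theorem nextWall_of_neg {q p : ℝ} (hp : p < 0) (h : M.pO < |p|) : M.nextWall q p = .left := by
  simp [nextWall, not_lt.2 hp.le, not_le.2 h]

/-- The state after `n` collisions as long as the particle passes over the interior wall. -/
theorem Regular.top_state (h : M.Regular ε δ z b B) (n : ℕ)
    (hn : ∀ j < n, M.pO < M.speed ε δ z j) :
    (Even n → 0 < (M.state ε δ z n).p ∧ (0 < n → (M.state ε δ z n).q = -M.a₁)) ∧
    (¬ Even n → (M.state ε δ z n).p < 0 ∧ (M.state ε δ z n).q = M.a₂) ∧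
    (M.state ε δ z n).hits .right = (n + 1) / 2 ∧ (M.state ε δ z n).hits .left = n / 2 := by
  induction n with
  -- The start may be anywhere in the interval; this is why the position is claimed only after a
  -- collision.
  | zero => simp [state, M.p₀_pos]
  | succ n ih =>
    obtain ⟨h1, h2, h3, h4⟩ := ih fun j hj => hn j (hj.trans (Nat.lt_succ_self n))
    have hv : M.pO < |(M.state ε δ z n).p| := hn n (Nat.lt_succ_self n)
    have hf : 0 < 1 - ε * M.lossAt ε δ z n := by linarith [h.factor_ge n]
    rw [Nat.even_add_one, p_succ, q_succ, hits_succ]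
    by_cases he : Even n
    · have hw : M.wallAt ε δ z n = .right := nextWall_of_pos (h1 he).1 hv
      refine ⟨fun h' => absurd he h', fun _ => ⟨?_, ?_⟩, ?_, ?_⟩
      · have := mul_pos (h1 he).1 hf
        linarith
      · rw [hw]; rfl
      · rw [hw, Function.update_self, h3]
        obtain ⟨k, rfl⟩ := he
        omega
      · rw [hw, Function.update_of_ne (by simp), h4]
        obtain ⟨k, rfl⟩ := he
        omega
    · have hw : M.wallAt ε δ z n = .left := nextWall_of_neg (h2 he).1 hv
      refine ⟨fun _ => ⟨?_, fun _ => ?_⟩, fun h' => absurd he h', ?_, ?_⟩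
      · exact mul_pos (by linarith [(h2 he).1]) hf
      · rw [hw]; rfl
      · rw [hw, Function.update_of_ne (by simp), h3]
        obtain ⟨k, rfl⟩ := Nat.not_even_iff_odd.1 he
        omega
      · rw [hw, Function.update_self, h4]
        obtain ⟨k, rfl⟩ := Nat.not_even_iff_odd.1 he
        omega

/-- The condition includes `j = n`: the wall hit next depends on the speed after `n` collisions. -/
theorem Regular.top_wallAt (h : M.Regular ε δ z b B) {n : ℕ}
    (hn : ∀ j < n + 1, M.pO < M.speed ε δ z j) :
    M.wallAt ε δ z n = if Even n then .right else .left := by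
  obtain ⟨h1, h2, -, -⟩ := h.top_state n fun j hj => hn j (by omega)
  have hv : M.pO < |(M.state ε δ z n).p| := hn n (Nat.lt_succ_self n)
  split_ifs with he
  · exact nextWall_of_pos (h1 he).1 hv
  · exact nextWall_of_neg (h2 he).1 hv

/-- The states of the trapped particle. -/
theorem Regular.trap_state (h : M.Regular ε δ z b B) {m : ℕ} (hm : M.IsCrossing ε δ z m) (j : ℕ) :
    (crossingWell m = .right →
      (Even j → (M.state ε δ z (m + j)).p < 0 ∧ (M.state ε δ z (m + j)).q = M.a₂) ∧
      (¬ Even j → 0 < (M.state ε δ z (m + j)).p ∧ (M.state ε δ z (m + j)).q = 0)) ∧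
    (crossingWell m = .left →
      (Even j → 0 < (M.state ε δ z (m + j)).p ∧ (M.state ε δ z (m + j)).q = -M.a₁) ∧
      (¬ Even j → (M.state ε δ z (m + j)).p < 0 ∧ (M.state ε δ z (m + j)).q = 0)) := by
  induction j with
  | zero =>
    -- All speeds before the crossing exceed `pO`, so the crossing itself happens at an outer wall,
    -- and the parity of `m` tells which one.
    obtain ⟨h1, h2, -, -⟩ := h.top_state m hm.2
    by_cases he : Even m
    · simp [crossingWell, he, (h1 he).1, (h1 he).2 hm.pos]
    · simp [crossingWell, he, (h2 he).1, (h2 he).2]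
  | succ j ih =>
    have hv : |(M.state ε δ z (m + j)).p| ≤ M.pO :=
      (h.speed_antitone (Nat.le_add_right m j)).trans hm.1
    have hf : 0 < 1 - ε * M.lossAt ε δ z (m + j) := by linarith [h.factor_ge (m + j)]
    have ha1 := M.a₁_pos
    have ha2 := M.a₂_pos
    obtain ⟨hr, hl⟩ := ih
    rw [← add_assoc, Nat.even_add_one, p_succ, q_succ]
    constructor
    · intro hw
      obtain ⟨h1, h2⟩ := hr hw
      refine ⟨fun he => ?_, fun he => ?_⟩
      · have hwall : M.wallAt ε δ z (m + j) = .right := by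
          simp [wallAt, nextWall, (h2 he).1, (h2 he).2]
        rw [hwall]
        exact ⟨by have := mul_pos (h2 he).1 hf; linarith, rfl⟩
      · rw [not_not] at he
        have hwall : M.wallAt ε δ z (m + j) = .middle := by
          simp [wallAt, nextWall, not_lt.2 (h1 he).1.le, (h1 he).2, hv, ha2]
        rw [hwall]
        exact ⟨mul_pos (by linarith [(h1 he).1]) hf, rfl⟩
    · intro hw
      obtain ⟨h1, h2⟩ := hl hw
      refine ⟨fun he => ?_, fun he => ?_⟩
      · have hwall : M.wallAt ε δ z (m + j) = .left := by
          simp [wallAt, nextWall, not_lt.2 (h2 he).1.le, (h2 he).2]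
        rw [hwall]
        exact ⟨mul_pos (by linarith [(h2 he).1]) hf, rfl⟩
      · rw [not_not] at he
        have hwall : M.wallAt ε δ z (m + j) = .middle := by
          simp [wallAt, nextWall, (h1 he).1, (h1 he).2, hv, ha1]
        rw [hwall]
        exact ⟨by have := mul_pos (h1 he).1 hf; linarith, rfl⟩

theorem Regular.trap_wallAt (h : M.Regular ε δ z b B) {m : ℕ} (hm : M.IsCrossing ε δ z m) (j : ℕ) :
    M.wallAt ε δ z (m + j) = if Even j then .middle else (crossingWell m).outer := by
  have hv : |(M.state ε δ z (m + j)).p| ≤ M.pO :=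
    (h.speed_antitone (Nat.le_add_right m j)).trans hm.1
  have ha1 := M.a₁_pos
  have ha2 := M.a₂_pos
  obtain ⟨hr, hl⟩ := h.trap_state hm j
  rcases hW : crossingWell m with _ | _
  · obtain ⟨h1, h2⟩ := hl hW
    split_ifs with he
    · simp [wallAt, nextWall, (h1 he).1, (h1 he).2, hv, ha1]
    · simp [wallAt, nextWall, not_lt.2 (h2 he).1.le, (h2 he).2, Well.outer]
  · obtain ⟨h1, h2⟩ := hr hW
    split_ifs with he
    · simp [wallAt, nextWall, not_lt.2 (h1 he).1.le, (h1 he).2, hv, ha2]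
    · simp [wallAt, nextWall, (h2 he).1, (h2 he).2, Well.outer]

/-- At the interior wall the position `0` does not reveal the side; the velocity after the
reflection does, as it points back into the well. -/
theorem Regular.side_trap (h : M.Regular ε δ z b B) {m n : ℕ} (hm : M.IsCrossing ε δ z m)
    (hn : m ≤ n) : side ((M.state ε δ z n).q, (M.state ε δ z n).p) = crossingWell m := by
  obtain ⟨j, rfl⟩ := Nat.exists_eq_add_of_le hn
  have ha1 := M.a₁_pos
  have ha2 := M.a₂_pos
  obtain ⟨hr, hl⟩ := h.trap_state hm j
  rcases hW : crossingWell m with _ | _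
  · obtain ⟨h1, h2⟩ := hl hW
    by_cases he : Even j
    · simp [side, (h1 he).2, ha1]
    · simp [side, (h2 he).2, (h2 he).1]
  · obtain ⟨h1, h2⟩ := hr hW
    by_cases he : Even j
    · simp [side, (h1 he).2, not_lt.2 ha2.le, ha2.ne']
    · simp [side, (h2 he).2, not_lt.2 (h2 he).1.le]

theorem flight_zero : M.flight ε δ z 0 = M.a₂ - M.q₀ := by
  have : M.wallAt ε δ z 0 = .right := nextWall_of_pos M.p₀_pos (M.pO_lt.trans_le (le_abs_self _))
  rw [flight, this]
  exact abs_of_nonneg (sub_nonneg.2 M.q₀_mem.2)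

theorem Regular.flight_top (h : M.Regular ε δ z b B) {m n : ℕ} (hm : M.IsCrossing ε δ z m)
    (hn : n < m) (hn0 : 0 < n) : M.flight ε δ z n = M.a₁ + M.a₂ := by
  have ha1 := M.a₁_pos
  have ha2 := M.a₂_pos
  obtain ⟨h1, h2, -, -⟩ := h.top_state n fun j hj => hm.2 j (by omega)
  rw [flight, h.top_wallAt fun j hj => hm.2 j (by omega)]
  split_ifs with he
  · rw [(h1 he).2 hn0, wallPos, abs_of_pos (by linarith)]
    ring
  · rw [(h2 he).2, wallPos, abs_of_neg (by linarith)]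
    ring

theorem Regular.flight_trap (h : M.Regular ε δ z b B) {m n : ℕ} (hm : M.IsCrossing ε δ z m)
    (hn : m ≤ n) : M.flight ε δ z n = M.wellWidth (crossingWell m) := by
  obtain ⟨j, rfl⟩ := Nat.exists_eq_add_of_le hn
  have ha1 := M.a₁_pos
  have ha2 := M.a₂_pos
  obtain ⟨hr, hl⟩ := h.trap_state hm j
  rw [flight, h.trap_wallAt hm]
  rcases hW : crossingWell m with _ | _
  · obtain ⟨h1, h2⟩ := hl hW
    split_ifs with he
    · simp [wallPos, (h1 he).2, wellWidth, abs_of_pos ha1]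
    · simp [wallPos, (h2 he).2, wellWidth, Well.outer, abs_of_pos ha1]
  · obtain ⟨h1, h2⟩ := hr hW
    split_ifs with he
    · simp [wallPos, (h1 he).2, wellWidth, abs_of_pos ha2]
    · simp [wallPos, (h2 he).2, wellWidth, Well.outer, abs_of_pos ha2]

/-! ### The well in terms of the logarithmic steps -/

/-- The well is determined by the kind of the step that passes the level `log (p₀ / pO) / ε`. -/
theorem Regular.inFirst_iff (h : M.Regular ε δ z b B) {m : ℕ} (hm : M.IsCrossing ε δ z m) :
    InFirst (fun i => logStep ε (M.loss δ z .right i)) (fun i => logStep ε (M.loss δ z .left i))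
      (Real.log (M.p₀ / M.pO) / ε) ↔ crossingWell m = .right := by
  set x : ℕ → ℝ := fun i => logStep ε (M.loss δ z .right i) with hx
  set y : ℕ → ℝ := fun i => logStep ε (M.loss δ z .left i) with hy
  -- The logarithmic decrement divided by `ε` after `n` collisions, as if the particle never were
  -- trapped. It agrees with the real one up to the crossing, where even indices belong to the right
  -- wall.
  set Λ : ℕ → ℝ := fun n => ∑ j ∈ Finset.range n, if Even j then x (j / 2) else y (j / 2) with hΛ
  have hε := h.ε_pos
  have hΛmono : Monotone Λ := by
    refine monotone_nat_of_le_succ fun n => ?_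
    rw [hΛ]
    simp only [Finset.sum_range_succ]
    have hx0 : 0 ≤ x (n / 2) :=
      h.b_pos.le.trans ((h.le_loss _ _).trans (le_logStep hε (h.loss_small _ _)))
    have hy0 : 0 ≤ y (n / 2) :=
      h.b_pos.le.trans ((h.le_loss _ _).trans (le_logStep hε (h.loss_small _ _)))
    split_ifs <;> linarith
  have hΛodd : ∀ i, Λ (2 * i + 1) = Λ (2 * i) + x i := by
    intro i
    simp only [hΛ, Finset.sum_range_succ]
    rw [if_pos (even_two_mul i), Nat.mul_div_cancel_left _ two_pos]
  have hΛeven : ∀ i, Λ (2 * i) = pairSum x y i := by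
    intro i
    induction i with
    | zero => simp [hΛ, pairSum]
    | succ i ih =>
      have : 2 * (i + 1) = 2 * i + 1 + 1 := by ring
      rw [this, pairSum, Finset.sum_range_succ, ← pairSum, ← ih, ← add_assoc, ← hΛodd]
      simp only [hΛ]
      rw [Finset.sum_range_succ _ (2 * i + 1), if_neg (by simp)]
      congr 2
      omega
  have hlog : ∀ n ≤ m, Real.log M.p₀ - Real.log (M.speed ε δ z n) = ε * Λ n := by
    intro n
    induction n with
    | zero => intro _; simp [hΛ, speed_zero]
    | succ n ih =>
      intro hn
      have hf := h.factor_ge n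
      have htop : ∀ j < n + 1, M.pO < M.speed ε δ z j := fun j hj => hm.2 j (by omega)
      obtain ⟨-, -, h3, h4⟩ := h.top_state n fun j hj => htop j (by omega)
      have hstep : ε * (if Even n then x (n / 2) else y (n / 2))
          = -Real.log (1 - ε * M.lossAt ε δ z n) := by
        have : (if Even n then x (n / 2) else y (n / 2)) = logStep ε (M.lossAt ε δ z n) := by
          rw [lossAt, h.top_wallAt htop]
          split_ifs with he
          · rw [h3]
            have : (n + 1) / 2 = n / 2 := by obtain ⟨k, rfl⟩ := he; omega
            rw [this]
          · rw [h4]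
        rw [this, logStep]
        field_simp
      rw [h.speed_succ, Real.log_mul (h.speed_pos n).ne' (by linarith)]
      simp only [hΛ] at ih ⊢
      rw [Finset.sum_range_succ, mul_add, hstep, ← ih (by omega)]
      ring
  -- The conventions match: a speed strictly above `pO` corresponds to a sum strictly below the
  -- level, as in the half-open condition of `InFirst`.
  have hlevel : ∀ n ≤ m, (Λ n < Real.log (M.p₀ / M.pO) / ε ↔ M.pO < M.speed ε δ z n) := by
    intro n hn
    rw [lt_div_iff₀ hε, Real.log_div M.p₀_pos.ne' M.pO_pos.ne',
      ← Real.log_lt_log_iff M.pO_pos (h.speed_pos n)]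
    have := hlog n hn
    constructor <;> intro h' <;> linarith
  have hm0 := hm.pos
  have hbelow : Λ (m - 1) < Real.log (M.p₀ / M.pO) / ε :=
    (hlevel (m - 1) (by omega)).2 (hm.2 _ (by omega))
  have habove : Real.log (M.p₀ / M.pO) / ε ≤ Λ m := by
    rw [← not_lt, hlevel m le_rfl]
    exact not_lt.2 hm.1
  have hcw : crossingWell m = .right ↔ ¬ Even m := by
    unfold crossingWell
    split_ifs with he <;> simp [he]
  rw [hcw]
  constructor
  · rintro ⟨i, h1, h2⟩
    rw [← hΛeven] at h1 h2
    rw [← hΛodd] at h2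
    have l1 : 2 * i < m := by
      by_contra! hcon
      linarith [hΛmono hcon]
    have l2 : m - 1 < 2 * i + 1 := by
      by_contra! hcon
      linarith [hΛmono hcon]
    have : m = 2 * i + 1 := by omega
    rw [this]
    simp
  · intro ho
    obtain ⟨i, rfl⟩ := Nat.not_even_iff_odd.1 ho
    refine ⟨i, ?_, ?_⟩
    · rw [← hΛeven]; simpa using hbelow
    · rw [← hΛeven, ← hΛodd]; exact habove

end Model
end NearlyElastic

namespace NearlyElastic

/-! ### The graph along one well -/

/-- The top edge and one lower edge form a half-line, on which the shortest path through the vertex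
is the straight one. Energies below `0` are cut off at `0`. -/
theorem Graph.dist_point {hO : ℝ} (hpos : 0 < hO) (w : Well) (x y : ℝ) :
    dist (Graph.point hpos w x) (Graph.point hpos w y) = |max x 0 - max y 0| := by
  rw [Graph.dist_def]
  by_cases hx : hO ≤ x <;> by_cases hy : hO ≤ y
  · simp [Graph.point, hx, hy]
  · have h1 : hO ≤ max x 0 := hx.trans (le_max_left _ _)
    have h2 : max y 0 ≤ hO := max_le (not_le.1 hy).le hpos.le
    simp only [Graph.point, hx, hy, if_true, if_false, reduceCtorEq]
    rw [abs_of_nonneg (by linarith), abs_of_nonpos (by linarith), abs_of_nonneg (by linarith)]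
    ring
  · have h1 : hO ≤ max y 0 := hy.trans (le_max_left _ _)
    have h2 : max x 0 ≤ hO := max_le (not_le.1 hx).le hpos.le
    simp only [Graph.point, hx, hy, if_true, if_false, reduceCtorEq]
    rw [abs_of_nonpos (by linarith), abs_of_nonneg (by linarith), abs_of_nonpos (by linarith)]
    ring
  · simp [Graph.point, hx, hy]

theorem Graph.dist_point_le {hO : ℝ} (hpos : 0 < hO) (w : Well) (x y : ℝ) :
    dist (Graph.point hpos w x) (Graph.point hpos w y) ≤ |x - y| := by
  rw [Graph.dist_point]
  exact abs_max_sub_max_le_abs x y 0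

/-- Above the vertex the label of the well is irrelevant, so the whole path can be written with the
well in which the particle ends. -/
theorem Graph.point_eq_of_le {hO : ℝ} (hpos : 0 < hO) (w w' : Well) {x : ℝ} (hx : hO ≤ x) :
    Graph.point hpos w x = Graph.point hpos w' x := by
  ext <;> simp [Graph.point, hx]

namespace Model

variable {M : Model} {ε δ : ℝ} {z : Wall → ℕ → ℝ} {b B : ℝ}

/-! ### Collision times and the slow path -/

/-- The minimal width of a well. -/
def minWidth (M : Model) : ℝ := min M.a₁ M.a₂

theorem minWidth_pos (M : Model) : 0 < M.minWidth := lt_min M.a₁_pos M.a₂_pos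

namespace Regular

theorem flight_nonneg (n : ℕ) : 0 ≤ M.flight ε δ z n := abs_nonneg _

variable (h : M.Regular ε δ z b B)
include h

/-- The first flight is excluded: it starts at `q₀` and may be arbitrarily short, or of length zero
if `q₀ = a₂`. -/
theorem minWidth_le_flight {n : ℕ} (hn : 0 < n) : M.minWidth ≤ M.flight ε δ z n := by
  obtain ⟨m, hm⟩ := h.exists_crossing
  have h1 := M.a₁_pos
  have h2 := M.a₂_pos
  by_cases hnm : n < m
  · rw [h.flight_top hm hnm hn]
    exact (min_le_left _ _).trans (by linarith)
  · rw [h.flight_trap hm (not_lt.1 hnm)]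
    rcases crossingWell m with _ | _
    · exact min_le_left _ _
    · exact min_le_right _ _

theorem hitTime_mono : Monotone (M.hitTime ε δ z) :=
  monotone_nat_of_le_succ fun n => by
    rw [hitTime_succ]
    have := div_nonneg (flight_nonneg (M := M) (ε := ε) (δ := δ) (z := z) n) (h.speed_pos n).le
    linarith

theorem hitTime_succ_ge {n : ℕ} (hn : 0 < n) :
    M.hitTime ε δ z n + M.minWidth / M.speed ε δ z n ≤ M.hitTime ε δ z (n + 1) := by
  rw [hitTime_succ]
  have := h.speed_pos n
  have := h.minWidth_le_flight hn
  gcongr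

theorem hitTime_lt_succ {n : ℕ} (hn : 0 < n) : M.hitTime ε δ z n < M.hitTime ε δ z (n + 1) := by
  have := h.hitTime_succ_ge hn
  have := div_pos M.minWidth_pos (h.speed_pos n)
  linarith

/-- From the second flight on, each lasts at least the minimal width divided by the initial speed.
Hence collision times do not accumulate. -/
theorem hitTime_ge (n : ℕ) : n * (M.minWidth / M.p₀) ≤ M.hitTime ε δ z (n + 1) := by
  induction n with
  | zero =>
    have := h.hitTime_mono (Nat.zero_le 1)
    rw [hitTime_zero] at this
    simpa using this
  | succ n ih =>
    have h1 := h.hitTime_succ_ge (n := n + 1) (by omega)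
    have h2 : M.minWidth / M.p₀ ≤ M.minWidth / M.speed ε δ z (n + 1) := by
      have := h.speed_pos (n + 1)
      have := M.minWidth_pos
      have h3 := h.speed_antitone (Nat.zero_le (n + 1))
      rw [speed_zero] at h3
      gcongr
    push_cast
    linarith

theorem exists_lt_hitTime (t : ℝ) : ∃ n, t < M.hitTime ε δ z (n + 1) := by
  have hpos := div_pos M.minWidth_pos M.p₀_pos
  obtain ⟨n, hn⟩ := exists_nat_gt (t / (M.minWidth / M.p₀))
  rw [div_lt_iff₀ hpos] at hn
  exact ⟨n, hn.trans_le (h.hitTime_ge n)⟩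

theorem bddAbove_hits (t : ℝ) : BddAbove {n : ℕ | M.hitTime ε δ z n ≤ t} := by
  obtain ⟨n, hn⟩ := h.exists_lt_hitTime t
  refine ⟨n + 1, fun k hk => ?_⟩
  by_contra! hcon
  have := h.hitTime_mono hcon.le
  have hk' : M.hitTime ε δ z k ≤ t := hk
  linarith

theorem numHits_spec {t : ℝ} (ht : 0 ≤ t) : M.hitTime ε δ z (M.numHits ε δ z t) ≤ t ∧
    t < M.hitTime ε δ z (M.numHits ε δ z t + 1) := by
  have hb := h.bddAbove_hits t
  -- The supremum is attained because the set is bounded and contains `0`; this is where `0 ≤ t`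
  -- enters.
  refine ⟨Nat.sSup_mem (s := {n : ℕ | M.hitTime ε δ z n ≤ t}) ⟨0, by simpa [hitTime_zero]⟩ hb, ?_⟩
  by_contra! hcon
  have : M.numHits ε δ z t + 1 ≤ M.numHits ε δ z t := le_csSup hb hcon
  omega

theorem numHits_eq {t : ℝ} {n : ℕ} (h1 : M.hitTime ε δ z n ≤ t)
    (h2 : t < M.hitTime ε δ z (n + 1)) : M.numHits ε δ z t = n := by
  have h0 : 0 ≤ t := by
    have := h.hitTime_mono (Nat.zero_le n)
    rw [hitTime_zero] at this
    linarith
  obtain ⟨h3, h4⟩ := h.numHits_spec h0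
  apply le_antisymm
  · by_contra! hcon
    linarith [h.hitTime_mono (show n + 1 ≤ M.numHits ε δ z t from hcon)]
  · by_contra! hcon
    linarith [h.hitTime_mono (show M.numHits ε δ z t + 1 ≤ n from hcon)]

/-- The strict inequality rules out a first flight of length zero, for which the trajectory at this
time already shows the state after the next collision. -/
theorem trajectory_hitTime {n : ℕ} (hn : M.hitTime ε δ z n < M.hitTime ε δ z (n + 1)) :
    M.trajectory ε δ z (M.hitTime ε δ z n) = ((M.state ε δ z n).q, (M.state ε δ z n).p) := by
  have : M.numHits ε δ z (M.hitTime ε δ z n) = n := h.numHits_eq le_rfl hn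
  simp only [trajectory, this]
  rw [show (M.state ε δ z n).time = M.hitTime ε δ z n from rfl, sub_self, mul_zero, add_zero]

end Regular

/-- The energy after `n` collisions. -/
def energyAt (M : Model) (ε δ : ℝ) (z : Wall → ℕ → ℝ) (n : ℕ) : ℝ := M.speed ε δ z n ^ 2 / 2

/-- The interpolated energy between the collisions number `n` and `n + 1`. -/
def segment (M : Model) (ε δ : ℝ) (z : Wall → ℕ → ℝ) (n : ℕ) (s : ℝ) : ℝ :=
  M.energyAt ε δ z n + (s - M.hitTime ε δ z n) / (M.hitTime ε δ z (n + 1) - M.hitTime ε δ z n)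
    * (M.energyAt ε δ z (n + 1) - M.energyAt ε δ z n)

theorem energy_state (n : ℕ) :
    energy ((M.state ε δ z n).q, (M.state ε δ z n).p) = M.energyAt ε δ z n := by
  rw [energy, energyAt, speed, sq_abs]

theorem Regular.energyAt_antitone (h : M.Regular ε δ z b B) : Antitone (M.energyAt ε δ z) := by
  intro i j hij
  have h1 := h.speed_antitone hij
  have h2 := h.speed_pos j
  unfold energyAt
  gcongr

/-- The interpolated energy lies between its values at the ends. -/
theorem Regular.segment_mem (h : M.Regular ε δ z b B) {n : ℕ} {s : ℝ}
    (h1 : M.hitTime ε δ z n ≤ s) (h2 : s < M.hitTime ε δ z (n + 1)) :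
    M.segment ε δ z n s ∈ Icc (M.energyAt ε δ z (n + 1)) (M.energyAt ε δ z n) := by
  have hle := h.energyAt_antitone (Nat.le_add_right n 1)
  have hd : 0 < M.hitTime ε δ z (n + 1) - M.hitTime ε δ z n := by linarith
  set r := (s - M.hitTime ε δ z n) / (M.hitTime ε δ z (n + 1) - M.hitTime ε δ z n) with hr
  have hr0 : 0 ≤ r := div_nonneg (by linarith) hd.le
  have hr1 : r ≤ 1 := by
    rw [hr, div_le_one hd]
    linarith
  unfold segment
  rw [← hr]
  constructor <;> nlinarith

/-- The slow path in terms of the states at the two ends of the segment. -/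
theorem Regular.slowPath_eq_segment (h : M.Regular ε δ z b B) {t : ℝ} (ht : 0 ≤ t) :
    M.slowPath ε δ z t = Graph.point M.hO_pos
      (side ((M.state ε δ z (M.numHits ε δ z (t / ε) + 1)).q,
        (M.state ε δ z (M.numHits ε δ z (t / ε) + 1)).p))
      (M.segment ε δ z (M.numHits ε δ z (t / ε)) (t / ε)) := by
  obtain ⟨h1, h2⟩ := h.numHits_spec (div_nonneg ht h.ε_pos.le)
  have e1 := h.trajectory_hitTime (h1.trans_lt h2)
  have e2 := h.trajectory_hitTime
    (h.hitTime_lt_succ (Nat.succ_pos (M.numHits ε δ z (t / ε))))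
  simp only [slowPath]
  rw [e1, e2, energy_state, energy_state]
  rfl

/-- The slow path is the point with the interpolated energy in the final well. -/
theorem Regular.slowPath_eq (h : M.Regular ε δ z b B) {m : ℕ} (hm : M.IsCrossing ε δ z m) {t : ℝ}
    (ht : 0 ≤ t) : M.slowPath ε δ z t = Graph.point M.hO_pos (crossingWell m)
      (M.segment ε δ z (M.numHits ε δ z (t / ε)) (t / ε)) := by
  obtain ⟨h1, h2⟩ := h.numHits_spec (div_nonneg ht h.ε_pos.le)
  rw [h.slowPath_eq_segment ht]
  by_cases hnm : m ≤ M.numHits ε δ z (t / ε) + 1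
  · rw [h.side_trap hm hnm]
  -- Both ends of the segment precede the crossing, so the segment stays on the top edge.
  · apply Graph.point_eq_of_le
    refine le_trans ?_ (h.segment_mem h1 h2).1
    have := hm.2 (M.numHits ε δ z (t / ε) + 1) (by omega)
    have := M.pO_pos
    unfold hO energyAt
    gcongr

/-- The interpolated energy is continuous. -/
theorem Regular.continuousOn_segment (h : M.Regular ε δ z b B) :
    ContinuousOn (fun s => M.segment ε δ z (M.numHits ε δ z s) s) (Ici 0) := by
  have key : ∀ n, ContinuousOn (fun s => M.segment ε δ z (M.numHits ε δ z s) s)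
      (Icc 0 (M.hitTime ε δ z n)) := by
    intro n
    induction n with
    | zero => rw [hitTime_zero, Icc_self]; exact continuousOn_singleton _ _
    | succ n ih =>
      have h0 : 0 ≤ M.hitTime ε δ z n := by
        simpa [hitTime_zero] using h.hitTime_mono (Nat.zero_le n)
      have hle := h.hitTime_mono (Nat.le_add_right n 1)
      rw [← Icc_union_Icc_eq_Icc h0 hle]
      refine ih.union_of_isClosed ?_ isClosed_Icc isClosed_Icc
      -- Equality occurs when the first flight has length zero.
      rcases hle.eq_or_lt with heq | hlt
      · rw [← heq, Icc_self]; exact continuousOn_singleton _ _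
      · have hlin : ContinuousOn (M.segment ε δ z n)
            (Icc (M.hitTime ε δ z n) (M.hitTime ε δ z (n + 1))) := by
          unfold segment
          fun_prop
        refine hlin.congr fun s hs => ?_
        -- At the right end the hit counter has already moved on, but the next segment starts with
        -- the energy with which this one ends.
        rcases hs.2.eq_or_lt with hs2 | hs2
        · have hnum : M.numHits ε δ z s = n + 1 := by
            rw [hs2]
            exact h.numHits_eq le_rfl (h.hitTime_lt_succ (Nat.succ_pos n))
          simp only [hnum]
          rw [hs2]
          unfold segment
          rw [sub_self, zero_div, zero_mul, add_zero, div_self (by linarith), one_mul]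
          ring
        · simp only [h.numHits_eq hs.1 hs2]
  intro x hx
  obtain ⟨n, hn⟩ := h.exists_lt_hitTime x
  refine ((key (n + 1)) x ⟨hx, hn.le⟩).mono_of_mem_nhdsWithin ?_
  rw [← Ici_inter_Iic]
  exact inter_mem self_mem_nhdsWithin (mem_nhdsWithin_of_mem_nhds (Iic_mem_nhds hn))

theorem Regular.continuousOn_slowPath (h : M.Regular ε δ z b B) :
    ContinuousOn (M.slowPath ε δ z) (Ici 0) := by
  obtain ⟨m, hm⟩ := h.exists_crossing
  have : ContinuousOn (fun t => Graph.point M.hO_pos (crossingWell m)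
      (M.segment ε δ z (M.numHits ε δ z (t / ε)) (t / ε))) (Ici 0) := by
    refine (Graph.continuous_point M.hO_pos (crossingWell m)).comp_continuousOn ?_
    refine h.continuousOn_segment.comp (f := fun t => t / ε) (by fun_prop) fun t ht => ?_
    exact div_nonneg ht h.ε_pos.le
  exact this.congr fun t ht => h.slowPath_eq hm ht

theorem Regular.slowPathC_apply (h : M.Regular ε δ z b B) {T : ℝ} (t : Icc (0 : ℝ) T) :
    M.slowPathC T ε δ z t = M.slowPath ε δ z t := by
  have : Continuous fun t : Icc (0 : ℝ) T => M.slowPath ε δ z t :=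
    h.continuousOn_slowPath.comp_continuous continuous_subtype_val fun t => t.2.1
  rw [slowPathC, dif_pos this]
  rfl

end Model
end NearlyElastic

namespace NearlyElastic

/-! ### Averaging along a trajectory -/

/-- Summation by parts against a monotone sequence. -/
theorem abs_sum_mul_le {a u : ℕ → ℝ} (hu : Monotone u) (hu0 : 0 ≤ u 0) {s : ℝ} {N : ℕ}
    (hs : ∀ n ≤ N, |∑ j ∈ Finset.range n, a j| ≤ s) {n : ℕ} (hn : n ≤ N) :
    |∑ j ∈ Finset.range n, a j * u j| ≤ 2 * s * u n := by
  have key : ∀ n ≤ N, |∑ j ∈ Finset.range n, a j * u j - (∑ j ∈ Finset.range n, a j) * u n|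
      ≤ s * (u n - u 0) := by
    intro n
    induction n with
    | zero => simp
    | succ n ih =>
      intro hn
      have h1 := ih (by omega)
      have h2 := hs (n + 1) hn
      have h3 : 0 ≤ u (n + 1) - u n := sub_nonneg.2 (hu (Nat.le_succ n))
      have e : ∑ j ∈ Finset.range (n + 1), a j * u j - (∑ j ∈ Finset.range (n + 1), a j) * u (n + 1)
          = (∑ j ∈ Finset.range n, a j * u j - (∑ j ∈ Finset.range n, a j) * u n)
            - (∑ j ∈ Finset.range (n + 1), a j) * (u (n + 1) - u n) := by
        rw [Finset.sum_range_succ, Finset.sum_range_succ]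
        ring
      rw [e]
      refine (abs_sub _ _).trans ?_
      rw [abs_mul, abs_of_nonneg h3]
      nlinarith [mul_le_mul_of_nonneg_right h2 h3]
  have h1 := key n hn
  have h2 := hs n hn
  have hun : u 0 ≤ u n := hu (Nat.zero_le n)
  have h3 : |(∑ j ∈ Finset.range n, a j) * u n| ≤ s * u n := by
    rw [abs_mul, abs_of_nonneg (hu0.trans hun)]
    exact mul_le_mul_of_nonneg_right h2 (hu0.trans hun)
  have h4 := abs_add_le (∑ j ∈ Finset.range n, a j * u j - (∑ j ∈ Finset.range n, a j) * u n)
    ((∑ j ∈ Finset.range n, a j) * u n)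
  rw [sub_add_cancel] at h4
  have hs0 : 0 ≤ s := (abs_nonneg _).trans h2
  nlinarith

/-- Convergence of the averages controls the rescaled partial sums uniformly. -/
theorem eventually_partialSum_le {a : ℕ → ℝ} {c : ℝ}
    (h : Tendsto (fun n : ℕ => (∑ k ∈ Finset.range n, a k) / n) atTop (𝓝 c)) {K e : ℝ} (hK : 0 < K)
    (he : 0 < e) : ∀ᶠ ε in 𝓝[>] (0 : ℝ), ∀ n : ℕ, ε * n ≤ K →
      ε * |∑ k ∈ Finset.range n, (a k - c)| ≤ e := by
  obtain ⟨N, hN⟩ := (Metric.tendsto_atTop.1 h) (e / K) (by positivity)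
  -- The finitely many `n ≤ N` are handled by the smallness of `ε`, all larger ones by the
  -- convergence of the averages and `ε * n ≤ K`.
  set D := ∑ n ∈ Finset.range (N + 1), |∑ k ∈ Finset.range n, (a k - c)| with hD
  have hsmall : ∀ᶠ ε in 𝓝[>] (0 : ℝ), ε * D < e := by
    have : Tendsto (fun ε : ℝ => ε * D) (𝓝[>] 0) (𝓝 (0 * D)) :=
      (tendsto_nhdsWithin_of_tendsto_nhds tendsto_id).mul_const D
    exact this.eventually (gt_mem_nhds (by simpa using he))
  filter_upwards [hsmall, self_mem_nhdsWithin] with ε h1 (hε : 0 < ε) n hn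
  by_cases hnN : n ≤ N
  · refine le_trans ?_ h1.le
    gcongr
    exact Finset.single_le_sum (f := fun n => |∑ k ∈ Finset.range n, (a k - c)|)
      (fun _ _ => abs_nonneg _) (Finset.mem_range.2 (by omega))
  · have hn0 : (0 : ℝ) < n := by exact_mod_cast (by omega : 0 < n)
    have := (hN n (by omega)).le
    rw [Real.dist_eq] at this
    have e1 : ∑ k ∈ Finset.range n, (a k - c) = ((∑ k ∈ Finset.range n, a k) / n - c) * n := by
      rw [Finset.sum_sub_distrib, Finset.sum_const, Finset.card_range, nsmul_eq_mul]
      field_simp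
    rw [e1, abs_mul, abs_of_pos hn0]
    calc ε * (|(∑ k ∈ Finset.range n, a k) / n - c| * n)
        = |(∑ k ∈ Finset.range n, a k) / n - c| * (ε * n) := by ring
      _ ≤ e / K * K := by gcongr
      _ = e := by field_simp

/-- Comparison of the inverse speed with its limit. -/
theorem abs_sub_broken_le {k k' u₀ uO t₀ e₁ e₂ : ℝ} (hk : 0 < k) (hk' : 0 < k')
    (ht₀ : k * t₀ = uO - u₀) (he₁ : 0 ≤ e₁) (he₂ : 0 ≤ e₂) {u τ : ℝ}
    (h : (|u - u₀ - k * τ| ≤ e₁ ∧ u ≤ uO + e₂) ∨ ∃ um τm, τm ≤ τ ∧ uO ≤ um ∧ um ≤ uO + e₂ ∧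
      |um - u₀ - k * τm| ≤ e₁ ∧ |u - u₀ - k * τm - k' * (τ - τm)| ≤ e₁) :
    |u - (u₀ + k * min τ t₀ + k' * max (τ - t₀) 0)| ≤ e₁ + (1 + k' / k) * (e₁ + e₂) := by
  have hkk : 0 ≤ k' / k := by positivity
  have hK : k * (1 + k' / k) = k + k' := by field_simp
  -- Moving the break of the line by `d` changes the value by the difference of the slopes times
  -- `d`, and the break is known up to `(e₁ + e₂) / k`.
  have bound : ∀ d : ℝ, k * |d| ≤ e₁ + e₂ → |(k - k') * d| ≤ (1 + k' / k) * (e₁ + e₂) := by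
    intro d hd
    have h1 : |k - k'| ≤ k + k' := abs_le.2 ⟨by linarith, by linarith⟩
    rw [abs_mul]
    calc |k - k'| * |d| ≤ (k + k') * |d| := by gcongr
      _ = (1 + k' / k) * (k * |d|) := by rw [← hK]; ring
      _ ≤ _ := by gcongr
  have hnn : 0 ≤ (1 + k' / k) * (e₁ + e₂) := by positivity
  rcases h with ⟨h1, h2⟩ | ⟨um, τm, h1, h2, h3, h4, h5⟩
  · rcases le_total τ t₀ with hτ | hτ
    · rw [min_eq_left hτ, max_eq_right (by linarith)]
      have : u - (u₀ + k * τ + k' * 0) = u - u₀ - k * τ := by ring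
      rw [this]
      linarith
    · rw [min_eq_right hτ, max_eq_left (by linarith)]
      -- Before the crossing `u` is at most `uO + e₂`, so the time cannot be much beyond `t₀`.
      have hd := bound (τ - t₀) (by
        rw [abs_of_nonneg (by linarith)]
        linarith [(abs_le.1 h1).1])
      have : u - (u₀ + k * t₀ + k' * (τ - t₀)) = (u - u₀ - k * τ) + (k - k') * (τ - t₀) := by ring
      rw [this]
      exact (abs_add_le _ _).trans (add_le_add h1 hd)
  · have hm : k * |τm - t₀| ≤ e₁ + e₂ := by
      have e : k * |τm - t₀| = |k * (τm - t₀)| := by rw [abs_mul, abs_of_pos hk]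
      rw [e, abs_le]
      constructor <;> linarith [(abs_le.1 h4).1, (abs_le.1 h4).2]
    rcases le_total τ t₀ with hτ | hτ
    · rw [min_eq_left hτ, max_eq_right (by linarith)]
      have hd := bound (τ - τm) (le_trans (mul_le_mul_of_nonneg_left (by
        rw [abs_of_nonneg (by linarith), abs_of_nonpos (by linarith)]
        linarith) hk.le) hm)
      have : u - (u₀ + k * τ + k' * 0)
          = (u - u₀ - k * τm - k' * (τ - τm)) - (k - k') * (τ - τm) := by ring
      rw [this]
      exact (abs_sub _ _).trans (add_le_add h5 hd)
    · rw [min_eq_right hτ, max_eq_left (by linarith)]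
      have hd := bound (τm - t₀) hm
      have : u - (u₀ + k * t₀ + k' * (τ - t₀))
          = (u - u₀ - k * τm - k' * (τ - τm)) + (k - k') * (τm - t₀) := by ring
      rw [this]
      exact (abs_add_le _ _).trans (add_le_add h5 hd)

/-- The energy as a function of the inverse speed has a derivative of modulus `u ^ (-3)`, which is
bounded away from `0`. -/
theorem abs_inv_sq_sub_le {u g u₀ : ℝ} (hu₀ : 0 < u₀) (hu : u₀ ≤ u) (hg : u₀ ≤ g) :
    |1 / (2 * u ^ 2) - 1 / (2 * g ^ 2)| ≤ |u - g| / u₀ ^ 3 := by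
  have hu' : 0 < u := hu₀.trans_le hu
  have hg' : 0 < g := hu₀.trans_le hg
  have e : 1 / (2 * u ^ 2) - 1 / (2 * g ^ 2)
      = (g - u) * ((1 / (u ^ 2 * g) + 1 / (u * g ^ 2)) / 2) := by
    field_simp
    ring
  have h1 : 1 / (u ^ 2 * g) ≤ 1 / u₀ ^ 3 := by
    apply one_div_le_one_div_of_le (by positivity)
    calc u₀ ^ 3 = u₀ ^ 2 * u₀ := by ring
      _ ≤ u ^ 2 * g := by gcongr
  have h2 : 1 / (u * g ^ 2) ≤ 1 / u₀ ^ 3 := by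
    apply one_div_le_one_div_of_le (by positivity)
    calc u₀ ^ 3 = u₀ * u₀ ^ 2 := by ring
      _ ≤ u * g ^ 2 := by gcongr
  have h0 : 0 ≤ (1 / (u ^ 2 * g) + 1 / (u * g ^ 2)) / 2 := by positivity
  rw [e, abs_mul, abs_of_nonneg h0, abs_sub_comm, div_eq_mul_one_div |u - g|]
  exact mul_le_mul_of_nonneg_left (by linarith) (abs_nonneg _)

namespace Model

/-! ### The limiting energy for general mean losses -/

section

variable (M : Model) (C : Wall → ℝ)

/-- The rate of growth of the inverse speed above the interior wall. -/
def topRate : ℝ := (C .left + C .right) / (2 * (M.a₁ + M.a₂))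

/-- The rate of growth of the inverse speed in a well. -/
def trapRate (w : Well) : ℝ := (C w.outer + C .middle) / (2 * M.wellWidth w)

/-- The time at which the speed `pO` is reached. -/
def vertexTime : ℝ := (1 / M.pO - 1 / M.p₀) / M.topRate C

/-- The limiting inverse speed. -/
def invSpeed (w : Well) (t : ℝ) : ℝ :=
  1 / M.p₀ + M.topRate C * min t (M.vertexTime C) + M.trapRate C w * max (t - M.vertexTime C) 0

/-- The limiting energy. -/
def profile (w : Well) (t : ℝ) : ℝ := 1 / (2 * M.invSpeed C w t ^ 2)

end

variable {M : Model} {C : Wall → ℝ}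

theorem wellWidth_pos (M : Model) (w : Well) : 0 < M.wellWidth w := by
  cases w
  · exact M.a₁_pos
  · exact M.a₂_pos

theorem topRate_pos (hC : ∀ w, 0 < C w) : 0 < M.topRate C := by
  have := M.a₁_pos
  have := M.a₂_pos
  exact div_pos (add_pos (hC _) (hC _)) (by positivity)

theorem trapRate_pos (hC : ∀ w, 0 < C w) (w : Well) : 0 < M.trapRate C w :=
  div_pos (add_pos (hC _) (hC _)) (mul_pos two_pos (M.wellWidth_pos w))

theorem vertexTime_pos (hC : ∀ w, 0 < C w) : 0 < M.vertexTime C :=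
  div_pos (sub_pos.2 (one_div_lt_one_div_of_lt M.pO_pos M.pO_lt)) (topRate_pos hC)

theorem topRate_mul_vertexTime (hC : ∀ w, 0 < C w) :
    M.topRate C * M.vertexTime C = 1 / M.pO - 1 / M.p₀ :=
  mul_div_cancel₀ _ (topRate_pos hC).ne'

theorem le_invSpeed (hC : ∀ w, 0 < C w) (w : Well) {t : ℝ} (ht : 0 ≤ t) :
    1 / M.p₀ ≤ M.invSpeed C w t := by
  have h1 := topRate_pos (M := M) hC
  have h2 := trapRate_pos (M := M) hC w
  have h3 := vertexTime_pos (M := M) hC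
  have h4 : 0 ≤ min t (M.vertexTime C) := le_min ht h3.le
  have h5 : 0 ≤ max (t - M.vertexTime C) 0 := le_max_right _ _
  unfold invSpeed
  nlinarith [mul_nonneg h1.le h4, mul_nonneg h2.le h5]

theorem abs_invSpeed_sub_le (hC : ∀ w, 0 < C w) (w : Well) (s t : ℝ) :
    |M.invSpeed C w s - M.invSpeed C w t| ≤ (M.topRate C + M.trapRate C w) * |s - t| := by
  have h1 := topRate_pos (M := M) hC
  have h2 := trapRate_pos (M := M) hC w
  set t₀ := M.vertexTime C
  have e : M.invSpeed C w s - M.invSpeed C w t = M.topRate C * (min s t₀ - min t t₀)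
      + M.trapRate C w * (max (s - t₀) 0 - max (t - t₀) 0) := by
    unfold invSpeed
    ring
  have h3 : |min s t₀ - min t t₀| ≤ |s - t| := abs_min_sub_min_le_max s t₀ t t₀ |>.trans (by simp)
  have h4 : |max (s - t₀) 0 - max (t - t₀) 0| ≤ |s - t| := by
    have := abs_max_sub_max_le_abs (s - t₀) (t - t₀) 0
    rwa [sub_sub_sub_cancel_right] at this
  rw [e, add_mul]
  refine (abs_add_le _ _).trans ?_
  rw [abs_mul, abs_mul, abs_of_pos h1, abs_of_pos h2]
  gcongr

/-! ### The inverse speed along a trajectory -/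

variable {ε δ : ℝ} {z : Wall → ℕ → ℝ} {b B : ℝ}

/-- The inverse speed after `n` collisions. -/
def invSpeedAt (M : Model) (ε δ : ℝ) (z : Wall → ℕ → ℝ) (n : ℕ) : ℝ := 1 / M.speed ε δ z n

/-- The mean loss at the collision number `j + 1`, for a particle trapped at its collision number
`m`. -/
def meanLoss (C : Wall → ℝ) (m j : ℕ) : ℝ :=
  if j < m then (C .left + C .right) / 2 else (C (crossingWell m).outer + C .middle) / 2

theorem meanLoss_of_lt {m j : ℕ} (hj : j < m) : meanLoss C m j = (C .left + C .right) / 2 :=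
  if_pos hj

theorem meanLoss_of_le {m j : ℕ} (hj : m ≤ j) :
    meanLoss C m j = (C (crossingWell m).outer + C .middle) / 2 :=
  if_neg (not_lt.2 hj)

/-- The walls alternate and `meanLoss` is the average over the two walls in use, so deviations
cancel in pairs, before the crossing and after it. -/
theorem sum_wallAt_sub_meanLoss (h : M.Regular ε δ z b B) {m : ℕ} (hm : M.IsCrossing ε δ z m)
    (hC : ∀ w, 0 ≤ C w) (hCB : ∀ w, C w ≤ B) (n : ℕ) :
    |∑ j ∈ Finset.range n, (C (M.wallAt ε δ z j) - meanLoss C m j)| ≤ B := by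
  have top : ∀ n ≤ m, ∑ j ∈ Finset.range n, (C (M.wallAt ε δ z j) - meanLoss C m j)
      = if Even n then 0 else (C .right - C .left) / 2 := by
    intro n
    induction n with
    | zero => simp
    | succ n ih =>
      intro hn
      rw [Finset.sum_range_succ, ih (by omega), h.top_wallAt fun j hj => hm.2 j (by omega),
        meanLoss_of_lt (by omega)]
      by_cases he : Even n
      · simp only [Nat.even_add_one, he, if_true, not_true_eq_false, if_false]; ring
      · simp only [Nat.even_add_one, he, if_false, not_false_eq_true, if_true]; ring
  have trap : ∀ i, ∑ j ∈ Finset.range (m + i), (C (M.wallAt ε δ z j) - meanLoss C m j)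
      = (if Even m then 0 else (C .right - C .left) / 2)
        + if Even i then 0 else (C .middle - C (crossingWell m).outer) / 2 := by
    intro i
    induction i with
    | zero => simp [top m le_rfl]
    | succ i ih =>
      rw [← add_assoc, Finset.sum_range_succ, ih, h.trap_wallAt hm,
        meanLoss_of_le (by omega)]
      by_cases he : Even i
      · simp only [Nat.even_add_one, he, if_true, not_true_eq_false, if_false]; ring
      · simp only [Nat.even_add_one, he, if_false, not_false_eq_true, if_true]; ring
  have hB := h.B_pos
  have h1 := hC .left
  have h2 := hC .right
  have h3 := hC .middle
  have h4 := hC (crossingWell m).outer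
  have h5 := hCB .left
  have h6 := hCB .right
  have h7 := hCB .middle
  have h8 := hCB (crossingWell m).outer
  by_cases hn : n ≤ m
  · rw [top n hn, abs_le]
    split_ifs <;> constructor <;> linarith
  · obtain ⟨i, rfl⟩ := Nat.exists_eq_add_of_le (not_le.1 hn).le
    rw [trap i, abs_le]
    split_ifs <;> constructor <;> linarith

namespace Regular

variable (h : M.Regular ε δ z b B)
include h

theorem invSpeedAt_pos (n : ℕ) : 0 < M.invSpeedAt ε δ z n := one_div_pos.2 (h.speed_pos n)

theorem invSpeedAt_mono : Monotone (M.invSpeedAt ε δ z) := fun _ _ hij =>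
  one_div_le_one_div_of_le (h.speed_pos _) (h.speed_antitone hij)

omit h in
theorem invSpeedAt_zero : M.invSpeedAt ε δ z 0 = 1 / M.p₀ := by rw [invSpeedAt, speed_zero]

/-- The inequalities `1 + x ≤ 1 / (1 - x) ≤ 1 + x + 2 * x ^ 2` for `0 ≤ x ≤ 1 / 2`. Up to second
order the inverse speed satisfies a linear recursion. -/
theorem invSpeedAt_succ (n : ℕ) : M.invSpeedAt ε δ z n * (1 + ε * M.lossAt ε δ z n)
      ≤ M.invSpeedAt ε δ z (n + 1) ∧
    M.invSpeedAt ε δ z (n + 1) ≤ M.invSpeedAt ε δ z n * (1 + ε * M.lossAt ε δ z n)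
      + 2 * ε ^ 2 * B ^ 2 * M.invSpeedAt ε δ z n := by
  have hu := h.invSpeedAt_pos n
  have hf := h.factor_ge n
  have hf0 : 0 < 1 - ε * M.lossAt ε δ z n := by linarith
  have hε := h.ε_pos
  have hy : 0 ≤ M.lossAt ε δ z n := h.b_pos.le.trans (h.lossAt_ge n)
  have hyB := h.lossAt_le n
  have hsq : (ε * M.lossAt ε δ z n) ^ 2 ≤ (ε * B) ^ 2 := by gcongr
  have e : M.invSpeedAt ε δ z (n + 1) = M.invSpeedAt ε δ z n * (1 - ε * M.lossAt ε δ z n)⁻¹ := by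
    rw [invSpeedAt, invSpeedAt, h.speed_succ, one_div, mul_inv, one_div]
  have h1 : 1 + ε * M.lossAt ε δ z n ≤ (1 - ε * M.lossAt ε δ z n)⁻¹ := by
    rw [le_inv_comm₀ (by positivity) hf0, le_inv_comm₀ hf0 (by positivity)]
    rw [le_inv_comm₀ (by positivity) hf0, inv_eq_one_div, le_div_iff₀ (by positivity)]
    nlinarith [sq_nonneg (ε * M.lossAt ε δ z n)]
  have h2 : (1 - ε * M.lossAt ε δ z n)⁻¹
      ≤ 1 + ε * M.lossAt ε δ z n + 2 * (ε * M.lossAt ε δ z n) ^ 2 := by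
    rw [inv_le_iff_one_le_mul₀ hf0]
    nlinarith [mul_nonneg (sq_nonneg (ε * M.lossAt ε δ z n))
      (by linarith : 0 ≤ 1 - 2 * (ε * M.lossAt ε δ z n))]
  rw [e]
  constructor
  · exact mul_le_mul_of_nonneg_left h1 hu.le
  · have h3 := mul_le_mul_of_nonneg_left (h2.trans (by linarith :
      _ ≤ 1 + ε * M.lossAt ε δ z n + 2 * (ε * B) ^ 2)) hu.le
    linarith [h3]

theorem invSpeedAt_succ_le (n : ℕ) :
    M.invSpeedAt ε δ z (n + 1) ≤ M.invSpeedAt ε δ z n * (1 + 2 * ε * B) := by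
  have h1 := (h.invSpeedAt_succ n).2
  have hu := (h.invSpeedAt_pos n).le
  have h2 : ε * M.lossAt ε δ z n ≤ ε * B := by
    have := h.ε_pos
    have := h.lossAt_le n
    gcongr
  have h3 : 0 ≤ ε * B := (mul_pos h.ε_pos h.B_pos).le
  have h4 : 2 * (ε * B) ^ 2 ≤ ε * B := by nlinarith [h.small]
  nlinarith [mul_le_mul_of_nonneg_left h2 hu, mul_le_mul_of_nonneg_left h4 hu]

/-- The inverse speed is close to the sum of the mean losses. -/
theorem abs_invSpeedAt_sub_le {m : ℕ} (hm : M.IsCrossing ε δ z m) (hC : ∀ w, 0 ≤ C w)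
    (hCB : ∀ w, C w ≤ B) {e : ℝ} {N : ℕ}
    (he : ∀ w, ∀ n ≤ N, ε * |∑ k ∈ Finset.range n, (M.loss δ z w k - C w)| ≤ e) {n : ℕ}
    (hn : n ≤ N) :
    |M.invSpeedAt ε δ z n - M.invSpeedAt ε δ z 0
      - ∑ j ∈ Finset.range n, ε * meanLoss C m j * M.invSpeedAt ε δ z j|
      ≤ (6 * e + 2 * ε * B + 2 * ε ^ 2 * B ^ 2 * N) * M.invSpeedAt ε δ z n := by
  set u := M.invSpeedAt ε δ z with hu
  have hε := h.ε_pos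
  have hu0 : 0 ≤ u 0 := (h.invSpeedAt_pos 0).le
  -- The fluctuations at the three walls contribute `3 * e`, the alternation of the walls
  -- contributes `ε * B`; summation by parts doubles both.
  have hS : ∀ n ≤ N, |∑ j ∈ Finset.range n, ε * (M.lossAt ε δ z j - meanLoss C m j)|
      ≤ 3 * e + ε * B := by
    intro n hn
    have e1 : ∑ j ∈ Finset.range n, ε * (M.lossAt ε δ z j - meanLoss C m j)
        = ∑ w, ε * ∑ k ∈ Finset.range ((M.state ε δ z n).hits w), (M.loss δ z w k - C w)
          + ε * ∑ j ∈ Finset.range n, (C (M.wallAt ε δ z j) - meanLoss C m j) := by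
      rw [← Finset.mul_sum, ← Finset.mul_sum, ← mul_add,
        ← sum_hits (fun w k => M.loss δ z w k - C w), ← Finset.sum_add_distrib]
      congr 1
      refine Finset.sum_congr rfl fun j _ => ?_
      rw [lossAt]
      ring
    have hw : ∀ w, |ε * ∑ k ∈ Finset.range ((M.state ε δ z n).hits w), (M.loss δ z w k - C w)| ≤ e :=
      fun w => by
        rw [abs_mul, abs_of_pos hε]
        exact he w _ ((hits_le n w).trans hn)
    have h2 : |ε * ∑ j ∈ Finset.range n, (C (M.wallAt ε δ z j) - meanLoss C m j)| ≤ ε * B := by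
      rw [abs_mul, abs_of_pos hε]
      exact mul_le_mul_of_nonneg_left (sum_wallAt_sub_meanLoss h hm hC hCB n) hε.le
    rw [e1, Wall.sum_eq]
    have hl := abs_le.1 (hw .left)
    have hmi := abs_le.1 (hw .middle)
    have hr := abs_le.1 (hw .right)
    have h2' := abs_le.1 h2
    rw [abs_le]
    constructor
    · linarith [hl.1, hmi.1, hr.1, h2'.1]
    · linarith [hl.2, hmi.2, hr.2, h2'.2]
  have hA := abs_sum_mul_le h.invSpeedAt_mono hu0 hS hn
  -- The second-order errors are of size `ε ^ 2` per collision; their total stays of order `ε` as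
  -- long as `ε * n` is bounded.
  have hQ : |u n - u 0 - ∑ j ∈ Finset.range n, ε * M.lossAt ε δ z j * u j|
      ≤ 2 * ε ^ 2 * B ^ 2 * n * u n := by
    clear hA hn
    induction n with
    | zero => simp
    | succ n ih =>
      obtain ⟨h1, h2⟩ := h.invSpeedAt_succ n
      rw [← hu] at h1 h2
      have h3 : u n ≤ u (n + 1) := h.invSpeedAt_mono (Nat.le_succ n)
      have h4 : 2 * ε ^ 2 * B ^ 2 * n * u n ≤ 2 * ε ^ 2 * B ^ 2 * n * u (n + 1) := by gcongr
      have h5 : 2 * ε ^ 2 * B ^ 2 * u n ≤ 2 * ε ^ 2 * B ^ 2 * u (n + 1) := by gcongr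
      have h6 := abs_le.1 ih
      have h7 : 0 ≤ 2 * ε ^ 2 * B ^ 2 * u (n + 1) := by
        have := (h.invSpeedAt_pos (n + 1)).le
        positivity
      rw [Finset.sum_range_succ, abs_le]
      push_cast
      constructor
      · linarith [h6.1]
      · linarith [h6.2]
  have e2 : ∑ j ∈ Finset.range n, ε * M.lossAt ε δ z j * u j
      - ∑ j ∈ Finset.range n, ε * meanLoss C m j * u j
      = ∑ j ∈ Finset.range n, ε * (M.lossAt ε δ z j - meanLoss C m j) * u j := by
    rw [← Finset.sum_sub_distrib]
    exact Finset.sum_congr rfl fun j _ => by ring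
  have hnN : 2 * ε ^ 2 * B ^ 2 * n * u n ≤ 2 * ε ^ 2 * B ^ 2 * N * u n := by
    have := (h.invSpeedAt_pos n).le
    have : (n : ℝ) ≤ N := by exact_mod_cast hn
    gcongr
  have h1 := abs_le.1 hA
  have h2 := abs_le.1 hQ
  rw [abs_le]
  constructor
  · linarith [h1.1, h2.1]
  · linarith [h1.2, h2.2]

/-- The sum of the mean losses in terms of the rescaled collision times. -/
theorem abs_sum_meanLoss_sub_le {m : ℕ} (hm : M.IsCrossing ε δ z m) (hC : ∀ w, 0 ≤ C w)
    (hCB : ∀ w, C w ≤ B) (n : ℕ) :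
    |∑ j ∈ Finset.range n, ε * meanLoss C m j * M.invSpeedAt ε δ z j
      - (M.topRate C * (ε * M.hitTime ε δ z (min n m))
        + M.trapRate C (crossingWell m)
          * (ε * M.hitTime ε δ z n - ε * M.hitTime ε δ z (min n m)))|
      ≤ ε * B * M.invSpeedAt ε δ z 0 := by
  set u := M.invSpeedAt ε δ z with hu
  have ha1 := M.a₁_pos
  have ha2 := M.a₂_pos
  have hε := h.ε_pos
  have hu0 := h.invSpeedAt_pos 0
  rw [← hu] at hu0
  have hstep : ∀ j, ε * M.hitTime ε δ z (j + 1) - ε * M.hitTime ε δ z j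
      = ε * M.flight ε δ z j * u j := by
    intro j
    rw [hitTime_succ, hu, invSpeedAt]
    ring
  set D : ℕ → ℝ := fun n => ∑ j ∈ Finset.range n, ε * meanLoss C m j * u j
      - (M.topRate C * (ε * M.hitTime ε δ z (min n m)) + M.trapRate C (crossingWell m)
          * (ε * M.hitTime ε δ z n - ε * M.hitTime ε δ z (min n m))) with hD
  have hD0 : D 0 = 0 := by simp [hD, hitTime_zero]
  -- Only the first flight contributes to `D`, since it need not cover the full width. All later
  -- flights have exactly the width for which the increments of the two sums coincide.
  have hD1 : |D 1| ≤ ε * B * u 0 := by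
    have hm1 : min 1 m = 1 := min_eq_left hm.pos
    have h0 := hstep 0
    rw [hitTime_zero, flight_zero, mul_zero, sub_zero, zero_add] at h0
    have e1 : D 1 = ε * u 0 * ((C .left + C .right) / 2) *
        (1 - (M.a₂ - M.q₀) / (M.a₁ + M.a₂)) := by
      simp only [hD, Finset.sum_range_one, hm1, sub_self, mul_zero, add_zero,
        meanLoss_of_lt hm.pos, h0, topRate]
      field_simp
    have hq := M.q₀_mem
    have hr0 : 0 ≤ (M.a₂ - M.q₀) / (M.a₁ + M.a₂) :=
      div_nonneg (by linarith [hq.2]) (by linarith)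
    have hr1 : (M.a₂ - M.q₀) / (M.a₁ + M.a₂) ≤ 1 := by
      rw [div_le_one (by linarith)]
      linarith [hq.1]
    have hc0 : 0 ≤ (C .left + C .right) / 2 := by linarith [hC .left, hC .right]
    have hcB : (C .left + C .right) / 2 ≤ B := by linarith [hCB .left, hCB .right]
    have hB := h.B_pos
    rw [e1, abs_of_nonneg (mul_nonneg (by positivity) (by linarith))]
    calc ε * u 0 * ((C .left + C .right) / 2) * (1 - (M.a₂ - M.q₀) / (M.a₁ + M.a₂))
        ≤ ε * u 0 * B * 1 := by
          gcongr
          linarith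
      _ = ε * B * u 0 := by ring
  have hDs : ∀ n, D (n + 1 + 1) = D (n + 1) := by
    intro n
    have h1 := hstep (n + 1)
    simp only [hD]
    rw [Finset.sum_range_succ _ (n + 1)]
    by_cases hnm : n + 1 < m
    · rw [min_eq_left (by omega : n + 1 + 1 ≤ m), min_eq_left (by omega : n + 1 ≤ m),
        meanLoss_of_lt hnm]
      rw [h.flight_top hm hnm (Nat.succ_pos n)] at h1
      have : M.topRate C * (ε * M.hitTime ε δ z (n + 1 + 1))
          = M.topRate C * (ε * M.hitTime ε δ z (n + 1))
            + ε * ((C .left + C .right) / 2) * u (n + 1) := by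
        rw [← sub_eq_iff_eq_add', ← mul_sub, h1, topRate]
        field_simp
      rw [this]
      ring
    · rw [min_eq_right (by omega : m ≤ n + 1 + 1), min_eq_right (by omega : m ≤ n + 1),
        meanLoss_of_le (by omega)]
      rw [h.flight_trap hm (by omega)] at h1
      have hw := M.wellWidth_pos (crossingWell m)
      have : M.trapRate C (crossingWell m) * (ε * M.hitTime ε δ z (n + 1 + 1))
          = M.trapRate C (crossingWell m) * (ε * M.hitTime ε δ z (n + 1))
            + ε * ((C (crossingWell m).outer + C .middle) / 2) * u (n + 1) := by
        rw [← sub_eq_iff_eq_add', ← mul_sub, h1, trapRate]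
        field_simp
      rw [mul_sub, mul_sub, this]
      ring
  have hall : ∀ n, |D (n + 1)| ≤ ε * B * u 0 := by
    intro n
    induction n with
    | zero => exact hD1
    | succ n ih => rw [hDs]; exact ih
  cases n with
  | zero =>
    change |D 0| ≤ _
    rw [hD0, abs_zero]
    exact mul_nonneg (mul_pos hε h.B_pos).le hu0.le
  | succ n => exact hall n

end Regular

end Model
end NearlyElastic

namespace NearlyElastic
namespace Model

/-! ### A uniform error bound for the energy -/

variable {M : Model} {C : Wall → ℝ} {ε δ : ℝ} {z : Wall → ℕ → ℝ} {b B : ℝ}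

namespace Regular

variable (h : M.Regular ε δ z b B)
include h

theorem flight_le (n : ℕ) : M.flight ε δ z n ≤ M.a₁ + M.a₂ := by
  obtain ⟨m, hm⟩ := h.exists_crossing
  have h1 := M.a₁_pos
  have h2 := M.a₂_pos
  by_cases hnm : n < m
  · rcases Nat.eq_zero_or_pos n with rfl | hn
    · rw [flight_zero]
      linarith [M.q₀_mem.1]
    · exact (h.flight_top hm hnm hn).le
  · rw [h.flight_trap hm (not_lt.1 hnm)]
    rcases crossingWell m with _ | _ <;> simp only [wellWidth] <;> linarith

/-- The inverse speed grows at most linearly in time. -/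
theorem invSpeedAt_le (n : ℕ) : M.invSpeedAt ε δ z n
    ≤ 2 * (1 / M.p₀) + 2 * B * (ε * M.hitTime ε δ z n) / M.minWidth := by
  have hw := M.minWidth_pos
  have hε := h.ε_pos
  have hB := h.B_pos
  have hp := M.p₀_pos
  have h0 : M.invSpeedAt ε δ z 0 = 1 / M.p₀ := invSpeedAt_zero
  -- A collision adds at most `2 * ε * B * u`, and the flight before it takes at least `ε * minWidth
  -- * u` in rescaled time. The first flight has no such lower bound; its collision is absorbed by
  -- the factor `2`.
  have succ : ∀ n, M.invSpeedAt ε δ z (n + 1)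
      ≤ 2 * (1 / M.p₀) + 2 * B * (ε * M.hitTime ε δ z (n + 1)) / M.minWidth := by
    intro n
    induction n with
    | zero =>
      have h1 := h.invSpeedAt_succ_le 0
      rw [h0] at h1
      have h2 : 1 / M.p₀ * (1 + 2 * ε * B) ≤ 1 / M.p₀ * 2 := by
        have := h.small
        gcongr
        linarith
      have h3 : 0 ≤ M.hitTime ε δ z (0 + 1) := by
        simpa [hitTime_zero] using h.hitTime_mono (Nat.zero_le 1)
      have h4 : 0 ≤ 2 * B * (ε * M.hitTime ε δ z (0 + 1)) / M.minWidth := by positivity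
      linarith
    | succ n ih =>
      have h1 := h.invSpeedAt_succ_le (n + 1)
      have h2 := h.hitTime_succ_ge (Nat.succ_pos n)
      have h3 : 2 * B * (ε * (M.hitTime ε δ z (n + 1) + M.minWidth / M.speed ε δ z (n + 1)))
          / M.minWidth ≤ 2 * B * (ε * M.hitTime ε δ z (n + 1 + 1)) / M.minWidth := by
        gcongr
      have h4 : 2 * B * (ε * (M.hitTime ε δ z (n + 1) + M.minWidth / M.speed ε δ z (n + 1)))
          / M.minWidth = 2 * B * (ε * M.hitTime ε δ z (n + 1)) / M.minWidth
            + 2 * ε * B * M.invSpeedAt ε δ z (n + 1) := by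
        have := h.speed_pos (n + 1)
        rw [invSpeedAt]
        field_simp
      rw [h4] at h3
      linarith
  cases n with
  | zero =>
    rw [hitTime_zero, h0, mul_zero, mul_zero, zero_div]
    have : 0 < 1 / M.p₀ := by positivity
    linarith
  | succ n => exact succ n

end Regular

/-- A bound for the number of collisions in the rescaled time `T`, multiplied by `ε`. -/
def horizon (M : Model) (T : ℝ) : ℝ := 2 + T * M.p₀ / M.minWidth

theorem horizon_pos (M : Model) {T : ℝ} (hT : 0 < T) : 0 < M.horizon T := by
  have := M.minWidth_pos
  have := M.p₀_pos
  unfold horizon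
  positivity

set_option maxHeartbeats 1000000 in
/-- The interpolated energy is close to the limiting energy, with an explicit rate. -/
theorem exists_error_bound (M : Model) {C : Wall → ℝ} (hC : ∀ w, 0 < C w) {B T : ℝ} (hB : 0 < B)
    (hCB : ∀ w, C w ≤ B) (hT : 0 < T) (W : Well) : ∃ Q : ℝ, 0 < Q ∧
      ∀ (ε δ e b : ℝ) (z : Wall → ℕ → ℝ) (m : ℕ), M.Regular ε δ z b B → ε ≤ 1 → 0 ≤ e →
        (∀ w, ∀ n : ℕ, ε * n ≤ M.horizon T →
          ε * |∑ k ∈ Finset.range n, (M.loss δ z w k - C w)| ≤ e) →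
        M.IsCrossing ε δ z m → crossingWell m = W → ∀ t ∈ Icc 0 T,
          |M.segment ε δ z (M.numHits ε δ z (t / ε)) (t / ε) - M.profile C W t| ≤ Q * (e + ε) := by
  have hp := M.p₀_pos
  have hpO := M.pO_pos
  have ha1 := M.a₁_pos
  have ha2 := M.a₂_pos
  have hw := M.minWidth_pos
  have hK := M.horizon_pos hT
  set K := M.horizon T with hKdef
  set k := M.topRate C with hk
  set k' := M.trapRate C W with hk'
  have hk0 : 0 < k := topRate_pos hC
  have hk'0 : 0 < k' := trapRate_pos hC W
  set U := 2 * (1 / M.p₀) + 2 * B * T / M.minWidth with hU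
  have hU0 : 0 < U := by positivity
  -- Bounds, in units of `e + ε`: `q₁` for the linear relation at the collision times, `q₂` for the
  -- overshoot of the inverse speed at the crossing, `q₃` for the distance to the broken line at
  -- collision times, `q₄` for the change of that line during one flight. The factor `2 * U` covers
  -- the collision that follows time `T`.
  set q₁ := 2 * U * (6 + 3 * B + 2 * B ^ 2 * K) with hq₁
  set q₂ := 2 * B * (1 / M.pO) with hq₂
  set q₃ := q₁ + (1 + k' / k) * (q₁ + q₂) with hq₃
  set q₄ := (k + k') * ((M.a₁ + M.a₂) * U) with hq₄
  have hq₁0 : 0 < q₁ := by positivity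
  have hq₂0 : 0 < q₂ := by positivity
  have hq₃0 : 0 < q₃ := by positivity
  have hq₄0 : 0 < q₄ := by positivity
  refine ⟨(q₃ + q₄) / (1 / M.p₀) ^ 3, by positivity, ?_⟩
  intro ε δ e b z m h hε1 he hfluct hm hW t ht
  have hε := h.ε_pos
  have hs : 0 ≤ t / ε := div_nonneg ht.1 hε.le
  obtain ⟨hn1, hn2⟩ := h.numHits_spec hs
  set n := M.numHits ε δ z (t / ε) with hn
  have hτ1 : ε * M.hitTime ε δ z n ≤ t := by
    rw [le_div_iff₀ hε] at hn1; linarith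
  have hτ2 : t < ε * M.hitTime ε δ z (n + 1) := by
    rw [div_lt_iff₀ hε] at hn2; linarith
  set u := M.invSpeedAt ε δ z with hu
  have humono : Monotone u := h.invSpeedAt_mono
  have hu0 : u 0 = 1 / M.p₀ := Regular.invSpeedAt_zero
  have hτ0 : ∀ j, 0 ≤ ε * M.hitTime ε δ z j := fun j =>
    mul_nonneg hε.le (by simpa [hitTime_zero] using h.hitTime_mono (Nat.zero_le j))
  have hun : u n ≤ U := by
    refine (h.invSpeedAt_le n).trans ?_
    rw [hU]
    have := hτ1.trans ht.2
    gcongr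
  have hun1 : u (n + 1) ≤ 2 * U := by
    refine (h.invSpeedAt_succ_le n).trans ?_
    have h1 := h.invSpeedAt_pos n
    have h2 := h.small
    nlinarith
  -- the number of collisions
  have hNK : ε * ((n + 1 : ℕ) : ℝ) ≤ K := by
    push_cast
    rcases Nat.eq_zero_or_pos n with h0 | hpos
    · rw [h0, hKdef, horizon]
      have : 0 ≤ T * M.p₀ / M.minWidth := by positivity
      push_cast
      linarith
    · obtain ⟨i, hi⟩ := Nat.exists_eq_succ_of_ne_zero hpos.ne'
      have h1 := h.hitTime_ge i
      rw [Nat.succ_eq_add_one] at hi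
      rw [← hi] at h1
      have h2 : ε * (i * (M.minWidth / M.p₀)) ≤ T :=
        (mul_le_mul_of_nonneg_left h1 hε.le).trans (hτ1.trans ht.2)
      have h3 : ε * i ≤ T * M.p₀ / M.minWidth := by
        rw [le_div_iff₀ hw]
        have h4 : ε * (i * (M.minWidth / M.p₀)) * M.p₀ = ε * i * M.minWidth := by field_simp
        nlinarith
      rw [hi, hKdef, horizon]
      push_cast
      linarith
  -- the linear relation between inverse speed and time
  have hlin : ∀ j ≤ n + 1, |u j - 1 / M.p₀ - k * (ε * M.hitTime ε δ z (min j m))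
      - k' * (ε * M.hitTime ε δ z j - ε * M.hitTime ε δ z (min j m))| ≤ q₁ * (e + ε) := by
    intro j hj
    have h1 := h.abs_invSpeedAt_sub_le hm (fun w => (hC w).le) hCB (N := n + 1) (e := e)
      (fun w i hi => hfluct w i (le_trans (by
        have : (i : ℝ) ≤ ((n + 1 : ℕ) : ℝ) := by exact_mod_cast hi
        gcongr) hNK)) hj
    have h2 := h.abs_sum_meanLoss_sub_le hm (fun w => (hC w).le) hCB j
    rw [hW, ← hu, ← hk, ← hk', hu0] at h2
    rw [← hu, hu0] at h1
    have hj2 : u j ≤ 2 * U := (humono hj).trans hun1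
    have huj : 0 < u j := h.invSpeedAt_pos j
    have hp0U : 1 / M.p₀ ≤ 2 * U := by
      rw [← hu0]; exact (humono (Nat.zero_le j)).trans hj2
    have h3 : 2 * ε ^ 2 * B ^ 2 * ((n + 1 : ℕ) : ℝ) ≤ 2 * ε * B ^ 2 * K := by
      calc 2 * ε ^ 2 * B ^ 2 * ((n + 1 : ℕ) : ℝ) = 2 * ε * B ^ 2 * (ε * ((n + 1 : ℕ) : ℝ)) := by ring
        _ ≤ 2 * ε * B ^ 2 * K := by gcongr
    have h4 : (6 * e + 2 * ε * B + 2 * ε ^ 2 * B ^ 2 * ((n + 1 : ℕ) : ℝ)) * u j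
        ≤ (6 * e + 2 * ε * B + 2 * ε * B ^ 2 * K) * (2 * U) := by gcongr
    have h5 : ε * B * (1 / M.p₀) ≤ ε * B * (2 * U) := by gcongr
    have h6 : (6 * e + 2 * ε * B + 2 * ε * B ^ 2 * K) * (2 * U) + ε * B * (2 * U)
        ≤ q₁ * (e + ε) := by
      have : 0 ≤ 2 * U * (6 * ε + 3 * B * e + 2 * B ^ 2 * K * e) := by positivity
      rw [hq₁]
      linarith
    have h7 := abs_le.1 h1
    have h8 := abs_le.1 h2
    rw [abs_le]
    constructor
    · linarith [h7.1, h8.1]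
    · linarith [h7.2, h8.2]
  -- the overshoot at the crossing
  have hum : 1 / M.pO ≤ u m := one_div_le_one_div_of_le (h.speed_pos m) hm.1
  have hum2 : u m ≤ 1 / M.pO + q₂ * (e + ε) := by
    have hm0 := hm.pos
    have h1 := h.invSpeedAt_succ_le (m - 1)
    rw [Nat.sub_add_cancel hm0] at h1
    have h2 : M.invSpeedAt ε δ z (m - 1) ≤ 1 / M.pO :=
      one_div_le_one_div_of_le hpO (hm.2 _ (by omega)).le
    have h3 : M.invSpeedAt ε δ z (m - 1) * (1 + 2 * ε * B) ≤ 1 / M.pO * (1 + 2 * ε * B) := by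
      gcongr
    have h4 : 0 ≤ q₂ * e := by positivity
    rw [hq₂] at h4 ⊢
    linarith
  have hcmp : ∀ j ≤ n + 1,
      |u j - M.invSpeed C W (ε * M.hitTime ε δ z j)| ≤ q₃ * (e + ε) := by
    intro j hj
    have := abs_sub_broken_le (k := k) (k' := k') (u₀ := 1 / M.p₀) (uO := 1 / M.pO)
      (t₀ := M.vertexTime C) (e₁ := q₁ * (e + ε)) (e₂ := q₂ * (e + ε)) hk0 hk'0
      (topRate_mul_vertexTime hC) (by positivity) (by positivity) (u := u j)
      (τ := ε * M.hitTime ε δ z j) ?_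
    · refine this.trans (le_of_eq ?_)
      rw [hq₃]
      ring
    · by_cases hjm : j ≤ m
      · left
        have h1 := hlin j hj
        rw [min_eq_left hjm, sub_self, mul_zero, sub_zero] at h1
        exact ⟨h1, (humono hjm).trans hum2⟩
      · right
        push Not at hjm
        have h1 := hlin j hj
        have h2 := hlin m (hjm.le.trans hj)
        rw [min_self, sub_self, mul_zero, sub_zero] at h2
        rw [min_eq_right hjm.le] at h1
        exact ⟨u m, ε * M.hitTime ε δ z m,
          mul_le_mul_of_nonneg_left (h.hitTime_mono hjm.le) hε.le, hum, hum2, h2, h1⟩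
  -- comparison at time `t`
  have hgap : ε * M.hitTime ε δ z (n + 1) - ε * M.hitTime ε δ z n ≤ (M.a₁ + M.a₂) * U * ε := by
    have h1 : ε * M.hitTime ε δ z (n + 1) - ε * M.hitTime ε δ z n = M.flight ε δ z n * u n * ε := by
      rw [hitTime_succ, hu, invSpeedAt]
      ring
    rw [h1]
    have := h.flight_le n
    have := (h.invSpeedAt_pos n).le
    gcongr
  have hnear : ∀ j, (j = n ∨ j = n + 1) →
      |M.energyAt ε δ z j - M.profile C W t| ≤ (q₃ + q₄) / (1 / M.p₀) ^ 3 * (e + ε) := by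
    intro j hj
    have hj' : j ≤ n + 1 := by omega
    have h1 : |u j - M.invSpeed C W t| ≤ (q₃ + q₄) * (e + ε) := by
      have h2 := hcmp j hj'
      have h3 := abs_invSpeed_sub_le (M := M) hC W (ε * M.hitTime ε δ z j) t
      have h4 : |ε * M.hitTime ε δ z j - t| ≤ (M.a₁ + M.a₂) * U * ε := by
        rcases hj with rfl | rfl
        · rw [abs_of_nonpos (by linarith)]; linarith
        · rw [abs_of_nonneg (by linarith)]; linarith
      have h5 : (k + k') * |ε * M.hitTime ε δ z j - t| ≤ q₄ * ε := by
        calc _ ≤ (k + k') * ((M.a₁ + M.a₂) * U * ε) := by gcongr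
          _ = q₄ * ε := by rw [hq₄]; ring
      have h6 := abs_sub_le (u j) (M.invSpeed C W (ε * M.hitTime ε δ z j)) (M.invSpeed C W t)
      have h7 : 0 ≤ q₄ * e := by positivity
      linarith
    have huj : 1 / M.p₀ ≤ u j := by rw [← hu0]; exact humono (Nat.zero_le j)
    have h2 := abs_inv_sq_sub_le (by positivity : 0 < 1 / M.p₀) huj (le_invSpeed (M := M) hC W ht.1)
    have h3 : M.energyAt ε δ z j = 1 / (2 * u j ^ 2) := by
      have := h.speed_pos j
      rw [energyAt, hu, invSpeedAt]
      field_simp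
    rw [h3, profile, div_mul_eq_mul_div]
    refine h2.trans ?_
    gcongr
  -- The interpolated energy lies between the energies at both ends of its segment, and each of
  -- these is close to the profile.
  have hseg := h.segment_mem hn1 hn2
  have hA := abs_le.1 (hnear n (Or.inl rfl))
  have hB' := abs_le.1 (hnear (n + 1) (Or.inr rfl))
  rw [abs_le]
  constructor
  · linarith [hseg.1, hB'.1]
  · linarith [hseg.2, hA.2]

/-- If the losses have averages, the interpolated energy converges uniformly on `[0, T]`. -/
theorem eventually_abs_segment_sub_le (M : Model) {C : Wall → ℝ} (hC : ∀ w, 0 < C w) {δ b B T : ℝ}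
    (hb : 0 < b) (hT : 0 < T) {z : Wall → ℕ → ℝ} (hle : ∀ w k, b ≤ M.loss δ z w k)
    (hge : ∀ w k, M.loss δ z w k ≤ B) (hCB : ∀ w, C w ≤ B)
    (hmean : ∀ w, Tendsto (fun n : ℕ => (∑ k ∈ Finset.range n, M.loss δ z w k) / n) atTop
      (𝓝 (C w))) {κ : ℝ} (hκ : 0 < κ) :
    ∀ᶠ ε in 𝓝[>] (0 : ℝ), M.Regular ε δ z b B ∧ ∀ m, M.IsCrossing ε δ z m → ∀ t ∈ Icc 0 T,
      |M.segment ε δ z (M.numHits ε δ z (t / ε)) (t / ε) - M.profile C (crossingWell m) t| ≤ κ := by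
  have hB : 0 < B := (hC .left).trans_le (hCB .left)
  -- The well, and the constant with it, may change with `ε`; the sum of the two constants serves
  -- for both.
  choose Q hQ0 hQ using M.exists_error_bound hC hB hCB hT
  set q := Q .left + Q .right with hq
  have hq0 : 0 < q := add_pos (hQ0 _) (hQ0 _)
  have hQq : ∀ W, Q W ≤ q := fun W => by
    have := hQ0 .left
    have := hQ0 .right
    cases W <;> linarith
  set e := κ / (2 * q) with he
  have he0 : 0 < e := by positivity
  have hfl : ∀ᶠ ε in 𝓝[>] (0 : ℝ), ∀ w, ∀ n : ℕ, ε * n ≤ M.horizon T →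
      ε * |∑ k ∈ Finset.range n, (M.loss δ z w k - C w)| ≤ e :=
    eventually_all.2 fun w => eventually_partialSum_le (hmean w) (M.horizon_pos hT) he0
  have hsmall : ∀ x > (0 : ℝ), ∀ᶠ ε in 𝓝[>] (0 : ℝ), ε < x := fun x hx =>
    mem_nhdsWithin_of_mem_nhds (gt_mem_nhds hx)
  filter_upwards [hfl, hsmall 1 one_pos, hsmall e he0, hsmall (1 / (2 * B)) (by positivity),
    self_mem_nhdsWithin] with ε h1 h2 h3 h4 (hε : 0 < ε)
  have hR : M.Regular ε δ z b B := ⟨hε, hb, hle, hge, by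
    rw [lt_div_iff₀ (by positivity)] at h4
    linarith⟩
  refine ⟨hR, fun m hm t ht => ?_⟩
  refine (hQ _ ε δ e b z m hR h2.le he0.le h1 hm rfl t ht).trans ?_
  calc Q (crossingWell m) * (e + ε) ≤ q * (e + e) := by
        have := hQq (crossingWell m)
        gcongr
    _ = κ := by rw [he]; field_simp; ring

end Model
end NearlyElastic

namespace NearlyElastic

/-! ### Measurability -/

/-- The graph is covered by two continuous images of the real line. Separability of the path space,
needed for measurability, rests on this. -/
theorem Graph.secondCountableTopology {hO : ℝ} (hpos : 0 < hO) :
    SecondCountableTopology (Graph hO) := by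
  have hsep : TopologicalSpace.IsSeparable (univ : Set (Graph hO)) := by
    have hU : (univ : Set (Graph hO)) ⊆
        range (Graph.point hpos .left) ∪ range (Graph.point hpos .right) := by
      intro x _
      rcases hK : x.K with w | _
      · have h1 := x.nonneg_of_trap (by simp [hK])
        have h2 := x.lt_of_trap (by simp [hK])
        have : x = Graph.point hpos w x.H := by
          ext
          · simp [Graph.point, h1]
          · simp [Graph.point, not_le.2 h2, hK]
        rw [this]
        cases w
        · exact Or.inl ⟨_, rfl⟩
        · exact Or.inr ⟨_, rfl⟩
      · have h1 := x.le_of_top hK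
        refine Or.inl ⟨x.H, ?_⟩
        ext
        · simp [Graph.point, hpos.le.trans h1]
        · simp [Graph.point, h1, hK]
    exact ((TopologicalSpace.isSeparable_range (Graph.continuous_point hpos .left)).union
      (TopologicalSpace.isSeparable_range (Graph.continuous_point hpos .right))).mono hU
  have : TopologicalSpace.SeparableSpace (Graph hO) := TopologicalSpace.isSeparable_univ_iff.1 hsep
  exact UniformSpace.secondCountable_of_separable _

/-- A map into a separable metric space is measurable if the distances to all points are. -/
theorem measurable_of_measurable_dist {Ω E : Type*} [MeasurableSpace Ω] [PseudoMetricSpace E]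
    [SecondCountableTopology E] [MeasurableSpace E] [BorelSpace E] {f : Ω → E}
    (hf : ∀ e, Measurable fun ω => dist (f ω) e) : Measurable f := by
  refine measurable_of_isOpen fun U hU => ?_
  choose! r hr hrU using fun x (hx : x ∈ U) => Metric.isOpen_iff.1 hU x hx
  obtain ⟨T, hT, hTU⟩ := TopologicalSpace.isOpen_iUnion_countable
    (fun x : U => Metric.ball (x : E) (r x)) fun _ => Metric.isOpen_ball
  have : f ⁻¹' U = ⋃ x ∈ T, {ω | dist (f ω) x < r x} := by
    have hU' : U = ⋃ x ∈ T, Metric.ball (x : E) (r x) := by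
      rw [hTU]
      apply subset_antisymm
      · exact fun x hx => mem_iUnion.2 ⟨⟨x, hx⟩, Metric.mem_ball_self (hr x hx)⟩
      · exact iUnion_subset fun x => hrU x x.2
    calc f ⁻¹' U = f ⁻¹' ⋃ x ∈ T, Metric.ball (x : E) (r x) := congrArg _ hU'
      _ = _ := by
        ext ω
        simp [Metric.mem_ball]
  rw [this]
  exact MeasurableSet.biUnion hT fun x _ => measurableSet_lt (hf x) measurable_const

/-- A random continuous function on a compact space is measurable if its values are. -/
theorem measurable_continuousMap {Ω X E : Type*} [MeasurableSpace Ω] [TopologicalSpace X]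
    [CompactSpace X] [LocallyCompactSpace X] [SecondCountableTopology X] [PseudoMetricSpace E]
    [SecondCountableTopology E] [MeasurableSpace C(X, E)] [BorelSpace C(X, E)] {Φ : Ω → C(X, E)}
    (h : ∀ t e, Measurable fun ω => dist (Φ ω t) e) : Measurable Φ := by
  refine measurable_of_measurable_dist fun f => measurable_of_Iic fun c => ?_
  obtain ⟨D, hD, hDd⟩ := TopologicalSpace.exists_countable_dense X
  by_cases hc : 0 ≤ c
  · have : (fun ω => dist (Φ ω) f) ⁻¹' Iic c = ⋂ t ∈ D, {ω | dist (Φ ω t) (f t) ≤ c} := by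
      ext ω
      simp only [mem_preimage, mem_Iic, mem_iInter, mem_ofPred_eq]
      rw [ContinuousMap.dist_le hc]
      refine ⟨fun h t _ => h t, fun h t => ?_⟩
      have hcl : IsClosed {t | dist (Φ ω t) (f t) ≤ c} :=
        isClosed_le ((Φ ω).continuous.dist f.continuous) continuous_const
      exact hcl.closure_subset_iff.2 h (hDd t)
    rw [this]
    exact MeasurableSet.biInter hD fun t _ => measurableSet_le (h t _) measurable_const
  · have : (fun ω => dist (Φ ω) f) ⁻¹' Iic c = ∅ := by
      ext ω
      simp only [mem_preimage, mem_Iic, mem_empty_iff_false, iff_false, not_le]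
      exact (not_le.1 hc).trans_le dist_nonneg
    rw [this]
    exact MeasurableSet.empty

/-- A random choice among countably many measurable functions. -/
theorem measurable_select {Ω ι E : Type*} [MeasurableSpace Ω] [MeasurableSpace E] [Countable ι]
    [MeasurableSpace ι] [MeasurableSingletonClass ι] {f : ι → Ω → E} {g : Ω → ι}
    (hf : ∀ i, Measurable (f i)) (hg : Measurable g) : Measurable fun ω => f (g ω) ω := by
  have : Measurable fun p : ι × Ω => f p.1 p.2 := measurable_from_prod_countable_right hf
  exact this.comp (hg.prodMk measurable_id)

namespace Model

variable {Ω : Type*} [MeasurableSpace Ω] {M : Model} {ε δ : ℝ} {Z : Ω → Wall → ℕ → ℝ}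

theorem measurable_nextWall (M : Model) {q p : Ω → ℝ} (hq : Measurable q) (hp : Measurable p) :
    Measurable fun ω => M.nextWall (q ω) (p ω) := by
  have habs : Measurable fun ω => |p ω| := hp.abs
  unfold nextWall
  refine Measurable.ite (measurableSet_lt measurable_const hp)
    (Measurable.ite ?_ measurable_const measurable_const)
    (Measurable.ite ?_ measurable_const measurable_const)
  · exact (measurableSet_lt hq measurable_const).inter (measurableSet_le habs measurable_const)
  · exact (measurableSet_lt measurable_const hq).inter (measurableSet_le habs measurable_const)

theorem measurable_state (hZ : ∀ w k, Measurable fun ω => Z ω w k) (n : ℕ) :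
    Measurable (fun ω => (M.state ε δ (Z ω) n).q) ∧ Measurable (fun ω => (M.state ε δ (Z ω) n).p) ∧
    Measurable (fun ω => M.hitTime ε δ (Z ω) n) ∧
    ∀ w, Measurable fun ω => (M.state ε δ (Z ω) n).hits w := by
  induction n with
  | zero =>
    exact ⟨measurable_const, measurable_const, measurable_const, fun _ => measurable_const⟩
  | succ n ih =>
    obtain ⟨hq, hp, ht, hh⟩ := ih
    have hw : Measurable fun ω => M.wallAt ε δ (Z ω) n := M.measurable_nextWall hq hp
    have hpos : Measurable fun ω => M.wallPos (M.wallAt ε δ (Z ω) n) :=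
      (Measurable.of_discrete (f := M.wallPos)).comp hw
    have hhw : Measurable fun ω => (M.state ε δ (Z ω) n).hits (M.wallAt ε δ (Z ω) n) :=
      measurable_select (f := fun w ω => (M.state ε δ (Z ω) n).hits w) hh hw
    have hloss : Measurable fun ω => M.lossAt ε δ (Z ω) n := by
      have hl : ∀ wk : Wall × ℕ, Measurable fun ω => M.loss δ (Z ω) wk.1 wk.2 := fun wk =>
        ((hZ _ _).const_mul δ).const_add _
      exact measurable_select (f := fun (wk : Wall × ℕ) ω => M.loss δ (Z ω) wk.1 wk.2) hl
        (hw.prodMk hhw)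
    refine ⟨hpos, ?_, ?_, fun w => ?_⟩
    · simp_rw [p_succ]
      exact hp.neg.mul ((hloss.const_mul ε).const_sub 1)
    · simp_rw [hitTime_succ]
      exact ht.add (((hpos.sub hq).abs).div hp.abs)
    · simp_rw [hits_succ]
      refine measurable_select (f := fun v ω => Function.update (M.state ε δ (Z ω) n).hits v
        ((M.state ε δ (Z ω) n).hits v + 1) w) (fun v => ?_) hw
      by_cases hvw : w = v
      · subst hvw
        simp only [Function.update_self]
        exact (Measurable.of_discrete (f := fun i : ℕ => i + 1)).comp (hh w)
      · simp only [Function.update_of_ne hvw]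
        exact hh w

theorem measurable_numHits {b B : ℝ} (hZ : ∀ w k, Measurable fun ω => Z ω w k)
    (hR : ∀ ω, M.Regular ε δ (Z ω) b B) {t : ℝ} (ht : 0 ≤ t) :
    Measurable fun ω => M.numHits ε δ (Z ω) t := by
  refine measurable_to_countable' fun n => ?_
  have : (fun ω => M.numHits ε δ (Z ω) t) ⁻¹' {n}
      = {ω | M.hitTime ε δ (Z ω) n ≤ t} ∩ {ω | t < M.hitTime ε δ (Z ω) (n + 1)} := by
    ext ω
    simp only [mem_preimage, mem_singleton_iff, mem_inter_iff, mem_ofPred_eq]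
    constructor
    · rintro rfl
      exact (hR ω).numHits_spec ht
    · rintro ⟨h1, h2⟩
      exact (hR ω).numHits_eq h1 h2
  rw [this]
  exact (measurableSet_le (measurable_state hZ n).2.2.1 measurable_const).inter
    (measurableSet_lt measurable_const (measurable_state hZ (n + 1)).2.2.1)

/-- Measurability is checked through real-valued distances on the graph. For each fixed number of
collisions these are explicit functions of the noise, and the random number of collisions selects
among countably many of them. -/
theorem measurable_slowPathC {b B : ℝ} (hZ : ∀ w k, Measurable fun ω => Z ω w k)
    (hR : ∀ ω, M.Regular ε δ (Z ω) b B) (T : ℝ) :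
    Measurable fun ω => M.slowPathC T ε δ (Z ω) := by
  have := Graph.secondCountableTopology M.hO_pos
  refine measurable_continuousMap fun t e => ?_
  -- The positivity of `ε` is contained in `hR` and needs a sample point.
  rcases isEmpty_or_nonempty Ω with hΩ | ⟨⟨ω₀⟩⟩
  · exact measurable_of_empty _
  have ht : 0 ≤ (t : ℝ) / ε := div_nonneg t.2.1 (hR ω₀).ε_pos.le
  have hrw : ∀ ω, dist (M.slowPathC T ε δ (Z ω) t) e
      = (fun (n : ℕ) ω => dist (Graph.point M.hO_pos (side ((M.state ε δ (Z ω) (n + 1)).q,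
        (M.state ε δ (Z ω) (n + 1)).p)) (M.segment ε δ (Z ω) n (t / ε))) e)
          (M.numHits ε δ (Z ω) (t / ε)) ω := fun ω => by
    rw [(hR ω).slowPathC_apply, (hR ω).slowPath_eq_segment t.2.1]
  suffices hn : ∀ n, Measurable fun ω => dist (Graph.point M.hO_pos
      (side ((M.state ε δ (Z ω) (n + 1)).q, (M.state ε δ (Z ω) (n + 1)).p))
      (M.segment ε δ (Z ω) n (t / ε))) e by
    rw [funext hrw]
    exact measurable_select hn (measurable_numHits hZ hR ht)
  intro n
  have henergy : ∀ n, Measurable fun ω => M.energyAt ε δ (Z ω) n := fun n =>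
    ((measurable_state hZ n).2.1.abs.pow_const 2).div_const 2
  have hseg : Measurable fun ω => M.segment ε δ (Z ω) n (t / ε) := by
    unfold segment
    exact (henergy n).add ((((measurable_state hZ n).2.2.1.const_sub _).div
      ((measurable_state hZ (n + 1)).2.2.1.sub (measurable_state hZ n).2.2.1)).mul
        ((henergy (n + 1)).sub (henergy n)))
  obtain ⟨hq, hp, -, -⟩ := measurable_state (M := M) (ε := ε) (δ := δ) hZ (n + 1)
  have hpt : ∀ w, Measurable fun ω =>
      dist (Graph.point M.hO_pos w (M.segment ε δ (Z ω) n (t / ε))) e := fun w => by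
    have hc : Continuous fun x : ℝ => dist (Graph.point M.hO_pos w x) e :=
      (Graph.continuous_point M.hO_pos w).dist continuous_const
    exact hc.measurable.comp hseg
  have hset : MeasurableSet {ω | (M.state ε δ (Z ω) (n + 1)).q < 0 ∨
      ((M.state ε δ (Z ω) (n + 1)).q = 0 ∧ (M.state ε δ (Z ω) (n + 1)).p < 0)} :=
    (measurableSet_lt hq measurable_const).union
      ((measurableSet_eq_fun hq measurable_const).inter (measurableSet_lt hp measurable_const))
  have heq : (fun ω => dist (Graph.point M.hO_pos (side ((M.state ε δ (Z ω) (n + 1)).q,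
      (M.state ε δ (Z ω) (n + 1)).p)) (M.segment ε δ (Z ω) n (t / ε))) e)
      = fun ω => if (M.state ε δ (Z ω) (n + 1)).q < 0 ∨
        ((M.state ε δ (Z ω) (n + 1)).q = 0 ∧ (M.state ε δ (Z ω) (n + 1)).p < 0)
        then dist (Graph.point M.hO_pos .left (M.segment ε δ (Z ω) n (t / ε))) e
        else dist (Graph.point M.hO_pos .right (M.segment ε δ (Z ω) n (t / ε))) e := by
    ext ω
    simp only [side]
    split_ifs <;> rfl
  rw [heq]
  exact Measurable.ite hset (hpt .left) (hpt .right)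

end Model
end NearlyElastic

namespace NearlyElastic
namespace Model

/-! ### The limiting law for general mean losses -/

/-- Positive mean losses at the three walls. -/
abbrev MeanLosses : Type := {C : Wall → ℝ // ∀ w, 0 < C w}

/-- Joint continuity in mean losses and time gives, by currying over the compact interval,
continuity of the limiting path in the uniform topology. -/
theorem continuous_profile (M : Model) (T : ℝ) (W : Well) :
    Continuous fun p : MeanLosses × Icc (0 : ℝ) T => M.profile p.1 W p.2 := by
  have hC : ∀ w, Continuous fun p : MeanLosses × Icc (0 : ℝ) T => (p.1 : Wall → ℝ) w := fun w =>
    (continuous_apply w).comp (continuous_subtype_val.comp continuous_fst)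
  have ht : Continuous fun p : MeanLosses × Icc (0 : ℝ) T => (p.2 : ℝ) :=
    continuous_subtype_val.comp continuous_snd
  have h1 : Continuous fun p : MeanLosses × Icc (0 : ℝ) T => M.topRate p.1 :=
    ((hC _).add (hC _)).div_const _
  have h2 : Continuous fun p : MeanLosses × Icc (0 : ℝ) T => M.trapRate p.1 W :=
    ((hC _).add (hC _)).div_const _
  have h3 : Continuous fun p : MeanLosses × Icc (0 : ℝ) T => M.vertexTime p.1 :=
    continuous_const.div h1 fun p => (topRate_pos p.1.2).ne'
  have h4 : Continuous fun p : MeanLosses × Icc (0 : ℝ) T => M.invSpeed p.1 W p.2 :=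
    (continuous_const.add (h1.mul (ht.min h3))).add (h2.mul ((ht.sub h3).max continuous_const))
  refine continuous_const.div (continuous_const.mul (h4.pow 2)) fun p => ?_
  have h5 : 1 / M.p₀ ≤ M.invSpeed p.1 W p.2 := le_invSpeed p.1.2 W p.2.2.1
  have h6 : 0 < 1 / M.p₀ := one_div_pos.2 M.p₀_pos
  have : 0 < M.invSpeed p.1 W p.2 := h6.trans_le h5
  positivity

/-- The limiting path that enters the well `W`. -/
def profilePath (M : Model) (T : ℝ) (W : Well) (C : MeanLosses) : PathSpace T M.hO where
  toFun t := Graph.point M.hO_pos W (M.profile C W t)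
  continuous_toFun := by
    have h : Continuous fun t : Icc (0 : ℝ) T => M.profile C.1 W t :=
      (M.continuous_profile T W).comp (f := fun t => (C, t)) (Continuous.prodMk_right C)
    exact (Graph.continuous_point M.hO_pos W).comp h

theorem continuous_profilePath (M : Model) (T : ℝ) (W : Well) :
    Continuous (M.profilePath T W) :=
  ContinuousMap.continuous_of_continuous_uncurry _
    ((Graph.continuous_point M.hO_pos W).comp (M.continuous_profile T W))

/-- The probability to enter the well `W`. -/
def wellProb (W : Well) (C : MeanLosses) : ℝ := C.1 W.outer / (C.1 .left + C.1 .right)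

theorem wellProb_nonneg (W : Well) (C : MeanLosses) : 0 ≤ wellProb W C :=
  div_nonneg (C.2 _).le (add_pos (C.2 _) (C.2 _)).le

theorem wellProb_add (C : MeanLosses) : wellProb .left C + wellProb .right C = 1 := by
  have := add_pos (C.2 .left) (C.2 .right)
  rw [wellProb, wellProb, ← add_div]
  exact div_self this.ne'

theorem continuous_wellProb (W : Well) : Continuous (wellProb W) := by
  have hC : ∀ w, Continuous fun C : MeanLosses => (C : Wall → ℝ) w := fun w =>
    (continuous_apply w).comp continuous_subtype_val
  exact (hC _).div ((hC _).add (hC _)) fun C => (add_pos (C.2 .left) (C.2 .right)).ne'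

/-- The limiting law. -/
def profileLaw (M : Model) (T : ℝ) (C : MeanLosses) : ProbabilityMeasure (PathSpace T M.hO) :=
  ⟨ENNReal.ofReal (wellProb .left C) • Measure.dirac (M.profilePath T .left C)
    + ENNReal.ofReal (wellProb .right C) • Measure.dirac (M.profilePath T .right C), by
    constructor
    simp only [Measure.coe_add, Measure.coe_smul, Pi.add_apply, Pi.smul_apply, measure_univ,
      smul_eq_mul, mul_one]
    rw [← ENNReal.ofReal_add (wellProb_nonneg _ _) (wellProb_nonneg _ _), wellProb_add,
      ENNReal.ofReal_one]⟩

theorem integral_profileLaw (M : Model) (T : ℝ) (C : MeanLosses) (F : PathSpace T M.hO →ᵇ ℝ) :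
    ∫ x, F x ∂(M.profileLaw T C : Measure (PathSpace T M.hO))
      = wellProb .left C * F (M.profilePath T .left C)
        + wellProb .right C * F (M.profilePath T .right C) := by
  have hi : ∀ W, Integrable F
      (ENNReal.ofReal (wellProb W C) • Measure.dirac (M.profilePath T W C)) := fun W => by
    refine Integrable.smul_measure ?_ ENNReal.ofReal_ne_top
    exact F.integrable _
  change ∫ x, F x ∂(ENNReal.ofReal (wellProb .left C) • Measure.dirac (M.profilePath T .left C)
    + ENNReal.ofReal (wellProb .right C) • Measure.dirac (M.profilePath T .right C)) = _
  rw [integral_add_measure (hi _) (hi _), integral_smul_measure, integral_smul_measure,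
    integral_dirac, integral_dirac, ENNReal.toReal_ofReal (wellProb_nonneg _ _),
    ENNReal.toReal_ofReal (wellProb_nonneg _ _), smul_eq_mul, smul_eq_mul]

/-- Both the weights and the two atoms vary continuously. This is all that the limit `δ ↓ 0`
requires. -/
theorem continuous_profileLaw (M : Model) (T : ℝ) : Continuous (M.profileLaw T) := by
  rw [continuous_iff_continuousAt]
  intro C
  refine ProbabilityMeasure.tendsto_iff_forall_integral_tendsto.2 fun F => ?_
  simp_rw [integral_profileLaw]
  have : Continuous fun C => wellProb .left C * F (M.profilePath T .left C)
        + wellProb .right C * F (M.profilePath T .right C) :=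
    ((continuous_wellProb _).mul (F.continuous.comp (M.continuous_profilePath T _))).add
      ((continuous_wellProb _).mul (F.continuous.comp (M.continuous_profilePath T _)))
  exact this.tendsto C

/-- The constants of the walls as mean losses. -/
def wallLosses (M : Model) : MeanLosses :=
  ⟨M.c, fun w => by cases w; exacts [M.c₁_pos, M.c₃_pos, M.c₂_pos]⟩

/-- The energy to the power `-1 / 2` is `√2` times the inverse speed; this is the origin of the
factors `√2` in the limiting process. -/
theorem half_sq_rpow {p : ℝ} (hp : 0 < p) : (p ^ 2 / 2) ^ (-1 / 2 : ℝ) = √2 * (1 / p) := by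
  rw [neg_div, Real.rpow_neg (by positivity), ← Real.sqrt_eq_rpow, Real.sqrt_div (by positivity),
    Real.sqrt_sq hp.le]
  field_simp

theorem vertexTime_wallLosses (M : Model) : M.vertexTime M.c = M.t₀ := by
  have h1 := M.a₁_pos
  have h2 := M.a₂_pos
  have h3 := M.c₁_pos
  have h4 := M.c₂_pos
  have h5 := M.p₀_pos
  have h6 := M.pO_pos
  have hs : √2 * √2 = 2 := Real.mul_self_sqrt (by norm_num)
  rw [vertexTime, t₀, topRate, hO, h₀, half_sq_rpow h5, half_sq_rpow h6, ← mul_sub,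
    show √2 * (M.a₁ + M.a₂) * (√2 * (1 / M.pO - 1 / M.p₀))
      = √2 * √2 * ((M.a₁ + M.a₂) * (1 / M.pO - 1 / M.p₀)) by ring, hs]
  simp only [c]
  field_simp

theorem rpow_neg_two_sqrt_two_mul {x y : ℝ} (h : y = √2 * x) :
    y ^ (-2 : ℝ) = 1 / (2 * x ^ 2) := by
  rw [h, show (-2 : ℝ) = ((-2 : ℤ) : ℝ) by norm_num, Real.rpow_intCast, zpow_neg, one_div]
  congr 1
  rw [zpow_ofNat, mul_pow, Real.sq_sqrt (by norm_num)]

theorem profile_wallLosses (M : Model) (W : Well) (t : ℝ) :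
    M.profile M.c W t = M.limitEnergy W t := by
  have hs : √2 * √2 = 2 := Real.mul_self_sqrt (by norm_num)
  have hs0 : 0 < √2 := by positivity
  have hdiv : ∀ x : ℝ, x / √2 = √2 * (x / 2) := fun x => by
    rw [div_eq_iff hs0.ne']
    linear_combination (-x / 2) * hs
  have h1 := M.a₁_pos
  have h2 := M.a₂_pos
  have hw := M.wellWidth_pos W
  rw [profile, limitEnergy, invSpeed, vertexTime_wallLosses]
  split_ifs with h
  · symm
    rw [limitEnergyTop, min_eq_left h, max_eq_right (by linarith), h₀, half_sq_rpow M.p₀_pos, hdiv]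
    refine rpow_neg_two_sqrt_two_mul ?_
    rw [topRate]
    simp only [c]
    field_simp
    ring
  · push Not at h
    symm
    have ht : M.topRate M.c * M.t₀ = 1 / M.pO - 1 / M.p₀ := by
      rw [← vertexTime_wallLosses]
      exact topRate_mul_vertexTime M.wallLosses.2
    rw [limitEnergyTrap, min_eq_right h.le, max_eq_left (by linarith), hO, half_sq_rpow M.pO_pos,
      hdiv, ht]
    refine rpow_neg_two_sqrt_two_mul ?_
    have hc : M.trapRate M.c W = (M.wellC W + M.c₃) / (2 * M.wellWidth W) := by
      rw [trapRate]
      cases W <;> rfl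
    rw [hc]
    field_simp
    ring

theorem profileLaw_wallLosses (M : Model) (T : ℝ) : M.profileLaw T M.wallLosses = M.limitLaw T := by
  have hp : ∀ W, M.profilePath T W M.wallLosses = M.limitPath T W := fun W => by
    ext1 t
    exact congrArg (Graph.point M.hO_pos W) (M.profile_wallLosses W t)
  have hb : ∀ W, wellProb W M.wallLosses = M.branchProb W := fun W => by
    cases W <;> rfl
  apply Subtype.ext
  change ENNReal.ofReal (wellProb .left M.wallLosses) •
      Measure.dirac (M.profilePath T .left M.wallLosses)
    + ENNReal.ofReal (wellProb .right M.wallLosses) •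
      Measure.dirac (M.profilePath T .right M.wallLosses) = _
  rw [hp, hp, hb, hb]
  rfl

/-! ### Convergence for noise that is bounded everywhere -/

section

variable {Ω : Type*} [MeasurableSpace Ω] {P : Measure Ω} [IsProbabilityMeasure P]

/-- The law of large numbers for the losses at a wall. -/
theorem ae_tendsto_average_loss {Y : Wall → ℕ → Ω → ℝ} {C : ℝ}
    (hmeas : ∀ w k, Measurable (Y w k)) (hindep : iIndepFun (fun wk : Wall × ℕ => Y wk.1 wk.2) P)
    (hident : ∀ w k, IdentDistrib (Y w k) (Y w 0) P P) (hbdd : ∀ w k ω, |Y w k ω| ≤ C) :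
    ∀ᵐ ω ∂P, ∀ w, Tendsto (fun n : ℕ => (∑ k ∈ Finset.range n, Y w k ω) / n) atTop
      (𝓝 (∫ ω, Y w 0 ω ∂P)) := by
  rw [ae_all_iff]
  intro w
  refine strong_law_ae_real (fun k => Y w k) ?_ (fun i j hij => ?_) (hident w)
  · exact Integrable.of_bound (hmeas w 0).aestronglyMeasurable C (ae_of_all _ (hbdd w 0))
  · exact hindep.indepFun (i := (w, i)) (j := (w, j)) (by simpa using hij)

/-- Weak convergence as `ε ↓ 0` for a fixed `δ`. -/
theorem convergesWeakly_slowPathC (M : Model) {noise : Wall → ℕ → Ω → ℝ} {δ b B T : ℝ}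
    (hmeas : ∀ w k, Measurable (noise w k))
    (hindep : iIndepFun (fun wk : Wall × ℕ => noise wk.1 wk.2) P)
    (hident : ∀ w k, IdentDistrib (noise w k) (noise w 0) P P) (hb : 0 < b)
    (hle : ∀ w k ω, b ≤ M.loss δ (fun w k => noise w k ω) w k)
    (hge : ∀ w k ω, M.loss δ (fun w k => noise w k ω) w k ≤ B)
    (hmin : ∀ w, HasMinorant P fun ω => M.loss δ (fun w k => noise w k ω) w 0) (hT : 0 < T)
    (C : MeanLosses) (hC : ∀ w, C.1 w = ∫ ω, M.loss δ (fun w k => noise w k ω) w 0 ∂P) :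
    ConvergesWeakly P (fun ε ω => M.slowPathC T ε δ fun w k => noise w k ω) (𝓝[>] 0)
      (M.profileLaw T C : Measure (PathSpace T M.hO)) := by
  obtain ⟨ω₀⟩ : Nonempty Ω := nonempty_of_isProbabilityMeasure P
  set Y : Wall → ℕ → Ω → ℝ := fun w k ω => M.loss δ (fun w k => noise w k ω) w k with hY
  have hB : 0 < B := hb.trans_le ((hle .left 0 ω₀).trans (hge .left 0 ω₀))
  have haff : ∀ w, Measurable fun x : ℝ => M.c w + δ * x := fun w => by fun_prop
  have hYm : ∀ w k, Measurable (Y w k) := fun w k => (haff w).comp (hmeas w k)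
  have hYindep : iIndepFun (fun wk : Wall × ℕ => Y wk.1 wk.2) P :=
    hindep.comp (fun wk x => M.c wk.1 + δ * x) fun wk => haff wk.1
  have hYident : ∀ w k, IdentDistrib (Y w k) (Y w 0) P P := fun w k => (hident w k).comp (haff w)
  have hYabs : ∀ w k ω, |Y w k ω| ≤ B := fun w k ω => by
    rw [abs_of_nonneg (hb.le.trans (hle w k ω))]
    exact hge w k ω
  have hYi : ∀ w, Integrable (Y w 0) P := fun w =>
    Integrable.of_bound (hYm w 0).aestronglyMeasurable B (ae_of_all _ (hYabs w 0))
  have hCB : ∀ w, C.1 w ≤ B := fun w => by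
    have := integral_mono (hYi w) (integrable_const B) fun ω => hge w 0 ω
    rw [hC]
    simpa using this
  have hreg : ∀ᶠ ε in 𝓝[>] (0 : ℝ), ∀ ω, M.Regular ε δ (fun w k => noise w k ω) b B := by
    have h1 : ∀ᶠ ε in 𝓝[>] (0 : ℝ), ε < 1 / (2 * B) :=
      mem_nhdsWithin_of_mem_nhds (gt_mem_nhds (by positivity))
    filter_upwards [h1, self_mem_nhdsWithin] with ε h1 (hε : 0 < ε) ω
    refine ⟨hε, hb, fun w k => hle w k ω, fun w k => hge w k ω, ?_⟩
    rw [lt_div_iff₀ (by positivity)] at h1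
    linarith
  have hmeasC : ∀ᶠ ε in 𝓝[>] (0 : ℝ),
      Measurable fun ω => M.slowPathC T ε δ fun w k => noise w k ω :=
    hreg.mono fun ε h => measurable_slowPathC hmeas h T
  refine ⟨hmeasC.mono fun ε h => h.aemeasurable, fun F => ?_⟩
  -- the event that the particle enters the right well
  set L := Real.log (M.p₀ / M.pO) with hL
  have hL0 : 0 < L := Real.log_pos ((one_lt_div M.pO_pos).2 M.pO_lt)
  set S : ℝ → Set Ω := fun ε => {ω | InFirst (fun i => logStep ε (Y .right i ω))
    (fun i => logStep ε (Y .left i ω)) (L / ε)} with hS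
  have hSm : ∀ ε, MeasurableSet (S ε) := fun ε =>
    measurableSet_inFirst (fun i => (measurable_logStep ε).comp (hYm _ i))
      (fun i => (measurable_logStep ε).comp (hYm _ i)) measurable_const
  have hSprob : Tendsto (fun ε => P.real (S ε)) (𝓝[>] 0) (𝓝 (wellProb .right C)) := by
    have := tendsto_passProb_logStep hb hYm hYindep hYident hle hge hmin hL0
    rw [← hC, ← hC, add_comm] at this
    exact this
  -- The well depends on `ε`, so no fixed pointwise limit of the path is available. `G ε` evaluates
  -- `F` at the limiting path of the current well: its mean is governed by the branching
  -- probability, and its difference from `F` of the actual path tends to `0` almost surely.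
  set G : ℝ → Ω → ℝ := fun ε => (S ε).indicator (fun _ => F (M.profilePath T .right C))
    + (S ε)ᶜ.indicator (fun _ => F (M.profilePath T .left C)) with hG
  have hGi : ∀ ε, Integrable (G ε) P := fun ε =>
    ((integrable_const _).indicator (hSm ε)).add ((integrable_const _).indicator (hSm ε).compl)
  have hGint : ∀ ε, ∫ ω, G ε ω ∂P = P.real (S ε) * F (M.profilePath T .right C)
      + (1 - P.real (S ε)) * F (M.profilePath T .left C) := fun ε => by
    rw [hG]
    simp only [Pi.add_apply]
    rw [integral_add ((integrable_const _).indicator (hSm ε))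
      ((integrable_const _).indicator (hSm ε).compl), integral_indicator_const _ (hSm ε),
      integral_indicator_const _ (hSm ε).compl, probReal_compl_eq_one_sub (hSm ε), smul_eq_mul,
      smul_eq_mul]
  have hGlim : Tendsto (fun ε => ∫ ω, G ε ω ∂P) (𝓝[>] 0)
      (𝓝 (∫ x, F x ∂(M.profileLaw T C : Measure (PathSpace T M.hO)))) := by
    rw [integral_profileLaw, add_comm]
    simp_rw [hGint]
    have h1 : 1 - wellProb .right C = wellProb .left C := by linarith [wellProb_add C]
    have := (hSprob.mul_const (F (M.profilePath T .right C))).add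
      ((hSprob.const_sub 1).mul_const (F (M.profilePath T .left C)))
    simpa [h1] using this
  -- the path is close to the limiting path of its well
  have hdiff : Tendsto (fun ε => ∫ ω, (F (M.slowPathC T ε δ fun w k => noise w k ω) - G ε ω) ∂P)
      (𝓝[>] 0) (𝓝 (∫ _, (0 : ℝ) ∂P)) := by
    refine tendsto_integral_filter_of_dominated_convergence (fun _ => 2 * ‖F‖) ?_ ?_
      (integrable_const _) ?_
    · filter_upwards [hmeasC] with ε h
      exact ((F.continuous.measurable.comp h).aestronglyMeasurable).sub (hGi ε).1
    · refine Eventually.of_forall fun ε => ae_of_all _ fun ω => ?_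
      refine (norm_sub_le _ _).trans ?_
      have h1 : ‖G ε ω‖ ≤ ‖F‖ := by
        by_cases hω : ω ∈ S ε
        · simpa [hG, hω] using F.norm_coe_le_norm (M.profilePath T .right C)
        · simpa [hG, hω] using F.norm_coe_le_norm (M.profilePath T .left C)
      linarith [F.norm_coe_le_norm (M.slowPathC T ε δ fun w k => noise w k ω)]
    · filter_upwards [ae_tendsto_average_loss hYm hYindep hYident hYabs] with ω hω
      rw [Metric.tendsto_nhds]
      intro η hη
      have hcont : ∀ W, ∃ κ > 0, ∀ f, dist f (M.profilePath T W C) < κ →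
          dist (F f) (F (M.profilePath T W C)) < η := fun W =>
        Metric.continuousAt_iff.1 F.continuous.continuousAt η hη
      choose κ hκ0 hκ using hcont
      -- One tolerance for both wells, as the well may change with `ε`; halving it makes the
      -- comparison strict.
      set κ' := min (κ .left) (κ .right) / 2 with hκ'
      have hκ'0 : 0 < κ' := half_pos (lt_min (hκ0 _) (hκ0 _))
      have hκ'lt : ∀ W, κ' < κ W := fun W => by
        have := lt_min (hκ0 .left) (hκ0 .right)
        cases W
        · exact (half_lt_self this).trans_le (min_le_left _ _)
        · exact (half_lt_self this).trans_le (min_le_right _ _)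
      have hev := M.eventually_abs_segment_sub_le C.2 hb hT (δ := δ)
        (z := fun w k => noise w k ω) (fun w k => hle w k ω) (fun w k => hge w k ω) hCB
        (fun w => by rw [hC]; exact hω w) hκ'0
      filter_upwards [hev] with ε ⟨hR, hseg⟩
      obtain ⟨m, hm⟩ := hR.exists_crossing
      have hdist : dist (M.slowPathC T ε δ fun w k => noise w k ω)
          (M.profilePath T (crossingWell m) C) < κ (crossingWell m) := by
        refine lt_of_le_of_lt ((ContinuousMap.dist_le hκ'0.le).2 fun t => ?_) (hκ'lt _)
        rw [hR.slowPathC_apply, hR.slowPath_eq hm t.2.1]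
        exact (Graph.dist_point_le _ _ _ _).trans (hseg m hm t t.2)
      have hF := hκ _ _ hdist
      have hGω : G ε ω = F (M.profilePath T (crossingWell m) C) := by
        have hiff : ω ∈ S ε ↔ crossingWell m = .right := hR.inFirst_iff hm
        rcases hW : crossingWell m with _ | _
        · have : ω ∉ S ε := fun h => by
            rw [hiff, hW] at h
            cases h
          simp [hG, this]
        · have : ω ∈ S ε := hiff.2 hW
          simp [hG, this]
      rw [hGω, dist_zero_right, ← dist_eq_norm]
      exact hF
  have hfin := hdiff.add hGlim
  rw [integral_zero, zero_add] at hfin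
  refine hfin.congr' ?_
  filter_upwards [hmeasC] with ε h
  rw [← integral_add _ (hGi ε)]
  · simp
  · refine Integrable.sub ?_ (hGi ε)
    exact Integrable.of_bound (F.continuous.measurable.comp h).aestronglyMeasurable ‖F‖
      (ae_of_all _ fun ω => F.norm_coe_le_norm _)

end

end Model

end NearlyElastic

namespace NearlyElastic

/-! ### From almost surely bounded noise to noise bounded everywhere -/

variable {Ω : Type*} [MeasurableSpace Ω] {P : Measure Ω}

theorem HasMinorant.add_mul {X : Ω → ℝ} (hX : Measurable X) (h : HasMinorant P X) (c : ℝ) {δ : ℝ}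
    (hδ : 0 < δ) : HasMinorant P fun ω => c + δ * X ω := by
  obtain ⟨η, a, b, hη, hab, hle⟩ := h
  have hK : 0 < Real.toNNReal δ := Real.toNNReal_pos.2 hδ
  refine ⟨η / Real.toNNReal δ, c + δ * a, c + δ * b, div_pos hη hK, by gcongr, ?_⟩
  refine minorant_comp (F := fun x => c + δ * x) hX hK hle (by fun_prop) ?_ ?_
  · refine LipschitzOnWith.of_dist_le_mul fun x _ y _ => le_of_eq ?_
    rw [Real.dist_eq, Real.dist_eq, Real.coe_toNNReal _ hδ.le,
      show c + δ * x - (c + δ * y) = δ * (x - y) by ring, abs_mul, abs_of_pos hδ]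
  · rintro y ⟨h1, h2⟩
    refine ⟨(y - c) / δ, ⟨?_, ?_⟩, ?_⟩
    · rw [le_div_iff₀ hδ]
      linarith
    · rw [div_le_iff₀ hδ]
      linarith
    · field_simp
      ring

theorem ConvergesWeakly.congr {ι E : Type*} [TopologicalSpace E] [MeasurableSpace E]
    {X X' : ι → Ω → E} {l : Filter ι} {ν : Measure E} (h : ConvergesWeakly P X l ν)
    (hX : ∀ i, X i =ᵐ[P] X' i) : ConvergesWeakly P X' l ν := by
  refine ⟨h.1.mono fun i hi => hi.congr (hX i), fun F => (h.2 F).congr fun i => ?_⟩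
  exact integral_congr_ae ((hX i).fun_comp F)

/-- A real number, replaced by the midpoint of `(α, β)` outside of this interval. -/
def truncate (α β x : ℝ) : ℝ := if α < x ∧ x < β then x else (α + β) / 2

theorem measurable_truncate (α β : ℝ) : Measurable (truncate α β) :=
  Measurable.ite measurableSet_Ioo measurable_id measurable_const

theorem truncate_mem {α β : ℝ} (h : α < β) (x : ℝ) : truncate α β x ∈ Ioo α β := by
  unfold truncate
  split_ifs with hx
  · exact hx
  · constructor <;> linarith

namespace Model

variable [IsProbabilityMeasure P] {noise : Wall → ℕ → Ω → ℝ} {α β T : ℝ}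

/-- The mean noise stays in the range of the noise. -/
theorem le_integral_noise (hmeas : ∀ w k, Measurable (noise w k))
    (hbdd : ∀ w k ω, noise w k ω ∈ Ioo α β) (w : Wall) :
    Integrable (noise w 0) P ∧ α ≤ ∫ ω, noise w 0 ω ∂P := by
  have hi : Integrable (noise w 0) P := Integrable.of_mem_Icc α β (hmeas w 0).aemeasurable
    (ae_of_all _ fun ω => Ioo_subset_Icc_self (hbdd w 0 ω))
  refine ⟨hi, ?_⟩
  have := integral_mono (μ := P) (integrable_const α) hi fun ω => (hbdd w 0 ω).1.le
  simpa using this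

open Classical in
/-- The limiting law as `ε ↓ 0`, in terms of the mean values `m` of the noise. -/
def meanLaw (M : Model) (T : ℝ) (m : Wall → ℝ) (δ : ℝ) : ProbabilityMeasure (PathSpace T M.hO) :=
  if h : ∀ w, 0 < M.c w + δ * m w then M.profileLaw T ⟨_, h⟩ else M.limitLaw T

theorem tendsto_meanLaw (M : Model) (T : ℝ) (m : Wall → ℝ) :
    Tendsto (M.meanLaw T m) (𝓝[>] 0) (𝓝 (M.limitLaw T)) := by
  have hlim : ∀ w, Tendsto (fun δ : ℝ => M.c w + δ * m w) (𝓝[>] 0) (𝓝 (M.c w)) := fun w => by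
    have : Continuous fun δ : ℝ => M.c w + δ * m w := by fun_prop
    simpa using (this.tendsto 0).mono_left nhdsWithin_le_nhds
  have hpos : ∀ᶠ δ in 𝓝[>] (0 : ℝ), ∀ w, 0 < M.c w + δ * m w :=
    eventually_all.2 fun w => (hlim w).eventually (lt_mem_nhds (M.wallLosses.2 w))
  classical
  -- For small `δ` all mean losses are positive; the default value elsewhere does not affect the
  -- limit.
  set C : ℝ → MeanLosses := fun δ =>
    if h : ∀ w, 0 < M.c w + δ * m w then ⟨_, h⟩ else M.wallLosses with hC
  have hCtop : Tendsto C (𝓝[>] 0) (𝓝 M.wallLosses) := by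
    refine tendsto_subtype_rng.2 (tendsto_pi_nhds.2 fun w => (hlim w).congr' ?_)
    filter_upwards [hpos] with δ h
    simp [hC, h]
  have := ((M.continuous_profileLaw T).tendsto M.wallLosses).comp hCtop
  rw [profileLaw_wallLosses] at this
  refine this.congr' ?_
  filter_upwards [hpos] with δ h
  simp [hC, meanLaw, h]

/-- The convergence as `ε ↓ 0` for noise with values in `(α, β)`. -/
theorem slowPath_convergence (M : Model) (hmeas : ∀ w k, Measurable (noise w k))
    (hindep : iIndepFun (fun wk : Wall × ℕ => noise wk.1 wk.2) P)
    (hident : ∀ w k, IdentDistrib (noise w k) (noise w 0) P P)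
    (hmin : ∀ w, HasMinorant P (noise w 0)) (hbdd : ∀ w k ω, noise w k ω ∈ Ioo α β)
    (hT : 0 < T) {δ : ℝ} (hδ : 0 < δ) (hα : ∀ w, 0 < M.c w + δ * α) :
    (∀ᶠ ε in 𝓝[>] (0 : ℝ), ∀ ω,
      ContinuousOn (M.slowPath ε δ fun w k => noise w k ω) (Ici 0)) ∧
    ConvergesWeakly P (fun ε ω => M.slowPathC T ε δ fun w k => noise w k ω) (𝓝[>] 0)
      (M.meanLaw T (fun w => ∫ ω, noise w 0 ω ∂P) δ : Measure (PathSpace T M.hO)) := by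
  obtain ⟨ω₀⟩ : Nonempty Ω := nonempty_of_isProbabilityMeasure P
  have : Nonempty Wall := ⟨.left⟩
  -- The smallest and the largest possible loss over the three walls serve as the bounds `b` and
  -- `B`.
  obtain ⟨w₁, hw₁⟩ := Finite.exists_min fun w => M.c w + δ * α
  obtain ⟨w₂, hw₂⟩ := Finite.exists_max fun w => M.c w + δ * β
  set b := M.c w₁ + δ * α
  set B := M.c w₂ + δ * β
  have hle : ∀ w k ω, b ≤ M.loss δ (fun w k => noise w k ω) w k := fun w k ω => by
    refine (hw₁ w).trans ?_
    have := (hbdd w k ω).1.le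
    rw [loss]
    gcongr
  have hge : ∀ w k ω, M.loss δ (fun w k => noise w k ω) w k ≤ B := fun w k ω => by
    refine le_trans ?_ (hw₂ w)
    have := (hbdd w k ω).2.le
    rw [loss]
    gcongr
  have hB : 0 < B := (hα w₁).trans_le ((hle w₁ 0 ω₀).trans (hge w₁ 0 ω₀))
  have hpos : ∀ w, 0 < M.c w + δ * ∫ ω, noise w 0 ω ∂P := fun w => by
    have := (le_integral_noise (P := P) hmeas hbdd w).2
    refine (hα w).trans_le ?_
    gcongr
  constructor
  · have h1 : ∀ᶠ ε in 𝓝[>] (0 : ℝ), ε < 1 / (2 * B) :=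
      mem_nhdsWithin_of_mem_nhds (gt_mem_nhds (by positivity))
    filter_upwards [h1, self_mem_nhdsWithin] with ε h1 (hε : 0 < ε) ω
    have : M.Regular ε δ (fun w k => noise w k ω) b B := by
      refine ⟨hε, hα w₁, fun w k => hle w k ω, fun w k => hge w k ω, ?_⟩
      rw [lt_div_iff₀ (by positivity)] at h1
      linarith
    exact this.continuousOn_slowPath
  · rw [meanLaw, dif_pos hpos]
    refine M.convergesWeakly_slowPathC hmeas hindep hident (hα w₁) hle hge
      (fun w => (hmin w).add_mul (hmeas w 0) (M.c w) hδ) hT _ fun w => ?_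
    have hi := (le_integral_noise (P := P) hmeas hbdd w).1
    simp only [loss]
    rw [integral_add (integrable_const _) (hi.const_mul δ), integral_const_mul]
    simp

end Model

end NearlyElastic

end

open NearlyElastic in
theorem theorem3p1 (M : Model) {Ω : Type*} [MeasurableSpace Ω] (P : Measure Ω)
    [IsProbabilityMeasure P] (noise : Wall → ℕ → Ω → ℝ)
    (hmeas : ∀ w k, Measurable (noise w k))
    (hindep : iIndepFun (fun wk : Wall × ℕ => noise wk.1 wk.2) P)
    (hident : ∀ w k, IdentDistrib (noise w k) (noise w 0) P P)
    (hdens : ∀ w, HasContinuousDensity P (noise w 0))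
    (α β : ℝ) (hbdd : ∀ w, ∀ᵐ ω ∂P, α < noise w 0 ω ∧ noise w 0 ω < β)
    (T : ℝ) (hT : 0 < T) :
    ∃ ν : ℝ → ProbabilityMeasure (PathSpace T M.hO),
      (∀ δ : ℝ, 0 < δ → (∀ w, 0 < M.c w + δ * α) →
        (∀ᶠ ε in 𝓝[>] (0 : ℝ), ∀ᵐ ω ∂P,
          ContinuousOn (M.slowPath ε δ fun w k => noise w k ω) (Set.Ici 0)) ∧
        ConvergesWeakly P (fun ε ω => M.slowPathC T ε δ fun w k => noise w k ω) (𝓝[>] 0)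
          (ν δ : Measure (PathSpace T M.hO))) ∧
      Tendsto ν (𝓝[>] 0) (𝓝 (M.limitLaw T)) := by
  have hαβ : α < β := by
    obtain ⟨ω, h1, h2⟩ := (hbdd .left).exists
    exact h1.trans h2
  have hmt := measurable_truncate α β
  -- Truncation makes the bounds hold at every sample point. It keeps independence and equality of
  -- laws, and alters the noise only on a null set.
  set noise' : Wall → ℕ → Ω → ℝ := fun w k ω => truncate α β (noise w k ω) with hnoise'
  have hae : ∀ᵐ ω ∂P, (fun w k => noise' w k ω) = fun w k => noise w k ω := by
    have : ∀ᵐ ω ∂P, ∀ w k, noise w k ω ∈ Ioo α β :=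
      ae_all_iff.2 fun w => ae_all_iff.2 fun k =>
        -- The bounds are given for the first variable of each sequence and pass to the others by
        -- equality of laws.
        (hident w k).symm.ae_mem_snd measurableSet_Ioo (hbdd w)
    filter_upwards [this] with ω hω
    funext w k
    exact if_pos (hω w k)
  have hmin : ∀ w, HasMinorant P (noise' w 0) := fun w => by
    have hmap : P.map (noise' w 0) = P.map (noise w 0) :=
      Measure.map_congr (hae.mono fun ω h => congrFun (congrFun h w) 0)
    have := (hdens w).hasMinorant (hmeas w 0)
    rwa [HasMinorant, ← hmap] at this
  refine ⟨M.meanLaw T fun w => ∫ ω, noise' w 0 ω ∂P, fun δ hδ hα => ?_, M.tendsto_meanLaw T _⟩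
  obtain ⟨h1, h2⟩ := M.slowPath_convergence (P := P) (noise := noise') (β := β)
    (fun w k => hmt.comp (hmeas w k)) (hindep.comp (fun _ => truncate α β) fun _ => hmt)
    (fun w k => (hident w k).comp hmt) hmin (fun w k ω => truncate_mem hαβ _) hT hδ hα
  refine ⟨h1.mono fun ε h => hae.mono fun ω hω => ?_,
    h2.congr fun ε => hae.mono fun ω hω => congrArg (M.slowPathC T ε δ) hω⟩
  rw [← hω]
  exact h ω
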